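/- Let $n\ge 1$, $s\in(0,1)$, $T>0$, and let $\Omega\subset\mathbb{R}^n$ be open and bounded. Let $A:\mathbb{R}^n\to\mathbb{R}^{n\times n}$ be measurable, symmetric, bounded and uniformly elliptic: there are $0<\lambda_{\min}\le\lambda_{\max}<\infty$ with $\lambda_{\min}|\mathbf v|^2\le \mathbf v\cdot A(x)\mathbf v\le\lambda_{\max}|\mathbf v|^2$ for all $x,\mathbf v\in\mathbb{R}^n$. Let $$H^s_\Omega=\Big\{v\in L^2(\mathbb{R}^n):\ v=0 \text{ a.e. in } \mathbb{R}^n\setminus\Omega,\ \|v\|_{H^s_\Omega}^2:=\int_{\mathbb{R}^n}\!\int_{\mathbb{R}^n}\frac{|v(x)-v(y)|^2}{|x-y|^{n+2s}}\,dx\,dy<\infty\Big\},$$ and let $(H^s_\Omega)'$ be its dual with the operator norm. Put $$C_{n,s}=\frac{4^s\,\Gamma(s+\frac n2)}{\pi^{n/2}|\Gamma(-s)|},\qquad C_\omega=\frac{2^s\,\Gamma(\frac{n+s+1}2)}{\pi^{n/2}\,\Gamma(\frac{1-s}2)},\qquad \omega(x,y)=C_\omega|x-y|^{-(n+s)},\qquad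 \alpha(x,y)=\frac{y-x}{|y-x|},$$ $$\mathcal G_\omega u(x)=\lim_{\varepsilon\to0^+}\int_{|y-x|\ge\varepsilon}\omega(x,y)\,(u(y)-u(x))\,\alpha(x,y)\,dy\quad\text{(limit in } L^2(\mathbb{R}^n;\mathbb{R}^n)),\qquad \mathcal B_{\omega;A}(u,v)=\int_{\mathbb{R}^n}\mathcal G_\omega u(x)\cdot A(x)\,\mathcal G_\omega v(x)\,dx .$$ The limit $\mathcal G_\omega v$ exists for every $v\in H^s_\Omega$, and $H^s_\Omega$ satisfies a Poincaré inequality: there is a constant $C_p$ with $\|v\|_{L^2(\Omega)}\le C_p\|v\|_{H^s_\Omega}$ for all $v\in H^s_\Omega$. Let $f\in L^2(0,T;(H^s_\Omega)')$ and $u_0\in H^s_\Omega$. Then there is a unique $u^*\in L^2(0,T;H^s_\Omega)$, with weak time derivative $\partial_t u^*\in L^2(0,T;(H^s_\Omega)')$ and with a representative in $C([0,T];L^2(\Omega))$, such that $u^*(\cdot,0)=u_0$ and, for almost every $t\in(0,T)$, $$\langle\partial_t u^*(t),v\rangle+\mathcal B_{\omega;A}(u^*(t),v)=\langle f(t),v\rangle\qquad\text{for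 all } v\in H^s_\Omega .$$ Moreover, with $C_{\rm coer}=\frac{C_{n,s}}2\lambda_{\min}$ and any constant $C_p\ge\sqrt2$ for which the Poincaré inequality above holds, the continuous representative of $u^*$ satisfies, for all $t\in[0,T]$, $$\|u^*(\cdot,t)\|_{L^2(\Omega)}^2+C_{\rm coer}\int_0^t\|u^*(\cdot,r)\|_{H^s_\Omega}^2\,dr\ \le\ \|u_0\|_{L^2(\Omega)}^2+\frac{C_p^2}{2C_{\rm coer}}\int_0^t\|f(\cdot,r)\|_{(H^s_\Omega)'}^2\,dr .$$ -/

import Mathlib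

open MeasureTheory Filter Topology
open scoped ContDiff

noncomputable section

namespace FracDiff

/-- The Euclidean space `ℝⁿ`. -/
abbrev Eucl (n : ℕ) : Type := EuclideanSpace ℝ (Fin n)

/-- The space `L²(ℝⁿ)`. -/
abbrev L2 (n : ℕ) : Type := Lp ℝ 2 (volume : Measure (Eucl n))

/-! ### The fractional Sobolev space with zero exterior values -/

/-- The weighted difference quotient `(v(x) - v(y)) / |x - y|^(n/2 + s)`. -/
def diffQuot {n : ℕ} (s : ℝ) (v : Eucl n → ℝ) (p : Eucl n × Eucl n) : ℝ :=
  (v p.1 - v p.2) / ‖p.1 - p.2‖ ^ ((n : ℝ) / 2 + s)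

theorem diffQuot_congr {n : ℕ} (s : ℝ) {v w : Eucl n → ℝ} (h : v =ᵐ[volume] w) :
    diffQuot s v =ᵐ[volume.prod volume] diffQuot s w := by
  have h1 := (Measure.quasiMeasurePreserving_fst
    (μ := (volume : Measure (Eucl n))) (ν := (volume : Measure (Eucl n)))).ae_eq h
  have h2 := (Measure.quasiMeasurePreserving_snd
    (μ := (volume : Measure (Eucl n))) (ν := (volume : Measure (Eucl n)))).ae_eq h
  filter_upwards [h1, h2] with p hp1 hp2
  simp only [Function.comp] at hp1 hp2
  simp [diffQuot, hp1, hp2]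

theorem diffQuot_add {n : ℕ} (s : ℝ) (v w : L2 n) :
    diffQuot s (v + w : L2 n) =ᵐ[volume.prod volume] diffQuot s v + diffQuot s w := by
  refine (diffQuot_congr s (Lp.coeFn_add v w)).trans (Eventually.of_forall fun p => ?_)
  simp only [diffQuot, Pi.add_apply]
  ring

theorem diffQuot_smul {n : ℕ} (s c : ℝ) (v : L2 n) :
    diffQuot s (c • v : L2 n) =ᵐ[volume.prod volume] c • diffQuot s v := by
  refine (diffQuot_congr s (Lp.coeFn_smul c v)).trans (Eventually.of_forall fun p => ?_)
  simp only [diffQuot, Pi.smul_apply, smul_eq_mul]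
  ring

/-- `H^s_Ω(ℝⁿ)` as a subspace of `L²(ℝⁿ)`: the functions `v` that vanish almost everywhere outside
`Ω` and satisfy `∬ |v(x) - v(y)|² / |x - y|^(n + 2s) dx dy < ∞`. -/
def hsSubmodule {n : ℕ} (s : ℝ) (Ω : Set (Eucl n)) : Submodule ℝ (L2 n) where
  carrier := {v | MemLp (diffQuot s v) 2 (volume.prod volume) ∧ ∀ᵐ x, x ∉ Ω → v x = 0}
  zero_mem' := by
    refine ⟨?_, ?_⟩
    · refine (memLp_congr_ae (diffQuot_congr s (Lp.coeFn_zero ℝ 2 volume))).2 ?_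
      have : diffQuot s (0 : Eucl n → ℝ) = 0 := by
        funext p
        simp [diffQuot]
      rw [this]
      exact MemLp.zero
    · filter_upwards [Lp.coeFn_zero ℝ 2 (volume : Measure (Eucl n))] with x hx _
      exact hx
  add_mem' := by
    rintro v w ⟨hv, hv'⟩ ⟨hw, hw'⟩
    refine ⟨(memLp_congr_ae (diffQuot_add s v w)).2 (hv.add hw), ?_⟩
    filter_upwards [Lp.coeFn_add v w, hv', hw'] with x hx h1 h2 hxΩ
    rw [hx, Pi.add_apply, h1 hxΩ, h2 hxΩ, add_zero]
  smul_mem' := by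
    rintro c v ⟨hv, hv'⟩
    refine ⟨(memLp_congr_ae (diffQuot_smul s c v)).2 (hv.const_smul c), ?_⟩
    filter_upwards [Lp.coeFn_smul c v, hv'] with x hx h1 hxΩ
    rw [hx, Pi.smul_apply, h1 hxΩ, smul_zero]

/-- The space `H^s_Ω(ℝⁿ)`. It is a type of its own so that it carries the norm of `H^s_Ω` defined
below and not the norm of `L²(ℝⁿ)`. -/
def Hs {n : ℕ} (s : ℝ) (Ω : Set (Eucl n)) : Type := hsSubmodule s Ω

instance {n : ℕ} (s : ℝ) (Ω : Set (Eucl n)) : AddCommGroup (Hs s Ω) :=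
  inferInstanceAs (AddCommGroup (hsSubmodule s Ω))

instance {n : ℕ} (s : ℝ) (Ω : Set (Eucl n)) : Module ℝ (Hs s Ω) :=
  inferInstanceAs (Module ℝ (hsSubmodule s Ω))

/-- The inclusion of `H^s_Ω(ℝⁿ)` in `L²(ℝⁿ)`. -/
def Hs.toL2 {n : ℕ} {s : ℝ} {Ω : Set (Eucl n)} : Hs s Ω →ₗ[ℝ] L2 n :=
  (hsSubmodule s Ω).subtype

theorem Hs.memLp_diffQuot {n : ℕ} {s : ℝ} {Ω : Set (Eucl n)} (v : Hs s Ω) :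
    MemLp (diffQuot s (Hs.toL2 v)) 2 (volume.prod volume) :=
  v.2.1

/-- The difference quotient as a linear map from `H^s_Ω(ℝⁿ)` to `L²(ℝⁿ × ℝⁿ)`. -/
def Hs.quot {n : ℕ} {s : ℝ} {Ω : Set (Eucl n)} :
    Hs s Ω →ₗ[ℝ] Lp ℝ 2 ((volume : Measure (Eucl n)).prod (volume : Measure (Eucl n))) where
  toFun v := (Hs.memLp_diffQuot v).toLp
  map_add' v w :=
    ((MemLp.toLp_eq_toLp_iff (Hs.memLp_diffQuot (v + w))
      ((Hs.memLp_diffQuot v).add (Hs.memLp_diffQuot w))).2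
      (diffQuot_add s (Hs.toL2 v) (Hs.toL2 w))).trans
      (MemLp.toLp_add (Hs.memLp_diffQuot v) (Hs.memLp_diffQuot w))
  map_smul' c v :=
    ((MemLp.toLp_eq_toLp_iff (Hs.memLp_diffQuot (c • v))
      ((Hs.memLp_diffQuot v).const_smul c)).2
      (diffQuot_smul s c (Hs.toL2 v))).trans
      (MemLp.toLp_const_smul c (Hs.memLp_diffQuot v))

/-- The norm `‖v‖² = ∬ |v(x) - v(y)|² / |x - y|^(n + 2s) dx dy` of `H^s_Ω(ℝⁿ)`. -/
instance {n : ℕ} (s : ℝ) (Ω : Set (Eucl n)) : SeminormedAddCommGroup (Hs s Ω) :=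
  SeminormedAddCommGroup.induced (Hs s Ω) (Lp ℝ 2 ((volume : Measure (Eucl n)).prod (volume : Measure (Eucl n))))
    Hs.quot

/-- The inner product `∬ (v(x) - v(y)) (w(x) - w(y)) / |x - y|^(n + 2s) dx dy`. -/
instance {n : ℕ} (s : ℝ) (Ω : Set (Eucl n)) : InnerProductSpace ℝ (Hs s Ω) where
  toModule := inferInstanceAs (Module ℝ (Hs s Ω))
  norm_smul_le c v := by
    change ‖Hs.quot (c • v)‖ ≤ ‖c‖ * ‖Hs.quot v‖
    rw [map_smul, norm_smul]
  inner v w := inner ℝ (Hs.quot v) (Hs.quot w)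
  norm_sq_eq_re_inner v := norm_sq_eq_re_inner (𝕜 := ℝ) (Hs.quot v)
  conj_inner_symm v w := inner_conj_symm (𝕜 := ℝ) (Hs.quot v) (Hs.quot w)
  add_left u v w := by
    rw [map_add, inner_add_left]
  smul_left u v c := by
    rw [map_smul, inner_smul_left]

/-! ### The weighted nonlocal gradient and the anisotropic form -/

/-- `C_{n,s} = 4^s Γ(s + n/2) / (π^(n/2) |Γ(-s)|)`. -/
def fracLapConst (n : ℕ) (s : ℝ) : ℝ :=
  4 ^ s * Real.Gamma (s + n / 2) / (Real.pi ^ ((n : ℝ) / 2) * |Real.Gamma (-s)|)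

/-- The constant `C_ω` of the weight: the normalization for which the composition of the weighted
divergence and gradient is `-(-Δ)^s`. -/
def weightConst (n : ℕ) (s : ℝ) : ℝ :=
  2 ^ s * Real.Gamma ((n + s + 1) / 2) / (Real.pi ^ ((n : ℝ) / 2) * Real.Gamma ((1 - s) / 2))

/-- The weight `ω(x, y) = C_ω |x - y|^(-(n + s))`. -/
def weight {n : ℕ} (s : ℝ) (x y : Eucl n) : ℝ :=
  weightConst n s * ‖x - y‖ ^ (-((n : ℝ) + s))

/-- The antisymmetric vector function `α(x, y) = (y - x) / |y - x|`. -/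
def direction {n : ℕ} (x y : Eucl n) : Eucl n :=
  ‖y - x‖⁻¹ • (y - x)

/-- The integral `∫ ω(x, y) (u(y) - u(x)) α(x, y) dy` over `|y - x| ≥ ε`. -/
def truncGrad {n : ℕ} (s ε : ℝ) (u : Eucl n → ℝ) (x : Eucl n) : Eucl n :=
  ∫ y in (Metric.ball x ε)ᶜ, (weight s x y * (u y - u x)) • direction x y

/-- `g` is the weighted gradient `𝒢_ω u(x) = ∫ ω(x, y) (u(y) - u(x)) α(x, y) dy`. For a general `u`
in `H^s` the integral does not converge absolutely; it is a principal value, and the limit is taken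
in `L²(ℝⁿ; ℝⁿ)`. -/
def HasWeightedGrad {n : ℕ} (s : ℝ) (u : L2 n) (g : Lp (Eucl n) 2 (volume : Measure (Eucl n))) :
    Prop :=
  Tendsto (fun ε : ℝ => eLpNorm (fun x => truncGrad s ε u x - g x) 2 volume) (𝓝[>] 0) (𝓝 0)

open Classical in
/-- The weighted gradient `𝒢_ω u` (zero if it does not exist). -/
def weightedGrad {n : ℕ} (s : ℝ) (u : L2 n) : Lp (Eucl n) 2 (volume : Measure (Eucl n)) :=
  if h : ∃ g, HasWeightedGrad s u g then h.choose else 0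

/-- The tensor field `A` is measurable, symmetric, bounded and uniformly elliptic, with
`lmin |v|² ≤ v · A(x) v ≤ lmax |v|²`. -/
structure IsEllipticTensor {n : ℕ} (A : Eucl n → Matrix (Fin n) (Fin n) ℝ) (lmin lmax : ℝ) :
    Prop where
  measurable : ∀ i j, Measurable fun x => A x i j
  symm : ∀ x, (A x).IsSymm
  pos : 0 < lmin
  le : lmin ≤ lmax
  lower : ∀ x v, lmin * ‖v‖ ^ 2 ≤ inner ℝ v (Matrix.toEuclideanLin (A x) v)
  upper : ∀ x v, inner ℝ v (Matrix.toEuclideanLin (A x) v) ≤ lmax * ‖v‖ ^ 2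

/-- The form `ℬ_{ω;A}(u, v) = ∫ 𝒢_ω u(x) · A(x) 𝒢_ω v(x) dx`. -/
def anisoForm {n : ℕ} (s : ℝ) (A : Eucl n → Matrix (Fin n) (Fin n) ℝ) (u v : L2 n) : ℝ :=
  ∫ x, inner ℝ (weightedGrad s u x) (Matrix.toEuclideanLin (A x) (weightedGrad s v x))

/-! ### Weak solutions of the parabolic problem -/

/-- Lebesgue measure on the time interval `(0, T)`. -/
def timeMeasure (T : ℝ) : Measure ℝ := volume.restrict (Set.Ioo 0 T)

/-- `w` is the weak time derivative of `u` on `(0, T)`, with values in the dual of `H^s_Ω`. The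
`L²(Ω)` inner product is that of `L²(ℝⁿ)`, as elements of `H^s_Ω` vanish outside `Ω`. -/
def IsTimeDeriv {n : ℕ} {s : ℝ} {Ω : Set (Eucl n)} (T : ℝ) (u : ℝ → Hs s Ω)
    (w : ℝ → StrongDual ℝ (Hs s Ω)) : Prop :=
  ∀ φ : ℝ → ℝ, ContDiff ℝ ∞ φ → HasCompactSupport φ → tsupport φ ⊆ Set.Ioo 0 T →
    ∀ v : Hs s Ω, ∫ t, deriv φ t * inner ℝ (Hs.toL2 (u t)) (Hs.toL2 v) ∂(timeMeasure T) =
      -∫ t, φ t * w t v ∂(timeMeasure T)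

/-- `U` is the representative of `u` that is continuous on `[0, T]` with values in `L²`. -/
def IsContRep {n : ℕ} {s : ℝ} {Ω : Set (Eucl n)} (T : ℝ) (u : ℝ → Hs s Ω) (U : ℝ → L2 n) : Prop :=
  ContinuousOn U (Set.Icc 0 T) ∧ ∀ᵐ t ∂(timeMeasure T), U t = Hs.toL2 (u t)

/-- `u ∈ L²(0, T; H^s_Ω)` has a weak derivative `∂ₜ u ∈ L²(0, T; (H^s_Ω)')`, satisfies
`⟨∂ₜ u, v⟩ + ℬ_{ω;A}(u, v) = f(v)` for all `v ∈ H^s_Ω` at almost every time, and `u(0) = u₀`. -/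
structure IsWeakSolution {n : ℕ} {s : ℝ} {Ω : Set (Eucl n)}
    (A : Eucl n → Matrix (Fin n) (Fin n) ℝ) (T : ℝ) (f : ℝ → StrongDual ℝ (Hs s Ω))
    (u₀ : Hs s Ω) (u : ℝ → Hs s Ω) : Prop where
  memLp : MemLp u 2 (timeMeasure T)
  equation : ∃ w : ℝ → StrongDual ℝ (Hs s Ω), MemLp w 2 (timeMeasure T) ∧ IsTimeDeriv T u w ∧
    ∀ᵐ t ∂(timeMeasure T), ∀ v : Hs s Ω,
      w t v + anisoForm s A (Hs.toL2 (u t)) (Hs.toL2 v) = f t v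
  initial : ∃ U : ℝ → L2 n, IsContRep T u U ∧ U 0 = Hs.toL2 u₀

/-- The Poincaré inequality `‖v‖_{L²(Ω)} ≤ C ‖v‖_{H^s_Ω}` on `H^s_Ω`. -/
def PoincareOn {n : ℕ} (s : ℝ) (Ω : Set (Eucl n)) (C : ℝ) : Prop :=
  ∀ v : Hs s Ω, ‖Hs.toL2 v‖ ≤ C * ‖v‖

end FracDiff

end

/-! Write `V` for `Hs s Ω` with the Gagliardo norm and `H` for `L²`, with inclusion `ι : V → H`.
There are two halves: the form is bounded, symmetric and coercive on `V` with the stated constant,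
and an abstract parabolic problem for such a form is well posed.

The first half is Fourier analysis. Each component of the truncated gradient is a difference
operator with an integrable odd kernel, hence a Fourier multiplier `i m_ε(ξ)` (`fourierReal_diffOp`,
`integral_odd_mul_fourierChar_sub_one`). The symbols are bounded by a multiple of `|ξ|^s` uniformly
in `ε`, and converge to the components of `2πξ (2π|ξ|)^(s-1)` (`integral_fracKernel_mul_sin`).
Dominated convergence gives the limit in `L²`, with squared norm `∫ (2π|ξ|)^(2s) |v̂|²`
(`exists_weightedGrad`). The Gagliardo norm equals the same energy up to the factor `2 / C_{n,s}`
(`lintegral_diffQuot_sq`). Hence `‖𝒢v‖² = (C_{n,s}/2) ‖v‖²`, and ellipticity of `A` gives coercivity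
with `C_{n,s} λ_min / 2`. Both symbols are computed by writing powers of `|h|` as superpositions of
Gaussians.

The second half uses no Galerkin scheme. Let `S = ι*ι`, let `B` represent the form, and look for `w
= ∫₀ᵗ h` with `S h + B w = F`. The operator `h ↦ S h + B ∫₀ᵗ h` has dense range in `L²(0,T;V)`
because `S` is injective and `∫₀ᵀ ⟨B∫₀ᵗz, z⟩ = ⟨B Z(T), Z(T)⟩ / 2 ≥ 0` for symmetric `B`, with `Z =
∫₀ᵗ z`. Pairing with `w` bounds `c‖w‖` by the right-hand side, so approximate solutions converge;
the energy identity makes `ι w` converge uniformly in time (`exists_solution_zero_initial`).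
Subtracting `u₀` reduces general data to zero initial data.

Uniqueness comes from the time-integrated equation: a difference `z` satisfies `∫‖ι z‖² = -a(Z(T),
Z(T)) / 2 ≤ 0`. The du Bois-Reymond lemma turns weak time derivatives into this integrated form. The
estimate is the energy identity with Young's inequality, which yields the factor `1 / C_coer`; this
is at most `C_p² / (2 C_coer)` once `C_p ≥ √2`. -/

noncomputable section

namespace FracDiff

/-! ### Integration by parts for primitives of Bochner integrable functions. -/

section ProductRule

variable {E F G : Type*} [NormedAddCommGroup E] [NormedSpace ℝ E] [CompleteSpace E]
  [NormedAddCommGroup F] [NormedSpace ℝ F] [CompleteSpace F]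
  [NormedAddCommGroup G] [NormedSpace ℝ G] [CompleteSpace G]

/-- The product rule for primitives of integrable functions, in integrated form. -/
theorem integral_primitive_add_integral_primitive (L : E →L[ℝ] F →L[ℝ] G) {t : ℝ} (ht : 0 ≤ t)
    {a : ℝ → E} {b : ℝ → F} (ha : IntervalIntegrable a volume 0 t)
    (hb : IntervalIntegrable b volume 0 t) :
    (∫ r in (0 : ℝ)..t, L (∫ q in (0 : ℝ)..r, a q) (b r)) +
      ∫ r in (0 : ℝ)..t, L (a r) (∫ q in (0 : ℝ)..r, b q) =
    L (∫ r in (0 : ℝ)..t, a r) (∫ r in (0 : ℝ)..t, b r) := by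
  have ha' : Integrable a (volume.restrict (Set.Ioc 0 t)) :=
    (intervalIntegrable_iff_integrableOn_Ioc_of_le ht).1 ha
  have hb' : Integrable b (volume.restrict (Set.Ioc 0 t)) :=
    (intervalIntegrable_iff_integrableOn_Ioc_of_le ht).1 hb
  set μ := (volume : Measure ℝ).restrict (Set.Ioc 0 t) with hμ
  -- The integral of `L (a q) (b r)` over the square `(0, t]²` factorises into the right-hand side;
  -- the two parts of the square on either side of the diagonal give the two terms on the left.
  have hK : Integrable (fun z : ℝ × ℝ => L (a z.1) (b z.2)) (μ.prod μ) :=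
    ha'.op_fst_snd (by fun_prop) ⟨‖L‖, L.le_opNorm₂⟩ hb'
  have hS : MeasurableSet {z : ℝ × ℝ | z.1 ≤ z.2} := measurableSet_le measurable_fst measurable_snd
  have hsub : ∀ {r : ℝ}, r ∈ Set.Ioc 0 t → Set.Ioc 0 r ⊆ Set.Ioc 0 t := fun hr =>
    Set.Ioc_subset_Ioc le_rfl hr.2
  have h1 : ∫ z in {z : ℝ × ℝ | z.1 ≤ z.2}, L (a z.1) (b z.2) ∂(μ.prod μ) =
      ∫ r in (0 : ℝ)..t, L (∫ q in (0 : ℝ)..r, a q) (b r) := by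
    rw [← integral_indicator hS, integral_prod_symm _ (hK.indicator hS),
      intervalIntegral.integral_of_le ht]
    refine setIntegral_congr_fun measurableSet_Ioc fun r hr => ?_
    have h2 : ∀ q, Set.indicator {z : ℝ × ℝ | z.1 ≤ z.2} (fun z => L (a z.1) (b z.2)) (q, r) =
        Set.indicator (Set.Iic r) (fun q => L (a q) (b r)) q := fun q => by
      simp [Set.indicator_apply]
    simp only [h2]
    rw [integral_indicator measurableSet_Iic, hμ, Measure.restrict_restrict measurableSet_Iic,
      intervalIntegral.integral_of_le hr.1.le]
    have h3 : Set.Iic r ∩ Set.Ioc 0 t = Set.Ioc 0 r := by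
      ext q; simp only [Set.mem_inter_iff, Set.mem_Iic, Set.mem_Ioc]
      have := hr.2
      constructor
      · rintro ⟨h, h', _⟩; exact ⟨h', h⟩
      · rintro ⟨h, h'⟩; exact ⟨h', h, h'.trans this⟩
    rw [h3]
    exact (L.flip (b r)).integral_comp_comm (IntegrableOn.mono_set ha' (hsub hr))
  have h2 : ∫ z in {z : ℝ × ℝ | z.1 ≤ z.2}ᶜ, L (a z.1) (b z.2) ∂(μ.prod μ) =
      ∫ r in (0 : ℝ)..t, L (a r) (∫ q in (0 : ℝ)..r, b q) := by
    rw [← integral_indicator hS.compl, integral_prod _ (hK.indicator hS.compl),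
      intervalIntegral.integral_of_le ht]
    refine setIntegral_congr_fun measurableSet_Ioc fun r hr => ?_
    have h2 : ∀ q, Set.indicator {z : ℝ × ℝ | z.1 ≤ z.2}ᶜ (fun z => L (a z.1) (b z.2)) (r, q) =
        Set.indicator (Set.Iio r) (fun q => L (a r) (b q)) q := fun q => by
      simp [Set.indicator_apply]
    simp only [h2]
    rw [integral_indicator measurableSet_Iio, hμ, Measure.restrict_restrict measurableSet_Iio,
      intervalIntegral.integral_of_le hr.1.le]
    have h3 : Set.Iio r ∩ Set.Ioc 0 t = Set.Ioo 0 r := by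
      ext q; simp only [Set.mem_inter_iff, Set.mem_Iio, Set.mem_Ioc, Set.mem_Ioo]
      have := hr.2
      constructor
      · rintro ⟨h, h', _⟩; exact ⟨h', h⟩
      · rintro ⟨h, h'⟩; exact ⟨h', h, (h'.trans_le this).le⟩
    rw [h3, ← integral_Ioc_eq_integral_Ioo]
    exact (L (a r)).integral_comp_comm (IntegrableOn.mono_set hb' (hsub hr))
  rw [← h1, ← h2, integral_add_compl hS hK, integral_prod_bilin L ha' hb',
    intervalIntegral.integral_of_le ht, intervalIntegral.integral_of_le ht]

/-- The quadratic form of the product rule. -/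
theorem two_mul_integral_primitive (L : E →L[ℝ] E →L[ℝ] ℝ) (hL : ∀ x y, L x y = L y x)
    {t : ℝ} (ht : 0 ≤ t) {a : ℝ → E} (ha : IntervalIntegrable a volume 0 t) :
    2 * ∫ r in (0 : ℝ)..t, L (∫ q in (0 : ℝ)..r, a q) (a r) =
      L (∫ r in (0 : ℝ)..t, a r) (∫ r in (0 : ℝ)..t, a r) := by
  rw [← integral_primitive_add_integral_primitive L ht ha ha, two_mul]
  congr 1
  exact intervalIntegral.integral_congr fun r _ => hL _ _

end ProductRule

/-! ### The time interval: passing between `timeMeasure` and interval integrals. -/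

section TimeMeasure

variable {E : Type*} [NormedAddCommGroup E]

instance (T : ℝ) : IsFiniteMeasure (timeMeasure T) := by
  unfold timeMeasure; infer_instance

theorem intervalIntegrable_of_timeMeasure {T t : ℝ} (ht : t ∈ Set.Icc 0 T) {a : ℝ → E}
    (ha : Integrable a (timeMeasure T)) : IntervalIntegrable a volume 0 t := by
  rw [intervalIntegrable_iff_integrableOn_Ioo_of_le ht.1]
  exact IntegrableOn.mono_set ha (Set.Ioo_subset_Ioo le_rfl ht.2)

/-- Since the endpoints are null, an integral over `0..t` is an integral against `timeMeasure T` cut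
off at `t`. This lets statements holding almost everywhere on `(0, T)` be used under `∫ r in 0..t`.
-/
theorem restrict_Iic_timeMeasure {T t : ℝ} (ht : t ∈ Set.Icc 0 T) :
    (timeMeasure T).restrict (Set.Iic t) = volume.restrict (Set.Ioc 0 t) := by
  rw [timeMeasure, Measure.restrict_restrict measurableSet_Iic]
  refine Measure.restrict_congr_set ?_
  have h : (Set.Ioo 0 T : Set ℝ) =ᵐ[volume] Set.Ioc 0 T := Ioo_ae_eq_Ioc
  have h' : (Set.Iic t ∩ Set.Ioc 0 T : Set ℝ) = Set.Ioc 0 t := by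
    ext q; simp only [Set.mem_inter_iff, Set.mem_Iic, Set.mem_Ioc]
    have := ht.2
    constructor
    · rintro ⟨h, h', _⟩; exact ⟨h', h⟩
    · rintro ⟨h, h'⟩; exact ⟨h', h, h'.trans this⟩
  rw [← h']
  exact (Filter.EventuallyEq.refl _ _).inter h

theorem integral_Iic_timeMeasure [NormedSpace ℝ E] {T t : ℝ} (ht : t ∈ Set.Icc 0 T) (a : ℝ → E) :
    ∫ r in Set.Iic t, a r ∂(timeMeasure T) = ∫ r in (0 : ℝ)..t, a r := by
  rw [restrict_Iic_timeMeasure ht, intervalIntegral.integral_of_le ht.1]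

theorem integral_timeMeasure [NormedSpace ℝ E] {T : ℝ} (hT : 0 ≤ T) (a : ℝ → E) :
    ∫ r, a r ∂(timeMeasure T) = ∫ r in (0 : ℝ)..T, a r := by
  rw [timeMeasure, intervalIntegral.integral_of_le hT, integral_Ioc_eq_integral_Ioo]

theorem intervalIntegral_congr_timeMeasure [NormedSpace ℝ E] {T t : ℝ} (ht : t ∈ Set.Icc 0 T)
    {a b : ℝ → E} (h : a =ᵐ[timeMeasure T] b) :
    ∫ r in (0 : ℝ)..t, a r = ∫ r in (0 : ℝ)..t, b r := by
  rw [← integral_Iic_timeMeasure ht, ← integral_Iic_timeMeasure ht]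
  exact integral_congr_ae (ae_restrict_of_ae h)

theorem continuousOn_primitive [NormedSpace ℝ E] {T : ℝ} (hT : 0 ≤ T) {a : ℝ → E}
    (ha : Integrable a (timeMeasure T)) :
    ContinuousOn (fun t => ∫ r in (0 : ℝ)..t, a r) (Set.Icc 0 T) := by
  have := intervalIntegral.continuousOn_primitive_interval (a := 0) (b := T) (μ := volume) (f := a)
    (by
      rw [Set.uIcc_of_le hT, integrableOn_Icc_iff_integrableOn_Ioo]
      exact ha)
  rwa [Set.uIcc_of_le hT] at this

theorem ae_timeMeasure_mem (T : ℝ) : ∀ᵐ t ∂(timeMeasure T), t ∈ Set.Icc 0 T := by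
  filter_upwards [ae_restrict_mem measurableSet_Ioo] with t ht using Set.Ioo_subset_Icc_self ht

theorem ContinuousOn.memLp_timeMeasure {T : ℝ} {a : ℝ → E}
    (ha : ContinuousOn a (Set.Icc 0 T)) (p : ENNReal) : MemLp a p (timeMeasure T) := by
  obtain ⟨C, hC⟩ := isCompact_Icc.exists_bound_of_continuousOn ha
  refine MemLp.of_bound (C := C) ?_ ?_
  · exact (ha.aestronglyMeasurable measurableSet_Icc).mono_measure
      (Measure.restrict_mono_set _ Set.Ioo_subset_Icc_self)
  · filter_upwards [ae_timeMeasure_mem T] with t ht using hC t ht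

/-- Two functions continuous on `[0, T]` that agree almost everywhere agree on `[0, T]`. -/
theorem eqOn_of_ae_timeMeasure {T : ℝ} (hT : 0 < T) {a b : ℝ → E}
    (ha : ContinuousOn a (Set.Icc 0 T)) (hb : ContinuousOn b (Set.Icc 0 T))
    (h : a =ᵐ[timeMeasure T] b) : Set.EqOn a b (Set.Icc 0 T) := by
  refine Measure.eqOn_Icc_of_ae_eq volume hT.ne ?_ ha hb
  have := (restrict_Ioo_eq_restrict_Icc (μ := (volume : Measure ℝ)) (a := 0) (b := T))
  rw [← this]; exact h

end TimeMeasure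

/-! ### The abstract parabolic equation with zero initial value. -/

section Parabolic

set_option linter.unusedSectionVars false

variable {V H : Type*} [NormedAddCommGroup V] [InnerProductSpace ℝ V] [CompleteSpace V]
  [NormedAddCommGroup H] [InnerProductSpace ℝ H] [CompleteSpace H]

/-- The bilinear map `(a, b) ↦ ∫₀ᵗ ⟪a, b⟫` on `L²(0, T; V)`. -/
def partialInner (T t : ℝ) :
    Lp V 2 (timeMeasure T) →ₗ[ℝ] Lp V 2 (timeMeasure T) →ₗ[ℝ] ℝ :=
  LinearMap.mk₂ ℝ (fun a b => ∫ r in Set.Iic t, inner ℝ (a r) (b r) ∂(timeMeasure T))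
      (fun a a' b => by
        rw [← integral_add (L2.integrable_inner a b).restrict (L2.integrable_inner a' b).restrict]
        refine integral_congr_ae (ae_restrict_of_ae ?_)
        filter_upwards [Lp.coeFn_add a a'] with r hr
        rw [hr, Pi.add_apply, inner_add_left])
      (fun c a b => by
        rw [smul_eq_mul, ← integral_const_mul]
        refine integral_congr_ae (ae_restrict_of_ae ?_)
        filter_upwards [Lp.coeFn_smul c a] with r hr
        rw [hr, Pi.smul_apply, real_inner_smul_left])
      (fun a b b' => by
        rw [← integral_add (L2.integrable_inner a b).restrict (L2.integrable_inner a b').restrict]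
        refine integral_congr_ae (ae_restrict_of_ae ?_)
        filter_upwards [Lp.coeFn_add b b'] with r hr
        rw [hr, Pi.add_apply, inner_add_right])
      (fun c a b => by
        rw [smul_eq_mul, ← integral_const_mul]
        refine integral_congr_ae (ae_restrict_of_ae ?_)
        filter_upwards [Lp.coeFn_smul c b] with r hr
        rw [hr, Pi.smul_apply, real_inner_smul_right])

/-- Cutting off at `t` only decreases the integral of `‖a‖ ‖b‖`, so Cauchy–Schwarz on the whole
interval suffices. The bound does not depend on `t`, which later gives convergence uniform in time.
-/
theorem abs_partialInner_le (T t : ℝ) (a b : Lp V 2 (timeMeasure T)) :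
    |partialInner T t a b| ≤ ‖a‖ * ‖b‖ := by
  have hm : MemLp (fun r => ‖a r‖) 2 (timeMeasure T) := (Lp.memLp a).norm
  have hm' : MemLp (fun r => ‖b r‖) 2 (timeMeasure T) := (Lp.memLp b).norm
  rw [partialInner, LinearMap.mk₂_apply]
  rw [← Real.norm_eq_abs]
  calc ‖∫ r in Set.Iic t, inner ℝ (a r) (b r) ∂(timeMeasure T)‖
      ≤ ∫ r in Set.Iic t, ‖a r‖ * ‖b r‖ ∂(timeMeasure T) :=
        norm_integral_le_of_norm_le (hm.integrable_mul hm').restrict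
          (Eventually.of_forall fun r => norm_inner_le_norm _ _)
    _ ≤ ∫ r, ‖a r‖ * ‖b r‖ ∂(timeMeasure T) :=
        setIntegral_le_integral (hm.integrable_mul hm')
          (Eventually.of_forall fun r => mul_nonneg (norm_nonneg _) (norm_nonneg _))
    _ = inner ℝ hm.toLp hm'.toLp := by
        rw [L2.inner_def]
        refine integral_congr_ae ?_
        filter_upwards [hm.coeFn_toLp, hm'.coeFn_toLp] with r h1 h2
        rw [h1, h2]; simp [mul_comm]
    _ ≤ ‖hm.toLp‖ * ‖hm'.toLp‖ := real_inner_le_norm _ _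
    _ = ‖a‖ * ‖b‖ := by
        rw [Lp.norm_toLp, Lp.norm_toLp, eLpNorm_norm, eLpNorm_norm, Lp.norm_def,
          Lp.norm_def]

theorem partialInner_apply {T t : ℝ} (ht : t ∈ Set.Icc 0 T) (a b : Lp V 2 (timeMeasure T)) :
    partialInner T t a b = ∫ r in (0 : ℝ)..t, inner ℝ (a r) (b r) :=
  integral_Iic_timeMeasure ht _

theorem tendsto_partialInner {T : ℝ} (t : ℝ) {a b : ℕ → Lp V 2 (timeMeasure T)}
    {a₀ b₀ : Lp V 2 (timeMeasure T)} (ha : Tendsto a atTop (𝓝 a₀)) (hb : Tendsto b atTop (𝓝 b₀)) :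
    Tendsto (fun i => partialInner T t (a i) (b i)) atTop (𝓝 (partialInner T t a₀ b₀)) := by
  rw [tendsto_iff_norm_sub_tendsto_zero]
  have h1 : Tendsto (fun i => ‖a i - a₀‖ * ‖b i‖ + ‖a₀‖ * ‖b i - b₀‖) atTop (𝓝 0) := by
    have h2 := (tendsto_iff_norm_sub_tendsto_zero.1 ha).mul hb.norm
    have h3 := (tendsto_iff_norm_sub_tendsto_zero.1 hb).const_mul ‖a₀‖
    simpa using h2.add h3
  refine squeeze_zero (fun _ => norm_nonneg _) (fun i => ?_) h1
  have h2 : partialInner T t (a i) (b i) - partialInner T t a₀ b₀ =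
      partialInner T t (a i - a₀) (b i) + partialInner T t a₀ (b i - b₀) := by
    simp only [map_sub, LinearMap.sub_apply]; ring
  rw [h2]
  exact (norm_add_le _ _).trans (add_le_add (abs_partialInner_le T t _ _)
    (abs_partialInner_le T t _ _))

theorem integrable_coeFn_Lp {T : ℝ} (a : Lp V 2 (timeMeasure T)) : Integrable a (timeMeasure T) :=
  (Lp.memLp a).integrable one_le_two

/-- The primitive of an element of `L²(0, T; V)`. -/
def primitive {T : ℝ} (h : Lp V 2 (timeMeasure T)) (t : ℝ) : V := ∫ r in (0 : ℝ)..t, h r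

theorem continuousOn_primitive_Lp {T : ℝ} (hT : 0 ≤ T) (h : Lp V 2 (timeMeasure T)) :
    ContinuousOn (primitive h) (Set.Icc 0 T) :=
  continuousOn_primitive hT (integrable_coeFn_Lp h)

theorem primitive_add {T t : ℝ} (ht : t ∈ Set.Icc 0 T) (h k : Lp V 2 (timeMeasure T)) :
    primitive (h + k) t = primitive h t + primitive k t := by
  rw [primitive, intervalIntegral_congr_timeMeasure ht (Lp.coeFn_add h k)]
  exact intervalIntegral.integral_add
    (intervalIntegrable_of_timeMeasure ht (integrable_coeFn_Lp h))
    (intervalIntegrable_of_timeMeasure ht (integrable_coeFn_Lp k))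

theorem primitive_smul {T t : ℝ} (ht : t ∈ Set.Icc 0 T) (c : ℝ) (h : Lp V 2 (timeMeasure T)) :
    primitive (c • h) t = c • primitive h t := by
  rw [primitive, intervalIntegral_congr_timeMeasure ht (Lp.coeFn_smul c h)]
  exact intervalIntegral.integral_smul _ _

/-- The primitive as a linear map of `L²(0, T; V)`. -/
def volterra {T : ℝ} (hT : 0 ≤ T) : Lp V 2 (timeMeasure T) →ₗ[ℝ] Lp V 2 (timeMeasure T) where
  toFun h := (ContinuousOn.memLp_timeMeasure (continuousOn_primitive_Lp hT h) 2).toLp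
  map_add' h k := by
    rw [← MemLp.toLp_add, MemLp.toLp_eq_toLp_iff]
    filter_upwards [ae_timeMeasure_mem T] with t ht using primitive_add ht h k
  map_smul' c h := by
    rw [RingHom.id_apply, ← MemLp.toLp_const_smul, MemLp.toLp_eq_toLp_iff]
    filter_upwards [ae_timeMeasure_mem T] with t ht using primitive_smul ht c h

theorem coeFn_volterra {T : ℝ} (hT : 0 ≤ T) (h : Lp V 2 (timeMeasure T)) :
    volterra hT h =ᵐ[timeMeasure T] primitive h :=
  (ContinuousOn.memLp_timeMeasure (continuousOn_primitive_Lp hT h) 2).coeFn_toLp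

/-- Integrated form of `d/dt ⟨p, S p⟩ = 2 ⟨p, S p'⟩` for the primitive `p` of `h`, which vanishes at
`0`. For `S = ι*ι` the right-hand side is `‖ι p(t)‖²`, so this is the energy identity. -/
theorem partialInner_comp_volterra {T t : ℝ} (hT : 0 ≤ T) (ht : t ∈ Set.Icc 0 T)
    (S : V →L[ℝ] V) (hS : ∀ x y, inner ℝ (S x) y = inner ℝ x (S y))
    (h : Lp V 2 (timeMeasure T)) :
    2 * partialInner T t (volterra hT h) (S.compLpL 2 (timeMeasure T) h) =
      inner ℝ (primitive h t) (S (primitive h t)) := by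
  have := two_mul_integral_primitive ((innerSL ℝ).flip.comp S).flip (fun x y => by
    simp only [ContinuousLinearMap.flip_apply, ContinuousLinearMap.comp_apply, innerSL_apply_apply]
    rw [real_inner_comm, hS]) ht.1 (intervalIntegrable_of_timeMeasure ht (integrable_coeFn_Lp h))
  simp only [ContinuousLinearMap.flip_apply, ContinuousLinearMap.comp_apply,
    innerSL_apply_apply] at this
  rw [primitive, ← this, partialInner_apply ht]
  congr 1
  refine intervalIntegral_congr_timeMeasure ht ?_
  filter_upwards [coeFn_volterra hT h, S.coeFn_compLpL h] with r h1 h2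
  rw [h1, h2]; rfl

/-- By symmetry `S` may sit on the other factor. With `S = B` positive, this shows that the memory
term `B ∫₀ᵗ h` pairs nonnegatively with `h`. -/
theorem partialInner_volterra_comp {T t : ℝ} (hT : 0 ≤ T) (ht : t ∈ Set.Icc 0 T)
    (S : V →L[ℝ] V) (hS : ∀ x y, inner ℝ (S x) y = inner ℝ x (S y))
    (h : Lp V 2 (timeMeasure T)) :
    2 * partialInner T t (S.compLpL 2 (timeMeasure T) (volterra hT h)) h =
      inner ℝ (primitive h t) (S (primitive h t)) := by
  rw [← partialInner_comp_volterra hT ht S hS, partialInner_apply ht, partialInner_apply ht]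
  congr 1
  refine intervalIntegral_congr_timeMeasure ht ?_
  filter_upwards [S.coeFn_compLpL h, S.coeFn_compLpL (volterra hT h)] with r h1 h2
  rw [h1, h2, hS]

theorem partialInner_self_eq_inner {T : ℝ} (hT : 0 ≤ T) (a b : Lp V 2 (timeMeasure T)) :
    partialInner T T a b = inner ℝ a b := by
  rw [partialInner_apply ⟨hT, le_rfl⟩, L2.inner_def, integral_timeMeasure hT]

/-- The operator `h ↦ S h + B ∫₀ᵗ h` has dense range in `L²(0, T; V)`. -/
theorem dense_range_parabolic {T : ℝ} (hT : 0 ≤ T) (ι : V →L[ℝ] H) (hι : Function.Injective ι)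
    (B : V →L[ℝ] V) (hB : ∀ x y, inner ℝ (B x) y = inner ℝ x (B y))
    (hpos : ∀ x, 0 ≤ inner ℝ x (B x)) (F : Lp V 2 (timeMeasure T)) :
    F ∈ closure (Set.range fun h : Lp V 2 (timeMeasure T) =>
      ((ContinuousLinearMap.adjoint ι).comp ι).compLpL 2 (timeMeasure T) h +
        B.compLpL 2 (timeMeasure T) (volterra hT h)) := by
  set S := (ContinuousLinearMap.adjoint ι).comp ι with hS
  let L : Lp V 2 (timeMeasure T) →ₗ[ℝ] Lp V 2 (timeMeasure T) :=
    (S.compLpL 2 (timeMeasure T)).toLinearMap +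
      (B.compLpL 2 (timeMeasure T)).toLinearMap.comp (volterra hT)
  have hcl : (LinearMap.range L).topologicalClosure = ⊤ := by
    rw [Submodule.topologicalClosure_eq_top_iff, Submodule.eq_bot_iff]
    intro z hz
    -- An element orthogonal to the range is tested against its own image; both resulting terms are
    -- nonnegative, so `ι z = 0`.
    have h0 : inner ℝ (L z) z = 0 := (Submodule.mem_orthogonal _ _).1 hz _ ⟨z, rfl⟩
    have h1 : inner ℝ (L z) z = inner ℝ (S.compLpL 2 (timeMeasure T) z) z +
        inner ℝ (B.compLpL 2 (timeMeasure T) (volterra hT z)) z := inner_add_left _ _ _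
    have h2 : 0 ≤ inner ℝ (B.compLpL 2 (timeMeasure T) (volterra hT z)) z := by
      have := partialInner_volterra_comp hT ⟨hT, le_rfl⟩ B hB z
      rw [partialInner_self_eq_inner hT] at this
      have := hpos (primitive z T)
      linarith
    have h3 : inner ℝ (S.compLpL 2 (timeMeasure T) z) z =
        inner ℝ (ι.compLpL 2 (timeMeasure T) z) (ι.compLpL 2 (timeMeasure T) z) := by
      rw [L2.inner_def, L2.inner_def]
      refine integral_congr_ae ?_
      filter_upwards [S.coeFn_compLpL z, ι.coeFn_compLpL z] with r h1 h2
      rw [h1, h2, hS, ContinuousLinearMap.comp_apply, ContinuousLinearMap.adjoint_inner_left]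
    have h4 : ι.compLpL 2 (timeMeasure T) z = 0 := by
      rw [← inner_self_eq_zero (𝕜 := ℝ)]
      have := real_inner_self_nonneg (x := ι.compLpL 2 (timeMeasure T) z)
      linarith
    rw [Lp.eq_zero_iff_ae_eq_zero] at h4 ⊢
    filter_upwards [h4, ι.coeFn_compLpL z] with r h5 h6
    exact hι (by rw [← h6, h5]; simp)
  have : F ∈ (LinearMap.range L).topologicalClosure := by rw [hcl]; trivial
  exact this

/-- Solvability of `(ι w)' + B w = F`, `w(0) = 0`, in `L²(0, T; V)`. -/
theorem exists_solution_zero_initial {T : ℝ} (hT : 0 ≤ T) (ι : V →L[ℝ] H)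
    (hι : Function.Injective ι)
    (B : V →L[ℝ] V) (hB : ∀ x y, inner ℝ (B x) y = inner ℝ x (B y)) {c : ℝ} (hc : 0 < c)
    (hcoer : ∀ x, c * ‖x‖ ^ 2 ≤ inner ℝ x (B x)) (F : Lp V 2 (timeMeasure T)) :
    ∃ (w g : Lp V 2 (timeMeasure T)) (U : ℝ → H), ContinuousOn U (Set.Icc 0 T) ∧
      (∀ᵐ t ∂(timeMeasure T), U t = ι (w t)) ∧ U 0 = 0 ∧
      (∀ t ∈ Set.Icc 0 T, ∀ v, inner ℝ (U t) (ι v) = ∫ r in (0 : ℝ)..t, inner ℝ (g r) v) ∧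
      (∀ t ∈ Set.Icc 0 T, ‖U t‖ ^ 2 = 2 * ∫ r in (0 : ℝ)..t, inner ℝ (w r) (g r)) ∧
      g + B.compLpL 2 (timeMeasure T) w = F := by
  set S := (ContinuousLinearMap.adjoint ι).comp ι with hS
  have hSι : ∀ x y, inner ℝ x (S y) = inner ℝ (ι x) (ι y) := fun x y => by
    rw [hS, ContinuousLinearMap.comp_apply, ContinuousLinearMap.adjoint_inner_right]
  have hSsymm : ∀ x y, inner ℝ (S x) y = inner ℝ x (S y) := fun x y => by
    rw [real_inner_comm, hSι, hSι, real_inner_comm]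
  have hSself : ∀ x, inner ℝ x (S x) = ‖ι x‖ ^ 2 := fun x => by
    rw [hSι, real_inner_self_eq_norm_sq]
  obtain ⟨k, hk, hkF⟩ := mem_closure_iff_seq_limit.1 (dense_range_parabolic hT ι hι B hB
    (fun x => (by positivity : (0 : ℝ) ≤ c * ‖x‖ ^ 2).trans (hcoer x)) F)
  choose h hh using hk
  set BX := B.compLpL 2 (timeMeasure T) with hBX
  set SX := S.compLpL 2 (timeMeasure T) with hSX
  -- A priori estimate: pair with `volterra hT z`. The `S` term contributes `‖ι p(T)‖² / 2 ≥ 0` and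
  -- can be dropped, while coercivity bounds the other term from below.
  have hbound : ∀ z : Lp V 2 (timeMeasure T),
      c * ‖volterra hT z‖ ≤ ‖SX z + BX (volterra hT z)‖ := by
    intro z
    have h1 := partialInner_comp_volterra hT ⟨hT, le_rfl⟩ S hSsymm z
    rw [partialInner_self_eq_inner hT, hSself] at h1
    have h2 : c * ‖volterra hT z‖ ^ 2 ≤ inner ℝ (volterra hT z) (BX (volterra hT z)) := by
      rw [← real_inner_self_eq_norm_sq, L2.inner_def, L2.inner_def, ← integral_const_mul]
      refine integral_mono_ae ((L2.integrable_inner (𝕜 := ℝ) _ _).const_mul _)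
        (L2.integrable_inner _ _) ?_
      filter_upwards [B.coeFn_compLpL (volterra hT z)] with r h1
      rw [real_inner_self_eq_norm_sq, h1]
      exact hcoer _
    have h3 : inner ℝ (volterra hT z) (SX z + BX (volterra hT z)) ≤
        ‖volterra hT z‖ * ‖SX z + BX (volterra hT z)‖ := real_inner_le_norm _ _
    rw [inner_add_right] at h3
    have h4 : ‖volterra hT z‖ * (c * ‖volterra hT z‖) ≤
        ‖volterra hT z‖ * ‖SX z + BX (volterra hT z)‖ := by
      nlinarith [sq_nonneg ‖ι (primitive z T)‖]
    rcases (norm_nonneg (volterra hT z)).eq_or_lt with h0 | h0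
    · rw [← h0, mul_zero]; exact norm_nonneg _
    · exact le_of_mul_le_mul_left h4 h0
  -- the approximating solutions converge
  have hcau : CauchySeq fun i => volterra hT (h i) := by
    have hk := hkF.cauchySeq
    rw [Metric.cauchySeq_iff] at hk ⊢
    intro ε hε
    obtain ⟨N, hN⟩ := hk (c * ε) (by positivity)
    refine ⟨N, fun i hi j hj => ?_⟩
    have h1 := hN i hi j hj
    rw [← hh, ← hh, dist_eq_norm] at h1
    have h2 := hbound (h i - h j)
    simp only [map_sub] at h2
    rw [dist_eq_norm]
    have h3 : c * ‖volterra hT (h i) - volterra hT (h j)‖ < c * ε := by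
      refine lt_of_le_of_lt (h2.trans (le_of_eq ?_)) h1
      congr 1; dsimp only; abel
    exact lt_of_mul_lt_mul_left h3 hc.le
  obtain ⟨w, hw⟩ := cauchySeq_tendsto_of_complete hcau
  -- Only `volterra hT (h i)` and `S (h i)` are shown to converge, not `h i`. The limit `g` of `S (h
  -- i)` represents the derivative of `ι w` in the dual of `V`.
  set g := F - BX w with hg
  have hgk : Tendsto (fun i => SX (h i)) atTop (𝓝 g) := by
    have : (fun i => SX (h i)) = fun i => k i - BX (volterra hT (h i)) := by
      funext i; rw [← hh]; simp [hSX, hBX]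
    rw [this]
    exact hkF.sub ((BX.continuous.tendsto w).comp hw)
  -- The energy identity for `h i - h j`, bounded independently of `t`, makes the `H`-valued
  -- primitives uniformly Cauchy.
  have hdiff : ∀ i j, ∀ t ∈ Set.Icc 0 T, ‖ι (primitive (h i) t) - ι (primitive (h j) t)‖ ^ 2 ≤
      2 * (‖volterra hT (h i) - volterra hT (h j)‖ * ‖SX (h i) - SX (h j)‖) := by
    intro i j t ht
    have h1 := partialInner_comp_volterra hT ht S hSsymm (h i - h j)
    rw [hSself] at h1
    have h2 := abs_partialInner_le T t (volterra hT (h i - h j)) (SX (h i - h j))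
    have h3 : primitive (h i - h j) t = primitive (h i) t - primitive (h j) t := by
      have := primitive_add ht (h i - h j) (h j)
      rw [sub_add_cancel] at this
      rw [this, add_sub_cancel_right]
    rw [h3] at h1
    rw [← map_sub, ← h1]
    simp only [map_sub] at h2 ⊢
    have := le_abs_self ((partialInner T t) (volterra hT (h i) - volterra hT (h j)) (SX (h i) - SX (h j)))
    simp only [map_sub] at this
    linarith
  have hunif : UniformCauchySeqOn (fun i t => ι (primitive (h i) t)) atTop (Set.Icc 0 T) := by
    rw [Metric.uniformCauchySeqOn_iff]
    intro ε hε
    obtain ⟨N, hN⟩ := Metric.cauchySeq_iff.1 hcau (ε / 2) (by positivity)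
    obtain ⟨N', hN'⟩ := Metric.cauchySeq_iff.1 hgk.cauchySeq (ε / 2) (by positivity)
    refine ⟨max N N', fun i hi j hj t ht => ?_⟩
    have h1 := hN i (le_of_max_le_left hi) j (le_of_max_le_left hj)
    have h2 := hN' i (le_of_max_le_right hi) j (le_of_max_le_right hj)
    rw [dist_eq_norm] at h1 h2 ⊢
    refine lt_of_pow_lt_pow_left₀ 2 hε.le ((hdiff i j t ht).trans_lt ?_)
    nlinarith [norm_nonneg (volterra hT (h i) - volterra hT (h j)), norm_nonneg (SX (h i) - SX (h j)),
      mul_lt_mul'' h1 h2 (norm_nonneg _) (norm_nonneg _)]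
  have hlim : ∀ t, ∃ x, t ∈ Set.Icc 0 T → Tendsto (fun i => ι (primitive (h i) t)) atTop (𝓝 x) := by
    intro t
    by_cases ht : t ∈ Set.Icc 0 T
    · obtain ⟨x, hx⟩ := cauchySeq_tendsto_of_complete (hunif.cauchySeq ht)
      exact ⟨x, fun _ => hx⟩
    · exact ⟨0, fun h => absurd h ht⟩
  choose U hU using hlim
  have hUunif := hunif.tendstoUniformlyOn_of_tendsto hU
  refine ⟨w, g, U, hUunif.continuousOn (Eventually.of_forall fun i =>
    ι.continuous.comp_continuousOn (continuousOn_primitive_Lp hT (h i))).frequently, ?_, ?_, ?_, ?_,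
    by rw [hg]; abel⟩
  -- Along a subsequence the primitives converge in `V` at almost every time, which identifies the
  -- uniform limit `U` with `ι w` there.
  · obtain ⟨ns, hns, hae⟩ := (tendstoInMeasure_of_tendsto_Lp hw).exists_seq_tendsto_ae
    have hall : ∀ᵐ t ∂(timeMeasure T), ∀ i, volterra hT (h i) t = primitive (h i) t :=
      ae_all_iff.2 fun i => coeFn_volterra hT (h i)
    filter_upwards [hae, hall, ae_timeMeasure_mem T] with t h1 h2 ht
    simp only [h2] at h1
    exact tendsto_nhds_unique ((hU t ht).comp hns.tendsto_atTop) ((ι.continuous.tendsto _).comp h1)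
  · refine tendsto_nhds_unique (hU 0 ⟨le_rfl, hT⟩) ?_
    simp [primitive]
  · intro t ht v
    have h1 : ∀ z : Lp V 2 (timeMeasure T), partialInner T t z
        ((memLp_const v : MemLp (fun _ => v) 2 (timeMeasure T)).toLp) =
        ∫ r in (0 : ℝ)..t, inner ℝ (z r) v := fun z => by
      rw [partialInner_apply ht]
      refine intervalIntegral_congr_timeMeasure ht ?_
      filter_upwards [(memLp_const v : MemLp (fun _ => v) 2 (timeMeasure T)).coeFn_toLp] with r hr
      rw [hr]
    -- Moving `ι*` across replaces the primitive of `h i` by that of `S (h i)`, and the latter has a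
    -- limit.
    have h2 : ∀ i, inner ℝ (ι (primitive (h i) t)) (ι v) =
        ∫ r in (0 : ℝ)..t, inner ℝ (SX (h i) r) v := fun i => by
      have h3 := (innerSL ℝ (S v)).intervalIntegral_comp_comm
        (intervalIntegrable_of_timeMeasure ht (integrable_coeFn_Lp (h i)))
      rw [← hSι, real_inner_comm]
      refine Eq.trans h3.symm (intervalIntegral_congr_timeMeasure ht ?_)
      filter_upwards [S.coeFn_compLpL (h i)] with r hr
      rw [hr, innerSL_apply_apply, hSsymm, real_inner_comm]
    rw [← h1]
    refine tendsto_nhds_unique (((hU t ht).inner tendsto_const_nhds)) ?_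
    simp only [h2, ← h1]
    exact tendsto_partialInner t hgk tendsto_const_nhds
  · intro t ht
    rw [← partialInner_apply ht]
    refine tendsto_nhds_unique ((hU t ht).norm.pow 2) ?_
    have h1 : ∀ i, ‖ι (primitive (h i) t)‖ ^ 2 =
        2 * partialInner T t (volterra hT (h i)) (SX (h i)) := fun i => by
      rw [partialInner_comp_volterra hT ht S hSsymm, hSself]
    simp only [h1]
    exact (tendsto_partialInner t hw hgk).const_mul 2

end Parabolic

/-! ### Weak derivatives on `(0, T)` and the du Bois-Reymond lemma. -/

section WeakDerivative

theorem eq_zero_of_tsupport_subset {T : ℝ} {φ : ℝ → ℝ} (hφ : tsupport φ ⊆ Set.Ioo 0 T) :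
    φ 0 = 0 ∧ φ T = 0 := by
  constructor <;> refine image_eq_zero_of_notMem_tsupport fun h => ?_
  · exact lt_irrefl _ (hφ h).1
  · exact lt_irrefl _ (hφ h).2

/-- A primitive of `w` has weak derivative `w`. -/
theorem integral_deriv_mul_primitive {T : ℝ} (hT : 0 ≤ T) {c w : ℝ → ℝ} {c₀ : ℝ}
    (hw : Integrable w (timeMeasure T))
    (hc : c =ᵐ[timeMeasure T] fun t => c₀ + ∫ r in (0 : ℝ)..t, w r)
    {φ : ℝ → ℝ} (hφ : ContDiff ℝ ∞ φ) (hφs : tsupport φ ⊆ Set.Ioo 0 T) :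
    ∫ t, deriv φ t * c t ∂(timeMeasure T) = -∫ t, φ t * w t ∂(timeMeasure T) := by
  obtain ⟨h0, hT0⟩ := eq_zero_of_tsupport_subset hφs
  have hd : Continuous (deriv φ) := hφ.continuous_deriv (by simp)
  have hprim : ∀ t, ∫ r in (0 : ℝ)..t, deriv φ r = φ t := fun t => by
    rw [intervalIntegral.integral_deriv_eq_sub (fun x _ => hφ.differentiable (by simp) x)
      (hd.intervalIntegrable _ _), h0, sub_zero]
  have hTT : T ∈ Set.Icc 0 T := ⟨hT, le_rfl⟩
  have hwT := intervalIntegrable_of_timeMeasure hTT hw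
  -- The test function is itself the primitive of `deriv φ`, so the product rule applies, and its
  -- boundary term vanishes because `φ T = 0`.
  have h1 := integral_primitive_add_integral_primitive (ContinuousLinearMap.mul ℝ ℝ) hT
    (hd.intervalIntegrable 0 T) hwT
  simp only [hprim, hT0, ContinuousLinearMap.mul_apply', zero_mul] at h1
  rw [integral_timeMeasure hT, integral_timeMeasure hT]
  have h2 : ∫ r in (0 : ℝ)..T, deriv φ r * c r =
      ∫ r in (0 : ℝ)..T, (deriv φ r * c₀ + deriv φ r * ∫ q in (0 : ℝ)..r, w q) := by
    refine intervalIntegral_congr_timeMeasure hTT ?_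
    filter_upwards [hc] with r hr
    rw [hr, mul_add]
  rw [h2, intervalIntegral.integral_add ((hd.intervalIntegrable _ _).mul_const _),
    intervalIntegral.integral_mul_const, hprim, hT0]
  · linarith
  · refine intervalIntegrable_of_timeMeasure hTT ?_
    exact ((ContinuousOn.memLp_timeMeasure (hd.continuousOn.mul
      (continuousOn_primitive hT hw)) 1).integrable le_rfl)

/-- The du Bois-Reymond lemma on `(0, T)`. -/
theorem ae_eq_const_of_integral_deriv_eq_zero {T : ℝ} (hT : 0 < T) {d : ℝ → ℝ}
    (hd : Integrable d (timeMeasure T))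
    (h : ∀ φ : ℝ → ℝ, ContDiff ℝ ∞ φ → HasCompactSupport φ → tsupport φ ⊆ Set.Ioo 0 T →
      ∫ t, deriv φ t * d t ∂(timeMeasure T) = 0) :
    ∃ C : ℝ, ∀ᵐ t ∂(timeMeasure T), d t = C := by
  -- A bump of mass one whose support `[T/4, 3T/4]` lies inside `(0, T)`; the constant sought is the
  -- average of `d` against it.
  let ρ₀ : ContDiffBump (T / 2) := ⟨T / 8, T / 4, by positivity, by linarith⟩
  set ρ := ρ₀.normed volume with hρ
  have hρs : tsupport ρ ⊆ Set.Ioo 0 T := by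
    rw [hρ, ρ₀.tsupport_normed_eq, Real.closedBall_eq_Icc]
    intro x hx
    have h1 : T / 2 - T / 4 ≤ x := hx.1
    have h2 : x ≤ T / 2 + T / 4 := hx.2
    constructor <;> linarith
  have hρc : HasCompactSupport ρ := ρ₀.hasCompactSupport_normed
  have hρd : ContDiff ℝ ∞ ρ := ρ₀.contDiff_normed
  have hρ1 : ∫ t, ρ t = 1 := ρ₀.integral_normed
  set C := ∫ t, ρ t * d t ∂(timeMeasure T) with hC
  refine ⟨C, ?_⟩
  have hmulint : ∀ ψ : ℝ → ℝ, Continuous ψ →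
      Integrable (fun t => ψ t * d t) (timeMeasure T) := fun ψ hψ => by
    obtain ⟨M, hM⟩ := (isCompact_Icc (a := 0) (b := T)).exists_bound_of_continuousOn hψ.continuousOn
    refine hd.bdd_mul hψ.aestronglyMeasurable (c := M) ?_
    filter_upwards [ae_timeMeasure_mem T] with t ht using hM t ht
  have hsub : ∀ᵐ x : ℝ, x ∈ Set.Ioo 0 T → d x - C = 0 := by
    refine isOpen_Ioo.ae_eq_zero_of_integral_contDiff_smul_eq_zero
      (IntegrableOn.locallyIntegrableOn (hd.sub (integrable_const C))) fun ψ hψ hψc hψs => ?_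
    set I := ∫ t, ψ t with hI
    -- Removing the mean of `ψ` with the fixed bump makes the primitive of `η` compactly supported,
    -- so that `η` is the derivative of an admissible test function.
    set η : ℝ → ℝ := fun t => ψ t - I * ρ t with hη
    have hηd : ContDiff ℝ ∞ η := hψ.sub (contDiff_const.mul hρd)
    have hηc : Continuous η := hηd.continuous
    have hηI : ∫ t, η t = 0 := by
      rw [hη, integral_sub (hψ.continuous.integrable_of_hasCompactSupport hψc)
        ((hρd.continuous.integrable_of_hasCompactSupport hρc).const_mul _), integral_const_mul, hρ1]
      simp [hI]
    have hK : IsCompact (tsupport ψ ∪ tsupport ρ) := hψc.isCompact.union hρc.isCompact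
    have hKs : tsupport ψ ∪ tsupport ρ ⊆ Set.Ioo 0 T := Set.union_subset hψs hρs
    have hKne : (tsupport ψ ∪ tsupport ρ).Nonempty := by
      rw [hρ, ρ₀.tsupport_normed_eq]
      exact ⟨T / 2, Or.inr (Metric.mem_closedBall_self (by positivity))⟩
    obtain ⟨α, hα, hαm⟩ := hK.exists_isLeast hKne
    obtain ⟨β, hβ, hβm⟩ := hK.exists_isGreatest hKne
    have hα0 := (hKs hα).1
    have hβT := (hKs hβ).2
    have hηs : Function.support η ⊆ Set.Icc α β := by
      intro x hx
      have : x ∈ tsupport ψ ∪ tsupport ρ := by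
        by_contra hcon
        rw [Set.mem_union, not_or] at hcon
        apply hx
        simp [hη, image_eq_zero_of_notMem_tsupport hcon.1,
          image_eq_zero_of_notMem_tsupport hcon.2]
      exact ⟨hαm this, hβm this⟩
    -- The base point `α / 2` lies strictly to the left of the support of `η`. To the right of `β`
    -- the primitive is the full integral of `η`, which is zero.
    set φ : ℝ → ℝ := fun t => ∫ r in (α / 2)..t, η r with hφ
    have hφd : ∀ t, HasDerivAt φ (η t) t := fun t =>
      intervalIntegral.integral_hasDerivAt_right (hηc.intervalIntegrable _ _)
        (hηc.stronglyMeasurableAtFilter _ _) hηc.continuousAt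
    have hφderiv : deriv φ = η := funext fun t => (hφd t).deriv
    have hφsupp : Function.support φ ⊆ Set.Icc α β := by
      intro x hx
      by_contra hcon
      apply hx
      rw [Set.mem_Icc, not_and_or, not_le, not_le] at hcon
      rcases hcon with hcon | hcon
      · rw [hφ]
        have hα2 : α / 2 < α := by linarith
        dsimp only
        rw [intervalIntegral.integral_congr (g := fun _ => (0 : ℝ))]
        · simp
        · intro r hr
          by_contra hne
          have h1 := (hηs hne).1
          have h2 : r ≤ max (α / 2) x := hr.2
          rcases le_max_iff.1 h2 with h3 | h3 <;> linarith
      · rw [hφ, ← hηI]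
        dsimp only
        refine intervalIntegral.integral_eq_integral_of_support_subset fun r hr => ?_
        have := hηs hr
        exact ⟨by linarith [this.1], by linarith [this.2]⟩
    have hφts : tsupport φ ⊆ Set.Icc α β := closure_minimal hφsupp isClosed_Icc
    have hφC : ContDiff ℝ ∞ φ := by
      rw [contDiff_infty_iff_deriv, hφderiv]
      exact ⟨fun t => (hφd t).differentiableAt, hηd⟩
    have h1 := h φ hφC (HasCompactSupport.of_support_subset_isCompact isCompact_Icc hφsupp)
      (hφts.trans (Set.Icc_subset_Ioo hα0 hβT))
    rw [hφderiv] at h1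
    have h2 : ∫ t, ψ t * d t ∂(timeMeasure T) - I * C = 0 := by
      rw [← h1, hC, ← integral_const_mul, ← integral_sub (hmulint ψ hψ.continuous)
        ((hmulint ρ hρd.continuous).const_mul I)]
      refine integral_congr_ae (Eventually.of_forall fun t => ?_)
      simp only [hη]; ring
    have h3 : ∀ k : ℝ → ℝ, ∫ t, ψ t * k t ∂(timeMeasure T) = ∫ t, ψ t * k t := fun k => by
      rw [timeMeasure]
      refine setIntegral_eq_integral_of_forall_compl_eq_zero fun t ht => ?_
      rw [image_eq_zero_of_notMem_tsupport fun h' => ht (hψs h'), zero_mul]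
    simp only [smul_eq_mul]
    rw [← h3 (fun t => d t - C)]
    have h4 : ∫ t, ψ t * C ∂(timeMeasure T) = I * C := by
      rw [h3 (fun _ => C), integral_mul_const]
    calc ∫ t, ψ t * (d t - C) ∂(timeMeasure T)
        = ∫ t, ψ t * d t ∂(timeMeasure T) - ∫ t, ψ t * C ∂(timeMeasure T) := by
          rw [← integral_sub (hmulint ψ hψ.continuous)]
          · simp only [mul_sub]
          · exact ((hψ.continuous.integrable_of_hasCompactSupport hψc).mul_const C).restrict
      _ = 0 := by rw [h4, h2]
  rw [timeMeasure, ae_restrict_iff' measurableSet_Ioo]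
  filter_upwards [hsub] with t ht hmem using sub_eq_zero.1 (ht hmem)

/-- A continuous function with weak derivative `w` is a primitive of `w`. -/
theorem eq_add_primitive_of_weak {T : ℝ} (hT : 0 < T) {c w : ℝ → ℝ}
    (hc : ContinuousOn c (Set.Icc 0 T)) (hw : Integrable w (timeMeasure T))
    (h : ∀ φ : ℝ → ℝ, ContDiff ℝ ∞ φ → HasCompactSupport φ → tsupport φ ⊆ Set.Ioo 0 T →
      ∫ t, deriv φ t * c t ∂(timeMeasure T) = -∫ t, φ t * w t ∂(timeMeasure T))
    {t : ℝ} (ht : t ∈ Set.Icc 0 T) : c t = c 0 + ∫ r in (0 : ℝ)..t, w r := by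
  have hp := continuousOn_primitive hT.le hw
  have hint : ∀ {k : ℝ → ℝ}, ContinuousOn k (Set.Icc 0 T) → Integrable k (timeMeasure T) :=
    fun hk => (ContinuousOn.memLp_timeMeasure hk 1).integrable le_rfl
  have hd : ContinuousOn (fun t => c t - ∫ r in (0 : ℝ)..t, w r) (Set.Icc 0 T) := hc.sub hp
  -- The difference between `c` and the primitive of `w` has zero weak derivative; by continuity it
  -- is constant up to the endpoints, and the constant is its value at `0`.
  obtain ⟨C, hC⟩ := ae_eq_const_of_integral_deriv_eq_zero hT (hint hd) fun φ hφ hφc hφs => by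
    have hdφ : ContinuousOn (deriv φ) (Set.Icc 0 T) := (hφ.continuous_deriv (by simp)).continuousOn
    have h1 := integral_deriv_mul_primitive hT.le (c₀ := 0) hw
      (Eventually.of_forall fun t => rfl) hφ hφs
    simp only [zero_add] at h1
    simp only [mul_sub]
    refine (integral_sub (hint (hdφ.mul hc)) (hint (hdφ.mul hp))).trans ?_
    simp only [Pi.mul_apply]
    rw [h φ hφ hφc hφs, h1, sub_self]
  have h2 := eqOn_of_ae_timeMeasure hT hd continuousOn_const hC
  have h3 := h2 ht
  have h4 := h2 (⟨le_rfl, hT.le⟩ : (0 : ℝ) ∈ Set.Icc 0 T)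
  simp only [intervalIntegral.integral_same, sub_zero] at h3 h4
  linarith

end WeakDerivative

/-! ### The parabolic problem for a symmetric coercive form: existence and uniqueness. -/

section ParabolicForm

set_option linter.unusedSectionVars false

variable {V H : Type*} [NormedAddCommGroup V] [InnerProductSpace ℝ V] [CompleteSpace V]
  [NormedAddCommGroup H] [InnerProductSpace ℝ H] [CompleteSpace H]

/-- Solvability of `⟨(ι u)', v⟩ + a(u, v) = f(v)`, `u(0) = u₀`, for a symmetric coercive bounded
form, together with the energy identity. -/
theorem exists_parabolic_solution {T : ℝ} (hT : 0 ≤ T) (ι : V →L[ℝ] H)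
    (hι : Function.Injective ι) (a : V →L[ℝ] V →L[ℝ] ℝ) (ha : ∀ x y, a x y = a y x) {c : ℝ}
    (hc : 0 < c) (hcoer : ∀ x, c * ‖x‖ ^ 2 ≤ a x x) {f : ℝ → StrongDual ℝ V}
    (hf : MemLp f 2 (timeMeasure T)) (u₀ : V) :
    ∃ (u : ℝ → V) (U : ℝ → H), MemLp u 2 (timeMeasure T) ∧ ContinuousOn U (Set.Icc 0 T) ∧
      (∀ᵐ t ∂(timeMeasure T), U t = ι (u t)) ∧ U 0 = ι u₀ ∧
      (∀ t ∈ Set.Icc 0 T, ∀ v, inner ℝ (U t) (ι v) =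
        inner ℝ (ι u₀) (ι v) + ∫ r in (0 : ℝ)..t, (f r v - a (u r) v)) ∧
      (∀ t ∈ Set.Icc 0 T, ‖U t‖ ^ 2 =
        ‖ι u₀‖ ^ 2 + 2 * ∫ r in (0 : ℝ)..t, (f r (u r) - a (u r) (u r))) := by
  -- The inverse Riesz map, conjugate-linear in general, is rebundled as a linear map over `ℝ`.
  let R : StrongDual ℝ V →L[ℝ] V := LinearMap.mkContinuous
    { toFun := (InnerProductSpace.toDual ℝ V).symm
      map_add' := map_add _
      map_smul' := fun c l => by simp } 1 (fun l => by simp)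
  have hR : ∀ (l : StrongDual ℝ V) v, inner ℝ (R l) v = l v := fun l v =>
    InnerProductSpace.toDual_symm_apply
  let B : V →L[ℝ] V := R.comp a
  have hBa : ∀ x y, inner ℝ (B x) y = a x y := fun x y => hR _ _
  have hBsymm : ∀ x y, inner ℝ (B x) y = inner ℝ x (B y) := fun x y => by
    rw [hBa, real_inner_comm, hBa, ha]
  -- Shift by the initial value: `u = u₀ + w` with `w(0) = 0` moves `B u₀` to the right-hand side,
  -- which makes sense because `u₀ ∈ V`.
  have hF : MemLp (fun t => R (f t) - B u₀) 2 (timeMeasure T) := by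
    refine MemLp.sub ?_ (memLp_const _)
    exact R.comp_memLp' hf
  obtain ⟨w, g, W, hWc, hWw, hW0, hWv, hWe, hwg⟩ := exists_solution_zero_initial hT ι hι B hBsymm hc
    (fun x => by rw [← hBsymm, hBa]; exact hcoer x) hF.toLp
  have hg : ∀ᵐ t ∂(timeMeasure T), ∀ v, inner ℝ (g t) v = f t v - a (u₀ + w t) v := by
    have h1 := hF.coeFn_toLp
    rw [← hwg] at h1
    filter_upwards [h1, Lp.coeFn_add g (B.compLpL 2 (timeMeasure T) w), B.coeFn_compLpL w]
      with t h2 h3 h4 v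
    rw [h3, Pi.add_apply, h4] at h2
    have h5 : g t = R (f t) - B u₀ - B (w t) := by rw [← h2]; abel
    rw [h5, inner_sub_left, inner_sub_left, hR, hBa, hBa, map_add, add_apply]
    ring
  have hgint : Integrable g (timeMeasure T) := integrable_coeFn_Lp g
  refine ⟨fun t => u₀ + w t, fun t => ι u₀ + W t, (memLp_const u₀).add (Lp.memLp w),
    continuousOn_const.add hWc, ?_, by simp [hW0], ?_, ?_⟩
  · filter_upwards [hWw] with t ht
    rw [ht, map_add]
  · intro t ht v
    rw [inner_add_left, hWv t ht]
    congr 1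
    refine intervalIntegral_congr_timeMeasure ht ?_
    filter_upwards [hg] with r hr using hr v
  · intro t ht
    -- The cross term `2⟨ι u₀, W t⟩` is the pairing identity with `v = u₀`; it combines with `2∫⟨w,
    -- g⟩` into `2∫⟨g, u₀ + w⟩`.
    rw [norm_add_sq_real, hWe t ht, real_inner_comm, hWv t ht, add_assoc, ← mul_add,
      ← intervalIntegral.integral_add
        (intervalIntegrable_of_timeMeasure ht (hgint.inner_const u₀))
        (intervalIntegrable_of_timeMeasure ht (L2.integrable_inner w g))]
    congr 2
    refine intervalIntegral_congr_timeMeasure ht ?_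
    filter_upwards [hg] with r hr
    rw [← hr, inner_add_right, real_inner_comm (g r) (w r)]

/-- Uniqueness for the homogeneous problem with zero initial value. -/
theorem ae_eq_zero_of_homogeneous {T : ℝ} (hT : 0 ≤ T) (ι : V →L[ℝ] H)
    (hι : Function.Injective ι) (a : V →L[ℝ] V →L[ℝ] ℝ) (ha : ∀ x y, a x y = a y x)
    (hpos : ∀ x, 0 ≤ a x x) {z : ℝ → V} (hz : MemLp z 2 (timeMeasure T))
    (h : ∀ᵐ t ∂(timeMeasure T), ∀ v, inner ℝ (ι (z t)) (ι v) = -∫ r in (0 : ℝ)..t, a (z r) v) :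
    z =ᵐ[timeMeasure T] 0 := by
  have hzi : Integrable z (timeMeasure T) := hz.integrable one_le_two
  have hTT : T ∈ Set.Icc 0 T := ⟨hT, le_rfl⟩
  -- Testing at time `t` with `v = z t` turns the right-hand side into `-a(Z, Z')` for the primitive
  -- `Z` of `z`, an exact derivative by symmetry of `a`.
  have h1 : (fun t => ‖ι (z t)‖ ^ 2) =ᵐ[timeMeasure T]
      fun t => -a (∫ r in (0 : ℝ)..t, z r) (z t) := by
    filter_upwards [h, ae_timeMeasure_mem T] with t h2 ht
    rw [← real_inner_self_eq_norm_sq, h2]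
    exact congrArg Neg.neg
      ((a.flip (z t)).intervalIntegral_comp_comm (intervalIntegrable_of_timeMeasure ht hzi))
  have h2 : ∫ t, ‖ι (z t)‖ ^ 2 ∂(timeMeasure T) ≤ 0 := by
    rw [integral_congr_ae h1, integral_neg, integral_timeMeasure hT]
    have h3 := two_mul_integral_primitive a ha hT (intervalIntegrable_of_timeMeasure hTT hzi)
    have h4 := hpos (∫ r in (0 : ℝ)..T, z r)
    linarith
  have h3 : Integrable (fun t => ‖ι (z t)‖ ^ 2) (timeMeasure T) :=
    (ι.comp_memLp' hz).norm.integrable_sq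
  have h4 := (integral_eq_zero_iff_of_nonneg (fun t => by positivity) h3).1
    (le_antisymm h2 (integral_nonneg fun t => by positivity))
  filter_upwards [h4] with t ht
  apply hι
  have : ‖ι (z t)‖ ^ 2 = 0 := ht
  simpa using this

end ParabolicForm

/-! ### Plancherel's theorem for the Fourier integral on `L¹ ∩ L²`. -/

section Plancherel

open scoped FourierTransform

variable {E : Type*} [NormedAddCommGroup E] [InnerProductSpace ℝ E] [FiniteDimensional ℝ E]
  [MeasurableSpace E] [BorelSpace E]

theorem continuous_fourier_of_integrable {f : E → ℂ} (hf : Integrable f) : Continuous (𝓕 f) :=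
  VectorFourier.fourierIntegral_continuous Real.continuous_fourierChar
    (by exact continuous_inner) hf

/-- On `L¹ ∩ L²` the `L²`-Fourier transform is the Fourier integral. -/
theorem fourier_toLp_ae_eq {f : E → ℂ} (hf : Integrable f) (hf2 : MemLp f 2) :
    (𝓕 hf2.toLp : Lp ℂ 2 (volume : Measure E)) =ᵐ[volume] 𝓕 f := by
  have hloc : LocallyIntegrable (𝓕 f) (volume : Measure E) :=
    (continuous_fourier_of_integrable hf).locallyIntegrable
  have hloc2 : LocallyIntegrable (𝓕 hf2.toLp : Lp ℂ 2 (volume : Measure E)) volume :=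
    (Lp.memLp _).locallyIntegrable one_le_two
  have h := ae_eq_zero_of_integral_contDiff_smul_eq_zero (hloc2.sub hloc) fun g hg hgc => by
    have hg₁ : HasCompactSupport (Complex.ofRealCLM ∘ g) := hgc.comp_left rfl
    have hg₂ : ContDiff ℝ ∞ (Complex.ofRealCLM ∘ g) := by fun_prop
    set G : SchwartzMap E ℂ := hg₁.toSchwartzMap hg₂ with hG
    have hGg : ∀ x, G x = (g x : ℂ) := fun x => rfl
    -- Both transforms satisfy the duality formula `∫ G f̂ = ∫ Ĝ f`: the `L²` one as a tempered
    -- distribution, the integral one by Fubini. Hence they agree against every smooth compactly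
    -- supported function.
    have h1 : ∫ x, G x • (𝓕 hf2.toLp : Lp ℂ 2 (volume : Measure E)) x =
        ∫ x, (𝓕 G) x • (hf2.toLp : Lp ℂ 2 (volume : Measure E)) x := by
      have h2 := Lp.fourier_toTemperedDistribution_eq (hf2.toLp : Lp ℂ 2 (volume : Measure E))
      have h3 := DFunLike.congr_fun h2 G
      rw [TemperedDistribution.fourier_apply, Lp.toTemperedDistribution_apply,
        Lp.toTemperedDistribution_apply] at h3
      exact h3.symm
    have h2 : ∫ x, (𝓕 G) x • (hf2.toLp : Lp ℂ 2 (volume : Measure E)) x = ∫ x, (𝓕 G) x • f x :=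
      integral_congr_ae (by filter_upwards [hf2.coeFn_toLp] with x hx; rw [hx])
    have h3 : ∫ x, (𝓕 G) x • f x = ∫ x, G x • 𝓕 f x := by
      have h4 := VectorFourier.integral_fourierIntegral_smul_eq_flip (μ := (volume : Measure E))
        (ν := (volume : Measure E)) (L := innerₗ E) Real.continuous_fourierChar
        (by exact continuous_inner) G.integrable hf
      rw [flip_innerₗ] at h4
      exact h4
    have hi1 : Integrable (fun x => g x • (𝓕 hf2.toLp : Lp ℂ 2 (volume : Measure E)) x) :=
      hloc2.integrable_smul_left_of_hasCompactSupport hg.continuous hgc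
    have hi2 : Integrable (fun x => g x • 𝓕 f x) :=
      hloc.integrable_smul_left_of_hasCompactSupport hg.continuous hgc
    simp only [Pi.sub_apply, smul_sub]
    rw [integral_sub hi1 hi2, sub_eq_zero]
    have h4 := (h1.trans h2).trans h3
    simpa only [hGg, Complex.coe_smul, smul_eq_mul, Complex.real_smul] using h4
  filter_upwards [h] with x hx using sub_eq_zero.1 hx

/-- Plancherel's theorem on `L¹ ∩ L²`. -/
theorem lintegral_enorm_fourier_sq {f : E → ℂ} (hf : Integrable f) (hf2 : MemLp f 2) :
    ∫⁻ ξ, ‖𝓕 f ξ‖ₑ ^ 2 = ∫⁻ x, ‖f x‖ₑ ^ 2 := by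
  have h1 : eLpNorm (𝓕 f) 2 volume = eLpNorm f 2 volume := by
    rw [← eLpNorm_congr_ae (fourier_toLp_ae_eq hf hf2), ← eLpNorm_congr_ae hf2.coeFn_toLp,
      ← ENNReal.toReal_eq_toReal_iff' (Lp.memLp _).2.ne (Lp.memLp _).2.ne]
    have := Lp.norm_fourier_eq (hf2.toLp : Lp ℂ 2 (volume : Measure E))
    rwa [Lp.norm_def, Lp.norm_def] at this
  have h2 : ∀ g : E → ℂ, ∫⁻ x, ‖g x‖ₑ ^ 2 = eLpNorm g 2 volume ^ 2 := fun g => by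
    rw [eLpNorm_eq_lintegral_rpow_enorm_toReal two_ne_zero ENNReal.ofNat_ne_top,
      ← ENNReal.rpow_natCast _ 2, ← ENNReal.rpow_mul]
    simp
  rw [h2, h2, h1]

end Plancherel

/-! ### Cosine and sine moments of Gaussians. -/

section Gaussian

open scoped FourierTransform

variable {n : ℕ}

theorem integrable_gaussian {t : ℝ} (ht : 0 < t) :
    Integrable fun h : Eucl n => Real.exp (-t * ‖h‖ ^ 2) := by
  have h1 := GaussianFourier.integrable_cexp_neg_mul_sq_norm_add (V := Eucl n) (b := (t : ℂ))
    (by simpa using ht) 0 0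
  refine h1.re.congr (Eventually.of_forall fun h => ?_)
  have : (-(t : ℂ) * (‖h‖ : ℂ) ^ 2 + 0 * (inner ℝ (0 : Eucl n) h : ℝ) : ℂ) =
      ((-t * ‖h‖ ^ 2 : ℝ) : ℂ) := by push_cast; ring
  simp only [this]
  rw [← Complex.ofReal_exp]
  exact Complex.ofReal_re _

theorem fourier_gaussian_real {t : ℝ} (ht : 0 < t) (ξ : Eucl n) :
    𝓕 (fun h : Eucl n => (Real.exp (-t * ‖h‖ ^ 2) : ℂ)) ξ =
      (((Real.pi / t) ^ ((n : ℝ) / 2) * Real.exp (-(Real.pi ^ 2 * ‖ξ‖ ^ 2) / t) : ℝ) : ℂ) := by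
  have h1 := fourier_gaussian_innerProductSpace (V := Eucl n) (b := (t : ℂ)) (by simpa using ht) ξ
  have h2 : (fun h : Eucl n => (Real.exp (-t * ‖h‖ ^ 2) : ℂ)) =
      fun h : Eucl n => Complex.exp (-(t : ℂ) * ‖h‖ ^ 2) := by
    funext h; push_cast; rfl
  rw [h2, h1]
  push_cast
  rw [Complex.ofReal_cpow (by positivity)]
  push_cast
  simp

theorem re_fourierChar_smul (θ a : ℝ) : (Real.fourierChar (-θ) • (a : ℂ)).re =
    Real.cos (2 * Real.pi * θ) * a := by
  rw [Circle.smul_def, Real.fourierChar_apply, smul_eq_mul, Complex.re_mul_ofReal]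
  have : (2 * Real.pi * (-θ : ℝ) : ℝ) = -(2 * Real.pi * θ) := by ring
  rw [this, Complex.exp_ofReal_mul_I_re, Real.cos_neg]

theorem im_fourierChar_smul (θ a : ℝ) : (Real.fourierChar (-θ) • (a : ℂ)).im =
    -(Real.sin (2 * Real.pi * θ) * a) := by
  rw [Circle.smul_def, Real.fourierChar_apply, smul_eq_mul, Complex.im_mul_ofReal]
  have : (2 * Real.pi * (-θ : ℝ) : ℝ) = -(2 * Real.pi * θ) := by ring
  rw [this, Complex.exp_ofReal_mul_I_im, Real.sin_neg, neg_mul]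

theorem integral_cos_mul_gaussian {t : ℝ} (ht : 0 < t) (ξ : Eucl n) :
    ∫ h : Eucl n, Real.cos (2 * Real.pi * inner ℝ h ξ) * Real.exp (-t * ‖h‖ ^ 2) =
      (Real.pi / t) ^ ((n : ℝ) / 2) * Real.exp (-(Real.pi ^ 2 * ‖ξ‖ ^ 2) / t) := by
  have h1 := congrArg Complex.re (fourier_gaussian_real ht ξ)
  rw [Complex.ofReal_re] at h1
  rw [← h1, Real.fourier_eq]
  have h2 := integral_re (𝕜 := ℂ) ((Real.fourierIntegral_convergent_iff ξ).2
    (integrable_gaussian (n := n) ht).ofReal)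
  simp only [RCLike.re_eq_complex_re] at h2
  refine Eq.trans (integral_congr_ae (Eventually.of_forall fun h => ?_)) h2
  dsimp only
  rw [← re_fourierChar_smul]; rfl

/-- Half of the exponent absorbs the factor `‖h‖`, through `x + 1 ≤ exp x`; the other half remains
integrable. -/
theorem integrable_norm_mul_gaussian {t : ℝ} (ht : 0 < t) :
    Integrable fun h : Eucl n => ‖h‖ * Real.exp (-t * ‖h‖ ^ 2) := by
  have h1 := (integrable_gaussian (n := n) (half_pos ht)).const_mul (1 + 2 / t)
  refine h1.mono' (by fun_prop) (Eventually.of_forall fun h => ?_)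
  rw [Real.norm_of_nonneg (by positivity)]
  have h2 : Real.exp (-t * ‖h‖ ^ 2) = Real.exp (-(t / 2) * ‖h‖ ^ 2) *
      Real.exp (-(t / 2) * ‖h‖ ^ 2) := by rw [← Real.exp_add]; ring_nf
  rw [h2, ← mul_assoc]
  gcongr
  have h3 : (t / 2) * ‖h‖ ^ 2 + 1 ≤ Real.exp ((t / 2) * ‖h‖ ^ 2) := Real.add_one_le_exp _
  have h4 : Real.exp (-(t / 2) * ‖h‖ ^ 2) = (Real.exp ((t / 2) * ‖h‖ ^ 2))⁻¹ := by
    rw [← Real.exp_neg]; ring_nf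
  rw [h4, ← div_eq_mul_inv, div_le_iff₀ (Real.exp_pos _)]
  calc ‖h‖ ≤ (1 + 2 / t) * (t / 2 * ‖h‖ ^ 2 + 1) := by
        have h5 : 0 ≤ t / 2 * ‖h‖ ^ 2 := by positivity
        have h6 : (2 / t) * (t / 2 * ‖h‖ ^ 2) = ‖h‖ ^ 2 := by field_simp
        have h7 : 0 < 2 / t := by positivity
        nlinarith [sq_nonneg (‖h‖ - 1)]
    _ ≤ _ := by gcongr

/-- Differentiating the Fourier transform of the Gaussian at `ξ` in direction `e` brings down a
factor `-2πi⟨h, e⟩`. The real part of the result is the sine integral, while the explicit transform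
differentiates directly. -/
theorem integral_sin_mul_inner_mul_gaussian {t : ℝ} (ht : 0 < t) (ξ e : Eucl n) :
    ∫ h : Eucl n, Real.sin (2 * Real.pi * inner ℝ h ξ) * inner ℝ h e * Real.exp (-t * ‖h‖ ^ 2) =
      Real.pi / t * inner ℝ ξ e *
        ((Real.pi / t) ^ ((n : ℝ) / 2) * Real.exp (-(Real.pi ^ 2 * ‖ξ‖ ^ 2) / t)) := by
  set f : Eucl n → ℂ := fun h => (Real.exp (-t * ‖h‖ ^ 2) : ℂ) with hf
  have hfi : Integrable f := (integrable_gaussian (n := n) ht).ofReal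
  have hfi2 : Integrable fun h => ‖h‖ * ‖f h‖ := by
    refine (integrable_norm_mul_gaussian (n := n) ht).congr (Eventually.of_forall fun h => ?_)
    simp only [hf, Complex.norm_real, Real.norm_eq_abs, Real.abs_exp]
  have h1 := Real.hasFDerivAt_fourier hfi hfi2 ξ
  have h2 : 𝓕 f = fun ξ => (((Real.pi / t) ^ ((n : ℝ) / 2) *
      Real.exp (-(Real.pi ^ 2 * ‖ξ‖ ^ 2) / t) : ℝ) : ℂ) := funext fun ξ => fourier_gaussian_real ht ξ
  rw [h2] at h1
  have h3 : HasFDerivAt (fun ξ : Eucl n => ((Real.pi / t) ^ ((n : ℝ) / 2) *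
      Real.exp (-(Real.pi ^ 2 * ‖ξ‖ ^ 2) / t) : ℝ)) _ ξ :=
    (((((hasStrictFDerivAt_norm_sq ξ).hasFDerivAt.const_mul (Real.pi ^ 2)).neg).mul_const
      t⁻¹).exp).const_mul _
  have h4 := (Complex.ofRealCLM.hasFDerivAt.comp ξ h3).unique h1
  have h5 := congrArg Complex.re (DFunLike.congr_fun h4 e)
  have hint : Integrable (VectorFourier.fourierSMulRight (innerSL ℝ) f) := by
    refine Integrable.mono' (hfi2.const_mul (2 * Real.pi * ‖innerSL ℝ (E := Eucl n)‖)) ?_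
      (Eventually.of_forall fun h => ?_)
    · exact hfi.aestronglyMeasurable.fourierSMulRight
    · rw [← mul_assoc]
      exact VectorFourier.norm_fourierSMulRight_le _ _ _
  rw [Real.fourier_continuousLinearMap_apply hint, Real.fourier_eq] at h5
  have hint2 : Integrable fun h => VectorFourier.fourierSMulRight (innerSL ℝ) f h e :=
    hint.apply_continuousLinearMap e
  have h6 := integral_re (𝕜 := ℂ) ((Real.fourierIntegral_convergent_iff ξ).2 hint2)
  simp only [RCLike.re_eq_complex_re] at h6
  rw [← h6] at h5
  have h7 : ∀ h : Eucl n, (Real.fourierChar (-inner ℝ h ξ) •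
      VectorFourier.fourierSMulRight (innerSL ℝ) f h e).re =
      -(2 * Real.pi) * (Real.sin (2 * Real.pi * inner ℝ h ξ) * inner ℝ h e *
        Real.exp (-t * ‖h‖ ^ 2)) := by
    intro h
    have h8 : VectorFourier.fourierSMulRight (innerSL ℝ) f h e =
        ((-(2 * Real.pi) * inner ℝ h e * Real.exp (-t * ‖h‖ ^ 2) : ℝ) : ℂ) * Complex.I := by
      rw [VectorFourier.fourierSMulRight_apply]
      have h9 : (innerSL ℝ h) e = inner ℝ h e := rfl
      simp only [hf, h9, Complex.real_smul, smul_eq_mul]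
      push_cast; ring
    rw [h8, ← smul_mul_assoc, Complex.mul_I_re, im_fourierChar_smul]
    ring
  simp only [h7] at h5
  rw [integral_const_mul] at h5
  rw [ContinuousLinearMap.comp_apply, Complex.ofRealCLM_apply, Complex.ofReal_re] at h5
  have h9 : (innerSL ℝ ξ) e = inner ℝ ξ e := rfl
  simp only [smul_apply, neg_apply, Pi.neg_apply, smul_eq_mul, h9, nsmul_eq_mul] at h5
  have hpi := Real.pi_pos
  have h10 : -(Real.pi ^ 2 * ‖ξ‖ ^ 2) * t⁻¹ = -(Real.pi ^ 2 * ‖ξ‖ ^ 2) / t := by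
    rw [div_eq_mul_inv]
  rw [h10] at h5
  have h11 : (2 * Real.pi) * ∫ h : Eucl n,
      Real.sin (2 * Real.pi * inner ℝ h ξ) * inner ℝ h e * Real.exp (-t * ‖h‖ ^ 2) =
      (2 * Real.pi) * (Real.pi / t * inner ℝ ξ e *
        ((Real.pi / t) ^ ((n : ℝ) / 2) * Real.exp (-(Real.pi ^ 2 * ‖ξ‖ ^ 2) / t))) := by
    refine neg_injective (Eq.trans ?_ (h5.symm.trans ?_))
    · rw [neg_mul_eq_neg_mul]
    · push_cast
      rw [div_eq_mul_inv Real.pi t]; ring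
  exact mul_left_cancel₀ (by positivity) h11

end Gaussian

/-! ### Gamma integrals in the subordination parameter. -/

section GammaIntegrals

theorem integral_rpow_mul_exp_neg {p r : ℝ} (hp : 0 < p) (hr : 0 < r) :
    ∫ t in Set.Ioi (0 : ℝ), t ^ (p - 1) * Real.exp (-t * r) = Real.Gamma p * r ^ (-p) := by
  have h := Real.integral_rpow_mul_exp_neg_mul_Ioi hp hr
  rw [one_div, Real.inv_rpow hr.le, ← Real.rpow_neg hr.le, mul_comm] at h
  rw [← h]
  refine setIntegral_congr_fun measurableSet_Ioi fun t _ => ?_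
  rw [neg_mul, mul_comm t r]

/-- The Bochner integral of a non-integrable function is `0` by convention, so a positive value of
the integral forces integrability. -/
theorem integrableOn_rpow_mul_exp_neg {p r : ℝ} (hp : 0 < p) (hr : 0 < r) :
    IntegrableOn (fun t : ℝ => t ^ (p - 1) * Real.exp (-t * r)) (Set.Ioi 0) := by
  by_contra hcon
  have h := integral_rpow_mul_exp_neg hp hr
  rw [integral_undef hcon] at h
  have : 0 < Real.Gamma p * r ^ (-p) := mul_pos (Real.Gamma_pos_of_pos hp) (Real.rpow_pos_of_pos hr _)
  linarith

theorem lintegral_rpow_mul_exp_neg {p r : ℝ} (hp : 0 < p) (hr : 0 < r) :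
    ∫⁻ t in Set.Ioi (0 : ℝ), ENNReal.ofReal (t ^ (p - 1) * Real.exp (-t * r)) =
      ENNReal.ofReal (Real.Gamma p * r ^ (-p)) := by
  rw [← integral_rpow_mul_exp_neg hp hr, ofReal_integral_eq_lintegral_ofReal
    (integrableOn_rpow_mul_exp_neg hp hr)]
  filter_upwards [ae_restrict_mem measurableSet_Ioi] with t ht
  exact mul_nonneg (Real.rpow_nonneg (le_of_lt ht) _) (Real.exp_pos _).le

/-- The substitution `t ↦ 1/t` in the Gamma integral. -/
theorem integral_rpow_mul_exp_neg_div {q u : ℝ} (hq : 0 < q) (hu : 0 < u) :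
    ∫ t in Set.Ioi (0 : ℝ), t ^ (-q - 1) * Real.exp (-u / t) = Real.Gamma q * u ^ (-q) := by
  rw [← integral_rpow_mul_exp_neg hq hu, ← integral_comp_rpow_Ioi _ (p := -1) (by norm_num)]
  refine setIntegral_congr_fun measurableSet_Ioi fun t ht => ?_
  have ht : 0 < t := ht
  simp only [smul_eq_mul]
  rw [← Real.rpow_mul ht.le, abs_neg, abs_one, one_mul, ← mul_assoc, ← Real.rpow_add ht,
    Real.rpow_neg_one]
  congr 2
  · ring
  · rw [div_eq_mul_inv, inv_inv]; ring

theorem integrableOn_rpow_mul_exp_neg_div {q u : ℝ} (hq : 0 < q) (hu : 0 < u) :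
    IntegrableOn (fun t : ℝ => t ^ (-q - 1) * Real.exp (-u / t)) (Set.Ioi 0) := by
  by_contra hcon
  have h := integral_rpow_mul_exp_neg_div hq hu
  rw [integral_undef hcon] at h
  have : 0 < Real.Gamma q * u ^ (-q) := mul_pos (Real.Gamma_pos_of_pos hq) (Real.rpow_pos_of_pos hu _)
  linarith

theorem lintegral_rpow_mul_exp_neg_div {q u : ℝ} (hq : 0 < q) (hu : 0 < u) :
    ∫⁻ t in Set.Ioi (0 : ℝ), ENNReal.ofReal (t ^ (-q - 1) * Real.exp (-u / t)) =
      ENNReal.ofReal (Real.Gamma q * u ^ (-q)) := by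
  rw [← integral_rpow_mul_exp_neg_div hq hu, ofReal_integral_eq_lintegral_ofReal
    (integrableOn_rpow_mul_exp_neg_div hq hu)]
  filter_upwards [ae_restrict_mem measurableSet_Ioi] with t ht
  exact mul_nonneg (Real.rpow_nonneg (le_of_lt ht) _) (Real.exp_pos _).le

/-- Write `t^(s-1) (1 - exp(-a/t)) = ∫₀ᵃ t^(s-2) exp(-u/t) du` and exchange the integrals: the `t`
integral is `Γ(1-s) u^(s-1)`, which is integrable at `0` because `s > 0`. -/
theorem lintegral_rpow_mul_one_sub_exp {s a : ℝ} (hs0 : 0 < s) (hs1 : s < 1) (ha : 0 ≤ a) :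
    ∫⁻ t in Set.Ioi (0 : ℝ), ENNReal.ofReal (t ^ (s - 1) * (1 - Real.exp (-a / t))) =
      ENNReal.ofReal (Real.Gamma (1 - s) / s * a ^ s) := by
  have h1 : ∀ t ∈ Set.Ioi (0 : ℝ), ENNReal.ofReal (t ^ (s - 1) * (1 - Real.exp (-a / t))) =
      ∫⁻ u in Set.Ioc 0 a, ENNReal.ofReal (t ^ (-(1 - s) - 1) * Real.exp (-u / t)) := by
    intro t ht
    have ht : 0 < t := ht
    have hcont : Continuous fun u : ℝ => t ^ (-(1 - s) - 1) * Real.exp (-u / t) := by fun_prop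
    rw [← ofReal_integral_eq_lintegral_ofReal hcont.integrableOn_Ioc
      (Eventually.of_forall fun u => mul_nonneg (Real.rpow_nonneg ht.le _) (Real.exp_pos _).le),
      ← intervalIntegral.integral_of_le ha]
    congr 1
    have hderiv : ∀ u ∈ Set.uIcc 0 a, HasDerivAt (fun u => -(t ^ (s - 1) * Real.exp (-u / t)))
        (t ^ (-(1 - s) - 1) * Real.exp (-u / t)) u := by
      intro u _
      have h2 := (((hasDerivAt_id u).neg.div_const t).exp.const_mul (t ^ (s - 1))).neg
      refine h2.congr_deriv ?_
      have h3 : t ^ (-(1 - s) - 1) = t ^ (s - 1) * t⁻¹ := by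
        rw [← Real.rpow_neg_one t, ← Real.rpow_add ht]; congr 1; ring
      rw [h3]
      simp only [id, Pi.neg_apply]
      ring
    rw [intervalIntegral.integral_eq_sub_of_hasDerivAt hderiv (hcont.intervalIntegrable _ _)]
    simp
    ring
  rw [setLIntegral_congr_fun measurableSet_Ioi h1, lintegral_lintegral_swap]
  · have h2 : ∀ u ∈ Set.Ioc 0 a, ∫⁻ t in Set.Ioi (0 : ℝ),
        ENNReal.ofReal (t ^ (-(1 - s) - 1) * Real.exp (-u / t)) =
        ENNReal.ofReal (Real.Gamma (1 - s) * u ^ (s - 1)) := fun u hu => by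
      rw [lintegral_rpow_mul_exp_neg_div (by linarith) hu.1]
      congr 3; ring
    have hint : IntervalIntegrable (fun u : ℝ => Real.Gamma (1 - s) * u ^ (s - 1)) volume 0 a :=
      (intervalIntegral.intervalIntegrable_rpow' (by linarith)).const_mul _
    rw [setLIntegral_congr_fun measurableSet_Ioc h2, ← ofReal_integral_eq_lintegral_ofReal,
      ← intervalIntegral.integral_of_le ha, intervalIntegral.integral_const_mul,
      integral_rpow (Or.inl (by linarith))]
    · congr 1
      rw [sub_add_cancel, Real.zero_rpow hs0.ne']
      ring
    · exact (intervalIntegrable_iff_integrableOn_Ioc_of_le ha).1 hint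
    · filter_upwards [ae_restrict_mem measurableSet_Ioc] with u hu
      exact mul_nonneg (Real.Gamma_pos_of_pos (by linarith)).le (Real.rpow_nonneg hu.1.le _)
  · exact Measurable.aemeasurable (by unfold Function.uncurry; fun_prop)

end GammaIntegrals

/-! ### The constants and the symbol of the Gagliardo seminorm. -/

section Symbols

variable {n : ℕ}

theorem fracLapConst_pos (n : ℕ) {s : ℝ} (hs0 : 0 < s) (hs1 : s < 1) : 0 < fracLapConst n s := by
  have h1 : 0 < Real.Gamma (s + n / 2) := Real.Gamma_pos_of_pos (by positivity)
  have h2 : Real.Gamma (-s) ≠ 0 := Real.Gamma_ne_zero fun m hm => by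
    rcases Nat.eq_zero_or_pos m with rfl | hm0
    · simp at hm; linarith
    · have : (1 : ℝ) ≤ m := by exact_mod_cast hm0
      linarith
  have := abs_pos.2 h2
  unfold fracLapConst
  positivity

/-- The functional equation gives `Γ(1-s) = -s Γ(-s)` with `Γ(1-s) > 0`, so `Γ(-s)` is negative. -/
theorem abs_Gamma_neg {s : ℝ} (hs0 : 0 < s) (hs1 : s < 1) :
    |Real.Gamma (-s)| = Real.Gamma (1 - s) / s := by
  have h1 := Real.Gamma_add_one (neg_ne_zero.2 hs0.ne')
  rw [neg_add_eq_sub] at h1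
  have h2 : 0 < Real.Gamma (1 - s) := Real.Gamma_pos_of_pos (by linarith)
  rw [h1, abs_of_neg]
  · field_simp
  · by_contra hcon
    nlinarith

theorem weightConst_pos (n : ℕ) {s : ℝ} (hs0 : 0 < s) (hs1 : s < 1) : 0 < weightConst n s := by
  have h1 : 0 < Real.Gamma ((n + s + 1) / 2) := Real.Gamma_pos_of_pos (by positivity)
  have h2 : 0 < Real.Gamma ((1 - s) / 2) := Real.Gamma_pos_of_pos (by linarith)
  unfold weightConst
  positivity

/-- Subordination: a negative power of `‖h‖` is a superposition of Gaussians. -/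
theorem norm_rpow_eq_integral {p : ℝ} (hp : 0 < p) {h : Eucl n} (hh : h ≠ 0) :
    ∫ t in Set.Ioi (0 : ℝ), t ^ (p - 1) * Real.exp (-t * ‖h‖ ^ 2) =
      Real.Gamma p * ‖h‖ ^ (-(2 * p)) := by
  rw [integral_rpow_mul_exp_neg hp (by positivity), ← Real.rpow_natCast, ← Real.rpow_mul (by positivity)]
  congr 2; push_cast; ring

/-- `∫ (1 - cos(2π⟨h, ξ⟩)) |h|^(-n-2s) dh = (2π|ξ|)^(2s) / C_{n,s}`. -/
theorem lintegral_one_sub_cos (hn : 1 ≤ n) {s : ℝ} (hs0 : 0 < s) (hs1 : s < 1) (ξ : Eucl n) :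
    ∫⁻ h : Eucl n, ENNReal.ofReal ((1 - Real.cos (2 * Real.pi * inner ℝ h ξ)) *
      ‖h‖ ^ (-((n : ℝ) + 2 * s))) =
      ENNReal.ofReal ((2 * Real.pi * ‖ξ‖) ^ (2 * s) / fracLapConst n s) := by
  have hpi := Real.pi_pos
  set p : ℝ := s + n / 2 with hp
  have hp0 : 0 < p := by positivity
  have hG : 0 < Real.Gamma p := Real.Gamma_pos_of_pos hp0
  have hcos : ∀ θ : ℝ, 0 ≤ 1 - Real.cos θ := fun θ => by linarith [Real.cos_le_one θ]
  have : Nonempty (Fin n) := ⟨⟨0, hn⟩⟩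
  -- Subordination with `2p = n + 2s`. All integrands are nonnegative, so Tonelli applies without
  -- any integrability check.
  have h1 : ∀ᵐ h : Eucl n, ENNReal.ofReal ((1 - Real.cos (2 * Real.pi * inner ℝ h ξ)) *
      ‖h‖ ^ (-((n : ℝ) + 2 * s))) = ∫⁻ t in Set.Ioi (0 : ℝ), ENNReal.ofReal ((Real.Gamma p)⁻¹ *
        (t ^ (p - 1) * ((1 - Real.cos (2 * Real.pi * inner ℝ h ξ)) * Real.exp (-t * ‖h‖ ^ 2)))) := by
    filter_upwards [Measure.ae_ne volume (0 : Eucl n)] with h hh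
    have hh' : 0 < ‖h‖ ^ 2 := by positivity
    set c := 1 - Real.cos (2 * Real.pi * inner ℝ h ξ) with hc
    have h2 : ∀ t : ℝ, ENNReal.ofReal ((Real.Gamma p)⁻¹ *
        (t ^ (p - 1) * (c * Real.exp (-t * ‖h‖ ^ 2)))) =
        ENNReal.ofReal ((Real.Gamma p)⁻¹ * c) *
          ENNReal.ofReal (t ^ (p - 1) * Real.exp (-t * ‖h‖ ^ 2)) := fun t => by
      rw [← ENNReal.ofReal_mul (mul_nonneg (by positivity) (hcos _))]
      congr 1; ring
    simp only [h2]
    rw [lintegral_const_mul _ (by fun_prop), lintegral_rpow_mul_exp_neg hp0 hh',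
      ← ENNReal.ofReal_mul (mul_nonneg (by positivity) (hcos _))]
    congr 1
    rw [← Real.rpow_natCast ‖h‖ 2, ← Real.rpow_mul (by positivity)]
    have h3 : ((2 : ℕ) : ℝ) * -p = -((n : ℝ) + 2 * s) := by rw [hp]; push_cast; ring
    rw [h3]
    field_simp
    exact hc
  rw [lintegral_congr_ae h1, lintegral_lintegral_swap]
  · have h2 : ∀ t ∈ Set.Ioi (0 : ℝ), ∫⁻ h : Eucl n, ENNReal.ofReal ((Real.Gamma p)⁻¹ *
        (t ^ (p - 1) * ((1 - Real.cos (2 * Real.pi * inner ℝ h ξ)) * Real.exp (-t * ‖h‖ ^ 2)))) =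
        ENNReal.ofReal ((Real.Gamma p)⁻¹ * Real.pi ^ ((n : ℝ) / 2)) *
        ENNReal.ofReal (t ^ (s - 1) * (1 - Real.exp (-(Real.pi ^ 2 * ‖ξ‖ ^ 2) / t))) := by
      intro t ht
      have ht : 0 < t := ht
      have hgi := integrable_gaussian (n := n) ht
      have hci : Integrable fun h : Eucl n =>
          Real.cos (2 * Real.pi * inner ℝ h ξ) * Real.exp (-t * ‖h‖ ^ 2) :=
        hgi.bdd_mul (c := 1) (by fun_prop)
          (Eventually.of_forall fun h => Real.abs_cos_le_one _)
      have hdi : Integrable fun h : Eucl n =>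
          (1 - Real.cos (2 * Real.pi * inner ℝ h ξ)) * Real.exp (-t * ‖h‖ ^ 2) := by
        refine (hgi.sub hci).congr (Eventually.of_forall fun h => ?_)
        simp only [Pi.sub_apply]; ring
      rw [← ofReal_integral_eq_lintegral_ofReal ((hdi.const_mul _).const_mul _)
        (Eventually.of_forall fun h => mul_nonneg (by positivity) (mul_nonneg (by positivity)
          (mul_nonneg (hcos _) (Real.exp_pos _).le))),
        ← ENNReal.ofReal_mul (by positivity)]
      congr 1
      rw [integral_const_mul, integral_const_mul]
      have h3 : ∫ h : Eucl n, (1 - Real.cos (2 * Real.pi * inner ℝ h ξ)) * Real.exp (-t * ‖h‖ ^ 2) =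
          (Real.pi / t) ^ ((n : ℝ) / 2) * (1 - Real.exp (-(Real.pi ^ 2 * ‖ξ‖ ^ 2) / t)) := by
        simp only [sub_mul, one_mul]
        rw [integral_sub hgi hci, integral_cos_mul_gaussian ht,
          GaussianFourier.integral_rexp_neg_mul_sq_norm ht]
        simp [mul_sub]
      rw [h3, Real.div_rpow hpi.le ht.le]
      -- The factor `t^(n/2)` cancels the normalisation `(π/t)^(n/2)` of the Gaussian transform,
      -- leaving a one-dimensional integral with exponent `s - 1`.
      have h4 : t ^ (p - 1) = t ^ (s - 1) * t ^ ((n : ℝ) / 2) := by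
        rw [← Real.rpow_add ht]; congr 1; rw [hp]; ring
      rw [h4]
      have : 0 < t ^ ((n : ℝ) / 2) := by positivity
      field_simp
    rw [setLIntegral_congr_fun measurableSet_Ioi h2, lintegral_const_mul _ (by fun_prop),
      lintegral_rpow_mul_one_sub_exp hs0 hs1 (by positivity), ← ENNReal.ofReal_mul (by positivity)]
    congr 1
    rw [fracLapConst, abs_Gamma_neg hs0 hs1, ← mul_pow, ← Real.rpow_natCast, ← Real.rpow_mul (by positivity)]
    have h5 : (2 * Real.pi * ‖ξ‖) ^ (2 * s) = 4 ^ s * (Real.pi * ‖ξ‖) ^ (2 * s) := by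
      rw [mul_assoc, Real.mul_rpow (by norm_num) (by positivity), Real.rpow_mul (by norm_num)]
      norm_num
    rw [h5]
    have h6 : (0 : ℝ) < 4 ^ s := by positivity
    have h7 : 0 < Real.Gamma (1 - s) := Real.Gamma_pos_of_pos (by linarith)
    push_cast
    rw [← hp]
    field_simp
  · exact Measurable.aemeasurable (by unfold Function.uncurry; fun_prop)

end Symbols

/-! ### The gradient kernel, its truncations and their symbols. -/

section Kernel

variable {n : ℕ}

/-- In polar coordinates the radial density is `r^(-s)` near `0` and `r^(-1-s)` at infinity; these
are integrable because `s < 1` and `s > 0` respectively. -/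
theorem integrable_min_mul_rpow (hn : 1 ≤ n) {s : ℝ} (hs0 : 0 < s) (hs1 : s < 1) :
    Integrable fun h : Eucl n => min 1 ‖h‖ * ‖h‖ ^ (-((n : ℝ) + s)) := by
  have : Nonempty (Fin n) := ⟨⟨0, hn⟩⟩
  have h0 := integrable_fun_norm_addHaar (E := Eucl n) (volume : Measure (Eucl n))
    (f := fun r : ℝ => min 1 r * r ^ (-((n : ℝ) + s)))
  refine h0.2 ?_
  have hpow : ∀ r : ℝ, 0 < r → r ^ (Module.finrank ℝ (Eucl n) - 1) * r ^ (-((n : ℝ) + s)) =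
      r ^ (-1 - s) := fun r hr => by
    rw [← Real.rpow_natCast, ← Real.rpow_add hr, finrank_euclideanSpace_fin, Nat.cast_sub hn]
    congr 1; push_cast; ring
  rw [← Set.Ioc_union_Ioi_eq_Ioi (zero_le_one' ℝ)]
  refine IntegrableOn.union ?_ ?_
  · have h1 : IntegrableOn (fun r : ℝ => r ^ (-s)) (Set.Ioc 0 1) :=
      (intervalIntegrable_iff_integrableOn_Ioc_of_le zero_le_one).1
        (intervalIntegral.intervalIntegrable_rpow' (by linarith))
    refine h1.congr_fun (fun r hr => ?_) measurableSet_Ioc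
    have hr0 : 0 < r := hr.1
    simp only [smul_eq_mul]
    rw [min_eq_right hr.2, mul_left_comm, hpow r hr0]
    nth_rewrite 2 [← Real.rpow_one r]
    rw [← Real.rpow_add hr0]; congr 1; ring
  · have h1 : IntegrableOn (fun r : ℝ => r ^ (-1 - s)) (Set.Ioi 1) :=
      integrableOn_Ioi_rpow_of_lt (by linarith) zero_lt_one
    refine h1.congr_fun (fun r hr => ?_) measurableSet_Ioi
    have hr1 : 1 < r := hr
    simp only [smul_eq_mul]
    rw [min_eq_left hr1.le, one_mul, hpow r (by linarith)]

theorem min_mul_rpow_comp_smul {s b : ℝ} (hb : 0 < b) (h : Eucl n) :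
    min 1 (b * ‖h‖) * ‖h‖ ^ (-((n : ℝ) + s)) =
      b ^ ((n : ℝ) + s) * (min 1 ‖b • h‖ * ‖b • h‖ ^ (-((n : ℝ) + s))) := by
  rw [norm_smul, Real.norm_of_nonneg hb.le, Real.mul_rpow hb.le (norm_nonneg _), Real.rpow_neg hb.le]
  have : 0 < b ^ ((n : ℝ) + s) := by positivity
  field_simp

theorem integrable_min_mul_rpow_scaled (hn : 1 ≤ n) {s : ℝ} (hs0 : 0 < s) (hs1 : s < 1) {b : ℝ}
    (hb : 0 ≤ b) : Integrable fun h : Eucl n => min 1 (b * ‖h‖) * ‖h‖ ^ (-((n : ℝ) + s)) := by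
  rcases hb.eq_or_lt with rfl | hb
  · simp
  simp only [min_mul_rpow_comp_smul hb]
  exact ((integrable_min_mul_rpow hn hs0 hs1).comp_smul hb.ne').const_mul _

/-- Rescaling `h` by `b` gives `b^(n+s)` from the kernel and `b^(-n)` from the volume. This is where
the growth `|ξ|^s` of the symbols originates. -/
theorem integral_min_mul_rpow_scaled {s : ℝ} (hs0 : 0 < s) {b : ℝ} (hb : 0 ≤ b) :
    ∫ h : Eucl n, min 1 (b * ‖h‖) * ‖h‖ ^ (-((n : ℝ) + s)) =
      (∫ h : Eucl n, min 1 ‖h‖ * ‖h‖ ^ (-((n : ℝ) + s))) * b ^ s := by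
  rcases hb.eq_or_lt with rfl | hb
  · simp [Real.zero_rpow hs0.ne']
  simp only [min_mul_rpow_comp_smul hb]
  rw [integral_const_mul, Measure.integral_comp_smul volume
    (fun h : Eucl n => min 1 ‖h‖ * ‖h‖ ^ (-((n : ℝ) + s))) b, finrank_euclideanSpace_fin,
    abs_of_pos (by positivity), smul_eq_mul, Real.rpow_add hb, Real.rpow_natCast]
  field_simp

/-- The component along `e` of the kernel `C_ω |h|^(-(n+s)) h / |h|`. -/
def fracKernel (s : ℝ) (e h : Eucl n) : ℝ :=
  weightConst n s * ‖h‖ ^ (-((n : ℝ) + s)) * (‖h‖⁻¹ * inner ℝ h e)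

/-- The kernel `fracKernel` restricted to `|h| ≥ ε`. -/
def truncKernel (s ε : ℝ) (e : Eucl n) : Eucl n → ℝ :=
  (Metric.ball (0 : Eucl n) ε)ᶜ.indicator (fracKernel s e)

theorem measurable_fracKernel (s : ℝ) (e : Eucl n) : Measurable (fracKernel s e) := by
  unfold fracKernel
  fun_prop

theorem measurable_truncKernel (s ε : ℝ) (e : Eucl n) : Measurable (truncKernel s ε e) :=
  (measurable_fracKernel s e).indicator Metric.isOpen_ball.measurableSet.compl

theorem abs_inv_norm_mul_inner_le (e h : Eucl n) : |‖h‖⁻¹ * inner ℝ h e| ≤ ‖e‖ := by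
  rcases eq_or_ne h 0 with rfl | hh
  · simp
  rw [abs_mul, abs_inv, abs_norm, inv_mul_le_iff₀ (norm_pos_iff.2 hh)]
  exact abs_real_inner_le_norm h e

theorem abs_fracKernel_le {s : ℝ} (hs0 : 0 < s) (hs1 : s < 1) (e h : Eucl n) :
    |fracKernel s e h| ≤ weightConst n s * ‖e‖ * ‖h‖ ^ (-((n : ℝ) + s)) := by
  have h1 := weightConst_pos n hs0 hs1
  have h2 : 0 ≤ ‖h‖ ^ (-((n : ℝ) + s)) := by positivity
  rw [fracKernel, abs_mul, abs_of_nonneg (mul_nonneg h1.le h2)]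
  calc _ ≤ weightConst n s * ‖h‖ ^ (-((n : ℝ) + s)) * ‖e‖ := by
        gcongr; exact abs_inv_norm_mul_inner_le e h
    _ = _ := by ring

theorem abs_truncKernel_le (s ε : ℝ) (e h : Eucl n) :
    |truncKernel s ε e h| ≤ |fracKernel s e h| := by
  rw [truncKernel, ← Real.norm_eq_abs, ← Real.norm_eq_abs]
  exact norm_indicator_le_norm_self _ _

/-- On `‖h‖ ≥ ε` one has `min 1 (ε⁻¹ ‖h‖) = 1`, so the integrable majorant already dominates the
truncated kernel. -/
theorem integrable_truncKernel (hn : 1 ≤ n) {s : ℝ} (hs0 : 0 < s) (hs1 : s < 1) {ε : ℝ}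
    (hε : 0 < ε) (e : Eucl n) : Integrable (truncKernel s ε e) := by
  have hw := weightConst_pos n hs0 hs1
  refine ((integrable_min_mul_rpow_scaled hn hs0 hs1 (inv_pos.2 hε).le).const_mul
    (weightConst n s * ‖e‖)).mono' (measurable_truncKernel s ε e).aestronglyMeasurable
    (Eventually.of_forall fun h => ?_)
  rw [truncKernel]
  by_cases hh : h ∈ (Metric.ball (0 : Eucl n) ε)ᶜ
  · rw [Set.indicator_of_mem hh]
    refine (abs_fracKernel_le hs0 hs1 e h).trans ?_
    have h1 : ε ≤ ‖h‖ := by simpa using hh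
    rw [min_eq_left ((le_inv_mul_iff₀ hε).2 (by simpa using h1)), one_mul]
  · rw [Set.indicator_of_notMem hh, norm_zero]
    positivity

/-- The bound `|sin x| ≤ min 1 |x|` supplies the power of `‖h‖` that the kernel lacks at the origin.
The majorant also serves all truncations, hence gives symbol bounds uniform in `ε`. -/
theorem abs_fracKernel_mul_sin_le {s : ℝ} (hs0 : 0 < s) (hs1 : s < 1) (e ξ h : Eucl n) :
    |fracKernel s e h * Real.sin (2 * Real.pi * inner ℝ h ξ)| ≤
      weightConst n s * ‖e‖ * (min 1 (2 * Real.pi * ‖ξ‖ * ‖h‖) * ‖h‖ ^ (-((n : ℝ) + s))) := by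
  have hw := weightConst_pos n hs0 hs1
  have hpi := Real.pi_pos
  have h1 : |Real.sin (2 * Real.pi * inner ℝ h ξ)| ≤ min 1 (2 * Real.pi * ‖ξ‖ * ‖h‖) := by
    refine le_min (Real.abs_sin_le_one _) (Real.abs_sin_le_abs.trans ?_)
    rw [abs_mul, abs_of_pos (by positivity : 0 < 2 * Real.pi), mul_assoc (2 * Real.pi),
      mul_comm ‖ξ‖]
    exact mul_le_mul_of_nonneg_left (abs_real_inner_le_norm h ξ) (by positivity)
  rw [abs_mul]
  calc _ ≤ (weightConst n s * ‖e‖ * ‖h‖ ^ (-((n : ℝ) + s))) * min 1 (2 * Real.pi * ‖ξ‖ * ‖h‖) := by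
        gcongr; exact abs_fracKernel_le hs0 hs1 e h
    _ = _ := by ring

theorem integrable_fracKernel_mul_sin (hn : 1 ≤ n) {s : ℝ} (hs0 : 0 < s) (hs1 : s < 1)
    (e ξ : Eucl n) :
    Integrable fun h => fracKernel s e h * Real.sin (2 * Real.pi * inner ℝ h ξ) := by
  refine ((integrable_min_mul_rpow_scaled hn hs0 hs1 (b := 2 * Real.pi * ‖ξ‖)
    (by positivity)).const_mul (weightConst n s * ‖e‖)).mono'
    ((measurable_fracKernel s e).mul (by fun_prop)).aestronglyMeasurable
    (Eventually.of_forall fun h => abs_fracKernel_mul_sin_le hs0 hs1 e ξ h)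

/-- The Fourier symbol (divided by `i`) of the truncated gradient in direction `e`. -/
def truncSymbol (s ε : ℝ) (e ξ : Eucl n) : ℝ :=
  ∫ h, truncKernel s ε e h * Real.sin (2 * Real.pi * inner ℝ h ξ)

theorem abs_truncSymbol_le (hn : 1 ≤ n) {s : ℝ} (hs0 : 0 < s) (hs1 : s < 1) (ε : ℝ)
    (e ξ : Eucl n) : |truncSymbol s ε e ξ| ≤ weightConst n s * ‖e‖ *
      ((∫ h : Eucl n, min 1 ‖h‖ * ‖h‖ ^ (-((n : ℝ) + s))) * (2 * Real.pi * ‖ξ‖) ^ s) := by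
  rw [← integral_min_mul_rpow_scaled hs0 (by positivity), ← integral_const_mul, truncSymbol,
    ← Real.norm_eq_abs]
  refine norm_integral_le_of_norm_le ((integrable_min_mul_rpow_scaled hn hs0 hs1
    (by positivity)).const_mul _) (Eventually.of_forall fun h => ?_)
  refine le_trans ?_ (abs_fracKernel_mul_sin_le hs0 hs1 e ξ h)
  rw [Real.norm_eq_abs, abs_mul, abs_mul]
  exact mul_le_mul_of_nonneg_right (abs_truncKernel_le s ε e h) (abs_nonneg _)

theorem tendsto_truncSymbol (hn : 1 ≤ n) {s : ℝ} (hs0 : 0 < s) (hs1 : s < 1) (e ξ : Eucl n) :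
    Tendsto (fun ε => truncSymbol s ε e ξ) (𝓝[>] 0)
      (𝓝 (∫ h, fracKernel s e h * Real.sin (2 * Real.pi * inner ℝ h ξ))) := by
  have : Nonempty (Fin n) := ⟨⟨0, hn⟩⟩
  refine tendsto_integral_filter_of_dominated_convergence
    (fun h => |fracKernel s e h * Real.sin (2 * Real.pi * inner ℝ h ξ)|)
    (Eventually.of_forall fun ε => ((measurable_truncKernel s ε e).mul
      (by fun_prop)).aestronglyMeasurable)
    (Eventually.of_forall fun ε => Eventually.of_forall fun h => ?_)
    (integrable_fracKernel_mul_sin hn hs0 hs1 e ξ).abs ?_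
  · rw [Real.norm_eq_abs, abs_mul, abs_mul]
    exact mul_le_mul_of_nonneg_right (abs_truncKernel_le s ε e h) (abs_nonneg _)
  · filter_upwards [Measure.ae_ne volume (0 : Eucl n)] with h hh
    refine tendsto_const_nhds.congr' ?_
    have h1 : ∀ᶠ ε in 𝓝[>] (0 : ℝ), ε < ‖h‖ :=
      (eventually_lt_nhds (norm_pos_iff.2 hh)).filter_mono nhdsWithin_le_nhds
    filter_upwards [h1] with ε hε
    rw [truncKernel, Set.indicator_of_mem]
    simpa using hε.le

/-- The symbol of the gradient: `(2π⟨ξ, e⟩) (2π|ξ|)^(s-1)`. -/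
theorem integral_fracKernel_mul_sin (hn : 1 ≤ n) {s : ℝ} (hs0 : 0 < s) (hs1 : s < 1)
    (e ξ : Eucl n) :
    ∫ h, fracKernel s e h * Real.sin (2 * Real.pi * inner ℝ h ξ) =
      2 * Real.pi * inner ℝ ξ e * (2 * Real.pi * ‖ξ‖) ^ (s - 1) := by
  rcases eq_or_ne ξ 0 with rfl | hξ
  · simp
  have : Nonempty (Fin n) := ⟨⟨0, hn⟩⟩
  have hpi := Real.pi_pos
  have hξ0 : 0 < ‖ξ‖ := norm_pos_iff.2 hξ
  set p : ℝ := (n + s + 1) / 2 with hp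
  have hp0 : 0 < p := by positivity
  have hG : 0 < Real.Gamma p := Real.Gamma_pos_of_pos hp0
  have hG2 : 0 < Real.Gamma ((1 - s) / 2) := Real.Gamma_pos_of_pos (by linarith)
  -- Subordination again, now with `2p = n + s + 1`: the direction factor adds one to the order of
  -- the singularity.
  set F : Eucl n → ℝ → ℝ := fun h t => t ^ (p - 1) *
    (Real.sin (2 * Real.pi * inner ℝ h ξ) * inner ℝ h e * Real.exp (-t * ‖h‖ ^ 2)) with hF
  have hFt : ∀ h : Eucl n, h ≠ 0 → ∫ t in Set.Ioi (0 : ℝ), F h t =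
      Real.Gamma p * (weightConst n s)⁻¹ *
        (fracKernel s e h * Real.sin (2 * Real.pi * inner ℝ h ξ)) := by
    intro h hh
    have hh0 : 0 < ‖h‖ := norm_pos_iff.2 hh
    have h1 : ∀ t, F h t = (Real.sin (2 * Real.pi * inner ℝ h ξ) * inner ℝ h e) *
        (t ^ (p - 1) * Real.exp (-t * ‖h‖ ^ 2)) := fun t => by rw [hF]; ring
    simp only [h1]
    rw [integral_const_mul, norm_rpow_eq_integral hp0 hh, fracKernel]
    have h2 : ‖h‖ ^ (-(2 * p)) = ‖h‖ ^ (-((n : ℝ) + s)) * ‖h‖⁻¹ := by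
      rw [← Real.rpow_neg_one ‖h‖, ← Real.rpow_add hh0]; congr 1; rw [hp]; ring
    have := weightConst_pos n hs0 hs1
    rw [h2]
    field_simp
  -- For fixed `h` the sign of `F h t` does not depend on `t`, so `∫ |F|` equals `|∫ F|`. The
  -- integrability of kernel times sine therefore justifies Fubini.
  have hFn : ∀ h : Eucl n, h ≠ 0 → ∫ t in Set.Ioi (0 : ℝ), ‖F h t‖ =
      |Real.Gamma p * (weightConst n s)⁻¹ *
        (fracKernel s e h * Real.sin (2 * Real.pi * inner ℝ h ξ))| := by
    intro h hh
    have h1 : ∀ t ∈ Set.Ioi (0 : ℝ), ‖F h t‖ =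
        |Real.sin (2 * Real.pi * inner ℝ h ξ) * inner ℝ h e| *
        (t ^ (p - 1) * Real.exp (-t * ‖h‖ ^ 2)) := fun t ht => by
      have ht : 0 < t := ht
      rw [hF, Real.norm_eq_abs, abs_mul, abs_mul _ (Real.exp _), Real.abs_exp,
        abs_of_nonneg (Real.rpow_nonneg ht.le _)]
      ring
    rw [setIntegral_congr_fun measurableSet_Ioi h1, integral_const_mul, ← hFt h hh,
      norm_rpow_eq_integral hp0 hh]
    have h2 : ∀ t, F h t = (Real.sin (2 * Real.pi * inner ℝ h ξ) * inner ℝ h e) *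
        (t ^ (p - 1) * Real.exp (-t * ‖h‖ ^ 2)) := fun t => by rw [hF]; ring
    simp only [h2]
    rw [integral_const_mul, norm_rpow_eq_integral hp0 hh, abs_mul _ (Real.Gamma p * _),
      abs_of_nonneg (by positivity : 0 ≤ Real.Gamma p * ‖h‖ ^ (-(2 * p)))]
  have hmeas : Measurable (Function.uncurry F) := by
    rw [hF]; unfold Function.uncurry; fun_prop
  have hint : Integrable (Function.uncurry F) (volume.prod (volume.restrict (Set.Ioi 0))) := by
    rw [integrable_prod_iff hmeas.aestronglyMeasurable]
    constructor
    · filter_upwards [Measure.ae_ne volume (0 : Eucl n)] with h hh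
      have h1 : ∀ t, Function.uncurry F (h, t) = (Real.sin (2 * Real.pi * inner ℝ h ξ) *
        inner ℝ h e) * (t ^ (p - 1) * Real.exp (-t * ‖h‖ ^ 2)) := fun t => by
          simp only [Function.uncurry, hF]; ring
      simp only [h1]
      have : 0 < ‖h‖ := norm_pos_iff.2 hh
      exact (integrableOn_rpow_mul_exp_neg hp0 (by positivity)).const_mul _
    · refine (((integrable_fracKernel_mul_sin hn hs0 hs1 e ξ).const_mul
        (Real.Gamma p * (weightConst n s)⁻¹)).abs).congr ?_
      filter_upwards [Measure.ae_ne volume (0 : Eucl n)] with h hh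
      exact (hFn h hh).symm
  have hswap := integral_integral_swap hint
  have hL : ∫ h : Eucl n, ∫ t in Set.Ioi (0 : ℝ), F h t = Real.Gamma p * (weightConst n s)⁻¹ *
      ∫ h, fracKernel s e h * Real.sin (2 * Real.pi * inner ℝ h ξ) := by
    rw [← integral_const_mul]
    refine integral_congr_ae ?_
    filter_upwards [Measure.ae_ne volume (0 : Eucl n)] with h hh using hFt h hh
  have hR : ∫ t in Set.Ioi (0 : ℝ), ∫ h : Eucl n, F h t =
      Real.pi * inner ℝ ξ e * Real.pi ^ ((n : ℝ) / 2) *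
        (Real.Gamma ((1 - s) / 2) * (Real.pi ^ 2 * ‖ξ‖ ^ 2) ^ (-((1 - s) / 2))) := by
    rw [← integral_rpow_mul_exp_neg_div (by linarith) (by positivity), ← integral_const_mul]
    refine setIntegral_congr_fun measurableSet_Ioi fun t ht => ?_
    have ht : 0 < t := ht
    simp only [hF]
    rw [integral_const_mul, integral_sin_mul_inner_mul_gaussian ht, Real.div_rpow hpi.le ht.le]
    have h4 : t ^ (p - 1) = t ^ (-((1 - s) / 2) - 1) * t ^ ((n : ℝ) / 2) * t := by
      nth_rewrite 4 [← Real.rpow_one t]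
      rw [← Real.rpow_add ht, ← Real.rpow_add ht]; congr 1; rw [hp]; ring
    rw [h4]
    have : 0 < t ^ ((n : ℝ) / 2) := by positivity
    field_simp
  rw [hL, hR] at hswap
  have hw : weightConst n s = 2 ^ s * Real.Gamma p /
      (Real.pi ^ ((n : ℝ) / 2) * Real.Gamma ((1 - s) / 2)) := rfl
  have hw0 := weightConst_pos n hs0 hs1
  have h5 : (Real.pi ^ 2 * ‖ξ‖ ^ 2) ^ (-((1 - s) / 2)) = (Real.pi * ‖ξ‖) ^ (s - 1) := by
    rw [← mul_pow, ← Real.rpow_natCast, ← Real.rpow_mul (by positivity)]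
    congr 1; push_cast; ring
  have h6 : (2 * Real.pi * ‖ξ‖) ^ (s - 1) = 2 ^ s / 2 * (Real.pi * ‖ξ‖) ^ (s - 1) := by
    rw [mul_assoc, Real.mul_rpow (by norm_num) (by positivity), Real.rpow_sub_one (by norm_num)]
  rw [h5] at hswap
  rw [h6]
  have h7 : 0 < Real.pi ^ ((n : ℝ) / 2) := by positivity
  have h8 : (0 : ℝ) < 2 ^ s := by positivity
  set I := ∫ h, fracKernel s e h * Real.sin (2 * Real.pi * inner ℝ h ξ) with hI
  have h9 : I = (weightConst n s / Real.Gamma p) * (Real.Gamma p * (weightConst n s)⁻¹ * I) := by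
    field_simp
  rw [h9, hswap, hw]
  field_simp

end Kernel

/-! ### Difference operators as Fourier multipliers. -/

section DifferenceOperators

open scoped FourierTransform

variable {n : ℕ}

/-- The Fourier transform of a real function. -/
def fourierReal (v : Eucl n → ℝ) : Eucl n → ℂ := 𝓕 fun x => (v x : ℂ)

theorem continuous_fourierReal {v : Eucl n → ℝ} (hv : Integrable v) : Continuous (fourierReal v) :=
  continuous_fourier_of_integrable hv.ofReal

theorem lintegral_fourierReal_sq {v : Eucl n → ℝ} (hv : Integrable v) (hv2 : MemLp v 2) :
    ∫⁻ ξ, ‖fourierReal v ξ‖ₑ ^ 2 = ∫⁻ x, ‖v x‖ₑ ^ 2 := by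
  refine (lintegral_enorm_fourier_sq (f := fun x => (v x : ℂ)) hv.ofReal hv2.ofReal).trans ?_
  simp only [enorm_eq_nnnorm, Complex.nnnorm_real]

theorem fourierReal_eq_integral (v : Eucl n → ℝ) (ξ : Eucl n) :
    fourierReal v ξ = ∫ x, (Real.fourierChar (-inner ℝ x ξ) : ℂ) * v x := by
  rw [fourierReal, Real.fourier_eq]; rfl

theorem fourierReal_translate_sub {v : Eucl n → ℝ} (hv : Integrable v) (h ξ : Eucl n) :
    fourierReal (fun x => v (x + h) - v x) ξ =
      ((Real.fourierChar (inner ℝ h ξ) : ℂ) - 1) * fourierReal v ξ := by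
  have hi : ∀ w : Eucl n → ℝ, Integrable w →
      Integrable fun x => (Real.fourierChar (-inner ℝ x ξ) : ℂ) * w x := fun w hw =>
    (Real.fourierIntegral_convergent_iff ξ).2 hw.ofReal
  have hvh : Integrable fun x => v (x + h) := hv.comp_add_right h
  rw [fourierReal_eq_integral, fourierReal_eq_integral]
  simp only [Complex.ofReal_sub, mul_sub]
  rw [integral_sub (hi _ hvh) (hi _ hv), sub_mul, one_mul]
  congr 1
  rw [← integral_const_mul, ← integral_add_right_eq_self _ (-h)]
  refine integral_congr_ae (Eventually.of_forall fun x => ?_)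
  simp only [neg_add_cancel_right]
  rw [inner_add_left, inner_neg_left, neg_add, neg_neg, AddChar.map_add_eq_mul, Circle.coe_mul]
  ring

theorem norm_fourierChar_sub_one_sq (θ : ℝ) :
    ‖(Real.fourierChar θ : ℂ) - 1‖ ^ 2 = 2 * (1 - Real.cos (2 * Real.pi * θ)) := by
  rw [Real.fourierChar_apply, ← Complex.normSq_eq_norm_sq, Complex.normSq_apply, Complex.sub_re,
    Complex.sub_im, Complex.exp_ofReal_mul_I_re, Complex.exp_ofReal_mul_I_im]
  simp only [Complex.one_re, Complex.one_im]
  nlinarith [Real.sin_sq_add_cos_sq (2 * Real.pi * θ)]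

theorem enorm_sq_eq_ofReal {E : Type*} [SeminormedAddCommGroup E] (x : E) :
    ‖x‖ₑ ^ 2 = ENNReal.ofReal (‖x‖ ^ 2) := by
  rw [← ofReal_norm, ENNReal.ofReal_pow (norm_nonneg _)]

/-- Plancherel: translation by `h` multiplies the transform by a character, and `|e^{iθ} - 1|² = 2(1
- cos θ)`. -/
theorem lintegral_translate_sub_sq {v : Eucl n → ℝ} (hv : Integrable v) (hv2 : MemLp v 2)
    (h : Eucl n) :
    ∫⁻ x, ‖v (x + h) - v x‖ₑ ^ 2 =
      ∫⁻ ξ, ENNReal.ofReal (2 * (1 - Real.cos (2 * Real.pi * inner ℝ h ξ))) *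
        ‖fourierReal v ξ‖ₑ ^ 2 := by
  have hvh : Integrable fun x => v (x + h) := hv.comp_add_right h
  have hvh2 : MemLp (fun x => v (x + h)) 2 :=
    hv2.comp_measurePreserving (measurePreserving_add_right volume h)
  refine (lintegral_fourierReal_sq (v := fun x => v (x + h) - v x) (hvh.sub hv)
    (hvh2.sub hv2)).symm.trans (lintegral_congr fun ξ => ?_)
  rw [fourierReal_translate_sub hv h ξ, enorm_mul, mul_pow, enorm_sq_eq_ofReal ((Real.fourierChar (inner ℝ h ξ) : ℂ) - 1),
    norm_fourierChar_sub_one_sq]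

/-- The Gagliardo seminorm in Fourier variables. -/
theorem lintegral_diffQuot_sq (hn : 1 ≤ n) {s : ℝ} (hs0 : 0 < s) (hs1 : s < 1) {v : Eucl n → ℝ}
    (hm : Measurable v) (hv : Integrable v) (hv2 : MemLp v 2) :
    ∫⁻ p, ‖diffQuot s v p‖ₑ ^ 2 ∂((volume : Measure (Eucl n)).prod volume) =
      ENNReal.ofReal (2 / fracLapConst n s) *
        ∫⁻ ξ, ENNReal.ofReal ((2 * Real.pi * ‖ξ‖) ^ (2 * s)) * ‖fourierReal v ξ‖ₑ ^ 2 := by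
  have hC := fracLapConst_pos n hs0 hs1
  have hcos : ∀ θ : ℝ, 0 ≤ 1 - Real.cos θ := fun θ => by linarith [Real.cos_le_one θ]
  have hfm : Measurable (fourierReal v) := (continuous_fourierReal hv).measurable
  have hdm : Measurable (diffQuot s v) := by unfold diffQuot; fun_prop
  rw [lintegral_prod _ (hdm.enorm.pow_const 2).aemeasurable]
  -- Putting `y = x + h` turns the double integral into a weighted integral over `h` of squared
  -- translation differences, to which Plancherel applies for each `h`.
  have h1 : ∀ x : Eucl n, ∫⁻ y, ‖diffQuot s v (x, y)‖ₑ ^ 2 =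
      ∫⁻ h, ENNReal.ofReal (‖h‖ ^ (-((n : ℝ) + 2 * s))) * ‖v (x + h) - v x‖ₑ ^ 2 := by
    intro x
    rw [← lintegral_add_left_eq_self _ x]
    refine lintegral_congr fun h => ?_
    have h2 : diffQuot s v (x, x + h) =
        -(‖h‖ ^ (-((n : ℝ) / 2 + s)) * (v (x + h) - v x)) := by
      simp only [diffQuot]
      rw [sub_add_cancel_left, norm_neg, Real.rpow_neg (norm_nonneg _)]
      ring
    rw [h2, enorm_neg, enorm_mul, mul_pow, enorm_sq_eq_ofReal (‖h‖ ^ (-((n : ℝ) / 2 + s))),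
      Real.norm_of_nonneg (by positivity), ← Real.rpow_natCast _ 2, ← Real.rpow_mul (by positivity)]
    congr 3; push_cast; ring
  simp only [h1]
  rw [lintegral_lintegral_swap]
  · have h2 : ∀ h : Eucl n, ∫⁻ x, ENNReal.ofReal (‖h‖ ^ (-((n : ℝ) + 2 * s))) *
        ‖v (x + h) - v x‖ₑ ^ 2 = ∫⁻ ξ, ENNReal.ofReal (2 *
        ((1 - Real.cos (2 * Real.pi * inner ℝ h ξ)) * ‖h‖ ^ (-((n : ℝ) + 2 * s)))) *
        ‖fourierReal v ξ‖ₑ ^ 2 := by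
      intro h
      rw [lintegral_const_mul _ (by fun_prop), lintegral_translate_sub_sq hv hv2,
        ← lintegral_const_mul _ (by fun_prop)]
      refine lintegral_congr fun ξ => ?_
      rw [← mul_assoc, ← ENNReal.ofReal_mul (by positivity)]
      congr 2; ring
    simp only [h2]
    rw [lintegral_lintegral_swap, ← lintegral_const_mul _ (by fun_prop)]
    · refine lintegral_congr fun ξ => ?_
      rw [lintegral_mul_const _ (by fun_prop)]
      simp only [ENNReal.ofReal_mul (zero_le_two (α := ℝ))]
      rw [lintegral_const_mul _ (by fun_prop), lintegral_one_sub_cos hn hs0 hs1, ← mul_assoc,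
        ← ENNReal.ofReal_mul (by norm_num), ← ENNReal.ofReal_mul (by positivity)]
      congr 2; ring
    · exact Measurable.aemeasurable (by unfold Function.uncurry; fun_prop)
  · exact Measurable.aemeasurable (by unfold Function.uncurry; fun_prop)

/-- The operator `v ↦ ∫ k(h) (v(x + h) - v(x)) dh`. -/
def diffOp (k v : Eucl n → ℝ) (x : Eucl n) : ℝ := ∫ h, k h * (v (x + h) - v x)

theorem integrable_mul_translate_sub {k v : Eucl n → ℝ} (hk : Integrable k) (hm : Measurable v)
    (hv : Integrable v) :
    Integrable (fun p : Eucl n × Eucl n => k p.2 * (v (p.1 + p.2) - v p.1))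
      ((volume : Measure (Eucl n)).prod volume) := by
  have hmeas : AEStronglyMeasurable (fun p : Eucl n × Eucl n => k p.2 * (v (p.1 + p.2) - v p.1))
      ((volume : Measure (Eucl n)).prod volume) :=
    hk.aestronglyMeasurable.comp_snd.mul (by fun_prop)
  rw [integrable_prod_iff' hmeas]
  have hvh : ∀ h, Integrable fun x => v (x + h) - v x := fun h => (hv.comp_add_right h).sub hv
  refine ⟨Eventually.of_forall fun h => (hvh h).const_mul (k h), ?_⟩
  refine (hk.norm.mul_const (2 * ∫ x, ‖v x‖)).mono' hmeas.norm.prod_swap.integral_prod_right'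
    (Eventually.of_forall fun h => ?_)
  rw [Real.norm_of_nonneg (integral_nonneg fun x => norm_nonneg _)]
  simp only [norm_mul]
  rw [integral_const_mul]
  refine mul_le_mul_of_nonneg_left ?_ (norm_nonneg _)
  calc ∫ x, ‖v (x + h) - v x‖ ≤ ∫ x, (‖v (x + h)‖ + ‖v x‖) :=
        integral_mono (hvh h).norm ((hv.comp_add_right h).norm.add hv.norm) fun x => norm_sub_le _ _
    _ = 2 * ∫ x, ‖v x‖ := by
        rw [integral_add (hv.comp_add_right h).norm hv.norm,
          integral_add_right_eq_self (fun x => ‖v x‖) h, two_mul]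

theorem integrable_diffOp {k v : Eucl n → ℝ} (hk : Integrable k) (hm : Measurable v)
    (hv : Integrable v) : Integrable (diffOp k v) :=
  (integrable_mul_translate_sub hk hm hv).integral_prod_left

/-- Young's inequality by hand: splitting `|k| = |k|^(1/2) |k|^(1/2)`, Cauchy–Schwarz bounds
`|diffOp k v x|²` by `‖k‖₁ ∫ |k(h)| |v(x+h) - v(x)|² dh`. After Tonelli, each translation difference
has squared norm at most `4‖v‖²`. -/
theorem memLp_diffOp {k v : Eucl n → ℝ} (hk : Integrable k) (hm : Measurable v)
    (hv : Integrable v) (hv2 : MemLp v 2) : MemLp (diffOp k v) 2 := by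
  refine ⟨(integrable_diffOp hk hm hv).aestronglyMeasurable, ?_⟩
  have hkm : AEMeasurable (fun h => ‖k h‖ₑ) := hk.aestronglyMeasurable.enorm
  have hpt : ∀ x, ‖diffOp k v x‖ₑ ^ 2 ≤
      (∫⁻ h, ‖k h‖ₑ) * ∫⁻ h, ‖k h‖ₑ * ‖v (x + h) - v x‖ₑ ^ 2 := by
    intro x
    have h1 : ‖diffOp k v x‖ₑ ≤ ∫⁻ h, ‖k h‖ₑ ^ (1 / 2 : ℝ) *
        (‖k h‖ₑ ^ (1 / 2 : ℝ) * ‖v (x + h) - v x‖ₑ) := by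
      refine (enorm_integral_le_lintegral_enorm _).trans (le_of_eq (lintegral_congr fun h => ?_))
      rw [enorm_mul, ← mul_assoc, ← ENNReal.rpow_add_of_nonneg _ _ (by norm_num) (by norm_num)]
      norm_num
    have h2 := ENNReal.lintegral_mul_le_Lp_mul_Lq volume Real.HolderConjugate.two_two
      (hkm.pow_const (1 / 2 : ℝ))
      ((hkm.pow_const (1 / 2 : ℝ)).mul
        (by fun_prop : Measurable fun h => ‖v (x + h) - v x‖ₑ).aemeasurable)
    have h3 : ∀ a : ENNReal, (a ^ (1 / 2 : ℝ)) ^ (2 : ℝ) = a := fun a => by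
      rw [← ENNReal.rpow_mul]; norm_num
    have h4 := pow_le_pow_left' (h1.trans h2) 2
    refine h4.trans (le_of_eq ?_)
    rw [mul_pow, ← ENNReal.rpow_natCast, ← ENNReal.rpow_natCast]
    simp only [Nat.cast_ofNat, h3, Pi.mul_apply]
    congr 1
    refine lintegral_congr fun h => ?_
    rw [ENNReal.mul_rpow_of_nonneg _ _ (by norm_num), h3]
    norm_num
  have hk' : ∫⁻ h, ‖k h‖ₑ < ⊤ := hk.2
  have hvt : ∫⁻ x, ‖v x‖ₑ ^ 2 < ⊤ := by
    have := hv2.2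
    rw [eLpNorm_lt_top_iff_lintegral_rpow_enorm_lt_top two_ne_zero ENNReal.ofNat_ne_top] at this
    simpa using this
  have htr : ∀ h, ∫⁻ x, ‖v (x + h) - v x‖ₑ ^ 2 ≤ 4 * ∫⁻ x, ‖v x‖ₑ ^ 2 := fun h => by
    rw [lintegral_translate_sub_sq hv hv2, ← lintegral_fourierReal_sq hv hv2,
      ← lintegral_const_mul _ ((continuous_fourierReal hv).measurable.enorm.pow_const 2)]
    refine lintegral_mono fun ξ => ?_
    gcongr
    refine (ENNReal.ofReal_le_ofReal (q := 4) ?_).trans (by simp)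
    linarith [Real.neg_one_le_cos (2 * Real.pi * inner ℝ h ξ)]
  rw [eLpNorm_lt_top_iff_lintegral_rpow_enorm_lt_top two_ne_zero ENNReal.ofNat_ne_top]
  simp only [ENNReal.toReal_ofNat, ENNReal.rpow_ofNat]
  calc ∫⁻ x, ‖diffOp k v x‖ₑ ^ 2
      ≤ ∫⁻ x, (∫⁻ h, ‖k h‖ₑ) * ∫⁻ h, ‖k h‖ₑ * ‖v (x + h) - v x‖ₑ ^ 2 := lintegral_mono hpt
    _ = (∫⁻ h, ‖k h‖ₑ) * ∫⁻ x, ∫⁻ h, ‖k h‖ₑ * ‖v (x + h) - v x‖ₑ ^ 2 :=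
        lintegral_const_mul' _ _ hk'.ne
    _ = (∫⁻ h, ‖k h‖ₑ) * ∫⁻ h, ∫⁻ x, ‖k h‖ₑ * ‖v (x + h) - v x‖ₑ ^ 2 := by
        rw [lintegral_lintegral_swap]
        refine AEMeasurable.mul (hk.aestronglyMeasurable.comp_snd.enorm) ?_
        exact Measurable.aemeasurable (by fun_prop)
    _ ≤ (∫⁻ h, ‖k h‖ₑ) * ∫⁻ h, ‖k h‖ₑ * (4 * ∫⁻ x, ‖v x‖ₑ ^ 2) := by
        refine mul_le_mul_right (lintegral_mono fun h => ?_) _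
        rw [lintegral_const_mul' _ _ enorm_ne_top]
        exact mul_le_mul_right (htr h) _
    _ < ⊤ := by
        rw [lintegral_mul_const' _ _ (ENNReal.mul_ne_top (by norm_num) hvt.ne)]
        exact ENNReal.mul_lt_top hk' (ENNReal.mul_lt_top hk'
          (ENNReal.mul_lt_top (by norm_num) hvt))

theorem fourierReal_diffOp {k v : Eucl n → ℝ} (hk : Integrable k) (hm : Measurable v)
    (hv : Integrable v) (ξ : Eucl n) :
    fourierReal (diffOp k v) ξ =
      (∫ h, (k h : ℂ) * ((Real.fourierChar (inner ℝ h ξ) : ℂ) - 1)) * fourierReal v ξ := by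
  have h1 : ∀ x, (Real.fourierChar (-inner ℝ x ξ) : ℂ) * (diffOp k v x : ℂ) =
      ∫ h, (Real.fourierChar (-inner ℝ x ξ) : ℂ) * ((k h * (v (x + h) - v x) : ℝ) : ℂ) :=
    fun x => (congrArg _ (integral_ofReal (𝕜 := ℂ)).symm).trans (integral_const_mul _ _).symm
  rw [fourierReal_eq_integral]
  simp only [h1]
  rw [integral_integral_swap]
  · rw [← integral_mul_const]
    refine integral_congr_ae (Eventually.of_forall fun h => ?_)
    simp only
    rw [mul_assoc, ← fourierReal_translate_sub hv, fourierReal_eq_integral, ← integral_const_mul]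
    refine integral_congr_ae (Eventually.of_forall fun x => ?_)
    simp only [Complex.ofReal_mul]
    ring
  · refine (integrable_mul_translate_sub hk hm hv).ofReal.bdd_mul (𝕜 := ℂ) (c := 1) ?_ ?_
    · exact Continuous.aestronglyMeasurable (by fun_prop)
    · exact Eventually.of_forall fun p => (Circle.norm_coe _).le

/-- Against an odd kernel the even part `cos - 1` of the character integrates to zero, so only the
sine part remains. -/
theorem integral_odd_mul_fourierChar_sub_one {k : Eucl n → ℝ} (hk : Integrable k)
    (hodd : ∀ h, k (-h) = -k h) (ξ : Eucl n) :
    ∫ h, (k h : ℂ) * ((Real.fourierChar (inner ℝ h ξ) : ℂ) - 1) =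
      Complex.I * ((∫ h, k h * Real.sin (2 * Real.pi * inner ℝ h ξ) : ℝ) : ℂ) := by
  have hs : Integrable fun h => k h * Real.sin (2 * Real.pi * inner ℝ h ξ) :=
    hk.mul_bdd (c := 1) (by fun_prop) (Eventually.of_forall fun h => Real.abs_sin_le_one _)
  have hc : Integrable fun h => k h * (Real.cos (2 * Real.pi * inner ℝ h ξ) - 1) := by
    refine hk.mul_bdd (c := 2) (by fun_prop) (Eventually.of_forall fun h => ?_)
    rw [Real.norm_eq_abs, abs_le]
    constructor <;> linarith [Real.neg_one_le_cos (2 * Real.pi * inner ℝ h ξ),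
      Real.cos_le_one (2 * Real.pi * inner ℝ h ξ)]
  have h0 : ∫ h, k h * (Real.cos (2 * Real.pi * inner ℝ h ξ) - 1) = 0 := by
    have h1 := integral_neg_eq_self (fun h => k h * (Real.cos (2 * Real.pi * inner ℝ h ξ) - 1))
      (volume : Measure (Eucl n))
    have h2 : ∀ h : Eucl n, k (-h) * (Real.cos (2 * Real.pi * inner ℝ (-h) ξ) - 1) =
        -(k h * (Real.cos (2 * Real.pi * inner ℝ h ξ) - 1)) := fun h => by
      rw [hodd, inner_neg_left, mul_neg, Real.cos_neg, neg_mul]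
    simp only [h2, integral_neg] at h1
    linarith
  have h1 : ∀ h : Eucl n, (k h : ℂ) * ((Real.fourierChar (inner ℝ h ξ) : ℂ) - 1) =
      ((k h * (Real.cos (2 * Real.pi * inner ℝ h ξ) - 1) : ℝ) : ℂ) +
        Complex.I * ((k h * Real.sin (2 * Real.pi * inner ℝ h ξ) : ℝ) : ℂ) := fun h => by
    rw [Real.fourierChar_apply, Complex.exp_mul_I, ← Complex.ofReal_cos, ← Complex.ofReal_sin]
    push_cast; ring
  simp only [h1]
  rw [integral_add hc.ofReal (hs.ofReal.const_mul _), integral_const_mul]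
  rw [integral_complex_ofReal, integral_complex_ofReal, h0, Complex.ofReal_zero, zero_add]

theorem lintegral_diffOp_sq {k v : Eucl n → ℝ} (hk : Integrable k) (hodd : ∀ h, k (-h) = -k h)
    (hm : Measurable v) (hv : Integrable v) (hv2 : MemLp v 2) :
    ∫⁻ x, ‖diffOp k v x‖ₑ ^ 2 =
      ∫⁻ ξ, ENNReal.ofReal ((∫ h, k h * Real.sin (2 * Real.pi * inner ℝ h ξ)) ^ 2) *
        ‖fourierReal v ξ‖ₑ ^ 2 := by
  rw [← lintegral_fourierReal_sq (integrable_diffOp hk hm hv) (memLp_diffOp hk hm hv hv2)]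
  refine lintegral_congr fun ξ => ?_
  rw [fourierReal_diffOp hk hm hv, integral_odd_mul_fourierChar_sub_one hk hodd, enorm_mul, mul_pow,
    enorm_sq_eq_ofReal (Complex.I * _)]
  simp

end DifferenceOperators

/-! ### The truncated gradient in Fourier variables. -/

section WeightedGradient

variable {n : ℕ}

theorem lintegral_enorm_sq_eq {α E : Type*} [MeasurableSpace α] [NormedAddCommGroup E]
    (μ : Measure α) (g : α → E) : ∫⁻ x, ‖g x‖ₑ ^ 2 ∂μ = eLpNorm g 2 μ ^ 2 := by
  rw [eLpNorm_eq_lintegral_rpow_enorm_toReal two_ne_zero ENNReal.ofNat_ne_top,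
    ← ENNReal.rpow_natCast _ 2, ← ENNReal.rpow_mul]
  simp

theorem eLpNorm_two_eq {α E : Type*} [MeasurableSpace α] [NormedAddCommGroup E]
    (μ : Measure α) (g : α → E) : eLpNorm g 2 μ = (∫⁻ x, ‖g x‖ₑ ^ 2 ∂μ) ^ (1 / 2 : ℝ) := by
  rw [lintegral_enorm_sq_eq, ← ENNReal.rpow_natCast, ← ENNReal.rpow_mul]
  simp

theorem truncKernel_neg (s ε : ℝ) (e h : Eucl n) :
    truncKernel s ε e (-h) = -truncKernel s ε e h := by
  unfold truncKernel fracKernel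
  by_cases hh : h ∈ (Metric.ball (0 : Eucl n) ε)ᶜ
  · have hh' : -h ∈ (Metric.ball (0 : Eucl n) ε)ᶜ := by simpa using hh
    rw [Set.indicator_of_mem hh, Set.indicator_of_mem hh', norm_neg, inner_neg_left]
    ring
  · have hh' : -h ∉ (Metric.ball (0 : Eucl n) ε)ᶜ := by simpa using hh
    rw [Set.indicator_of_notMem hh, Set.indicator_of_notMem hh', neg_zero]

theorem measurable_truncSymbol (s ε : ℝ) (e : Eucl n) :
    Measurable fun ξ : Eucl n => truncSymbol s ε e ξ := by
  have hk := measurable_truncKernel s ε e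
  have : StronglyMeasurable fun p : Eucl n × Eucl n =>
      truncKernel s ε e p.2 * Real.sin (2 * Real.pi * inner ℝ p.2 p.1) :=
    Measurable.stronglyMeasurable ((hk.comp measurable_snd).mul (by fun_prop))
  exact this.integral_prod_right'.measurable

theorem integrableOn_rpow_compl_ball (hn : 1 ≤ n) {s : ℝ} (hs0 : 0 < s) (hs1 : s < 1) {ε : ℝ}
    (hε : 0 < ε) (x : Eucl n) :
    IntegrableOn (fun y => ‖x - y‖ ^ (-((n : ℝ) + s))) (Metric.ball x ε)ᶜ := by
  have h1 := ((integrable_min_mul_rpow_scaled hn hs0 hs1 (inv_pos.2 hε).le).comp_sub_left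
    x).integrableOn (s := (Metric.ball x ε)ᶜ)
  refine h1.congr_fun (fun y hy => ?_) Metric.isOpen_ball.measurableSet.compl
  have h2 : ε ≤ ‖x - y‖ := by
    rw [← dist_eq_norm, dist_comm]; simpa using hy
  dsimp only
  rw [min_eq_left ((le_inv_mul_iff₀ hε).2 (by simpa using h2)), one_mul]

theorem norm_direction_le (x y : Eucl n) : ‖direction x y‖ ≤ 1 := by
  rw [direction, norm_smul, norm_inv, norm_norm]
  exact inv_mul_le_one

theorem integrableOn_truncGrad (hn : 1 ≤ n) {s : ℝ} (hs0 : 0 < s) (hs1 : s < 1) {ε : ℝ}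
    (hε : 0 < ε) {v : Eucl n → ℝ} (hm : Measurable v) (hv : Integrable v) (x : Eucl n) :
    IntegrableOn (fun y => (weight s x y * (v y - v x)) • direction x y) (Metric.ball x ε)ᶜ := by
  have hw := weightConst_pos n hs0 hs1
  have h1 : IntegrableOn (fun y => weightConst n s * (ε ^ (-((n : ℝ) + s)) * |v y| +
      ‖x - y‖ ^ (-((n : ℝ) + s)) * |v x|)) (Metric.ball x ε)ᶜ :=
    ((hv.abs.integrableOn.const_mul _).add
      ((integrableOn_rpow_compl_ball hn hs0 hs1 hε x).mul_const _)).const_mul _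
  refine Integrable.mono' h1 ?_ ?_
  · refine Measurable.aestronglyMeasurable ?_
    unfold weight direction
    fun_prop
  · filter_upwards [ae_restrict_mem Metric.isOpen_ball.measurableSet.compl] with y hy
    have h2 : ε ≤ ‖x - y‖ := by
      rw [← dist_eq_norm, dist_comm]; simpa using hy
    have h3 : ‖x - y‖ ^ (-((n : ℝ) + s)) ≤ ε ^ (-((n : ℝ) + s)) :=
      Real.rpow_le_rpow_of_nonpos hε h2 (by linarith [(Nat.cast_nonneg n : (0 : ℝ) ≤ n)])
    have h4 : 0 ≤ ‖x - y‖ ^ (-((n : ℝ) + s)) := by positivity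
    calc ‖(weight s x y * (v y - v x)) • direction x y‖
        ≤ ‖weight s x y * (v y - v x)‖ * 1 := by
          rw [norm_smul]; gcongr; exact norm_direction_le x y
      _ = weightConst n s * (‖x - y‖ ^ (-((n : ℝ) + s)) * |v y - v x|) := by
          rw [mul_one, norm_mul, weight, Real.norm_of_nonneg (by positivity), Real.norm_eq_abs]
          ring
      _ ≤ weightConst n s * (‖x - y‖ ^ (-((n : ℝ) + s)) * |v y| +
            ‖x - y‖ ^ (-((n : ℝ) + s)) * |v x|) := by
          rw [← mul_add]; gcongr; exact abs_sub _ _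
      _ ≤ _ := by gcongr

theorem indicator_inner_truncGrad (s ε : ℝ) (v : Eucl n → ℝ) (e x h : Eucl n) :
    (Metric.ball x ε)ᶜ.indicator (fun y => innerSL ℝ e ((weight s x y * (v y - v x)) •
      direction x y)) (x + h) = truncKernel s ε e h * (v (x + h) - v x) := by
  rw [truncKernel]
  by_cases hh : h ∈ (Metric.ball (0 : Eucl n) ε)ᶜ
  · have hh' : x + h ∈ (Metric.ball x ε)ᶜ := by simpa using hh
    rw [Set.indicator_of_mem hh, Set.indicator_of_mem hh', innerSL_apply_apply, direction,
      add_sub_cancel_left, inner_smul_right, inner_smul_right, weight, fracKernel,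
      sub_add_cancel_left, norm_neg, real_inner_comm]
    ring
  · have hh' : x + h ∉ (Metric.ball x ε)ᶜ := by simpa using hh
    rw [Set.indicator_of_notMem hh, Set.indicator_of_notMem hh', zero_mul]

theorem integrable_truncKernel_mul (hn : 1 ≤ n) {s : ℝ} (hs0 : 0 < s) (hs1 : s < 1) {ε : ℝ}
    (hε : 0 < ε) {v : Eucl n → ℝ} (hm : Measurable v) (hv : Integrable v) (e x : Eucl n) :
    Integrable fun h => truncKernel s ε e h * (v (x + h) - v x) := by
  simp only [← indicator_inner_truncGrad]
  exact (((integrable_indicator_iff Metric.isOpen_ball.measurableSet.compl).2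
    ((innerSL ℝ e).integrable_comp (integrableOn_truncGrad hn hs0 hs1 hε hm hv x)))).comp_add_left x

/-- The change of variables `y = x + h` makes each component of the truncated gradient a scalar
difference operator with an integrable odd kernel. -/
theorem inner_truncGrad (hn : 1 ≤ n) {s : ℝ} (hs0 : 0 < s) (hs1 : s < 1) {ε : ℝ}
    (hε : 0 < ε) {v : Eucl n → ℝ} (hm : Measurable v) (hv : Integrable v) (e x : Eucl n) :
    inner ℝ (truncGrad s ε v x) e = diffOp (truncKernel s ε e) v x := by
  have h1 := (innerSL ℝ e).integral_comp_comm (integrableOn_truncGrad hn hs0 hs1 hε hm hv x)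
  rw [real_inner_comm, truncGrad]
  refine h1.symm.trans ?_
  rw [← integral_indicator Metric.isOpen_ball.measurableSet.compl, diffOp,
    ← integral_add_left_eq_self _ x]
  exact integral_congr_ae (Eventually.of_forall fun h => indicator_inner_truncGrad s ε v e x h)

/-- The `i`-th standard basis vector. -/
def basisVec (i : Fin n) : Eucl n := EuclideanSpace.single i 1

theorem inner_basisVec (x : Eucl n) (i : Fin n) : inner ℝ x (basisVec i) = x i := by
  simp [basisVec, EuclideanSpace.inner_single_right]

theorem norm_sq_eq_sum_inner (x : Eucl n) : ‖x‖ ^ 2 = ∑ i, inner ℝ x (basisVec i) ^ 2 := by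
  rw [EuclideanSpace.real_norm_sq_eq]
  simp only [inner_basisVec]

theorem norm_basisVec (i : Fin n) : ‖(basisVec i : Eucl n)‖ = 1 := by
  simp [basisVec]

theorem memLp_of_inner_basisVec {G : Eucl n → Eucl n}
    (hG : ∀ i, MemLp (fun x => inner ℝ (G x) (basisVec i)) 2 volume) : MemLp G 2 volume := by
  have h1 : G = fun x => ∑ i, inner ℝ (G x) (basisVec i) • (basisVec i : Eucl n) := by
    funext x
    ext j
    simp only [inner_basisVec]
    simp [basisVec, Finset.sum_apply, Pi.single_apply]
  rw [h1]
  refine memLp_finsetSum _ fun i _ => ?_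
  exact ((ContinuousLinearMap.toSpanSingleton ℝ (basisVec i : Eucl n)).comp_memLp' (hG i))

/-- Pythagoras over the components. The kernels are left general so that the statement covers both a
truncated gradient and the difference of two of them. -/
theorem lintegral_enorm_sq_of_diffOp {k : Fin n → Eucl n → ℝ} (hk : ∀ i, Integrable (k i))
    (hodd : ∀ i h, k i (-h) = -k i h) {v : Eucl n → ℝ} (hm : Measurable v) (hv : Integrable v)
    (hv2 : MemLp v 2) {G : Eucl n → Eucl n}
    (hG : ∀ i x, inner ℝ (G x) (basisVec i) = diffOp (k i) v x)
    (hmeas : ∀ i, Measurable fun ξ => ∫ h, k i h * Real.sin (2 * Real.pi * inner ℝ h ξ)) :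
    ∫⁻ x, ‖G x‖ₑ ^ 2 = ∫⁻ ξ, ENNReal.ofReal
      (∑ i, (∫ h, k i h * Real.sin (2 * Real.pi * inner ℝ h ξ)) ^ 2) * ‖fourierReal v ξ‖ₑ ^ 2 := by
  have hfm : Measurable (fourierReal v) := (continuous_fourierReal hv).measurable
  have h1 : ∀ x, ‖G x‖ₑ ^ 2 = ∑ i, ‖diffOp (k i) v x‖ₑ ^ 2 := fun x => by
    rw [enorm_sq_eq_ofReal, norm_sq_eq_sum_inner, ENNReal.ofReal_sum_of_nonneg fun i _ => sq_nonneg _]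
    refine Finset.sum_congr rfl fun i _ => ?_
    rw [enorm_sq_eq_ofReal, hG, Real.norm_eq_abs, sq_abs]
  simp only [h1]
  rw [lintegral_finsetSum' _ fun i _ =>
    ((integrable_diffOp (hk i) hm hv).aestronglyMeasurable.enorm.pow_const 2)]
  have h2 : ∀ ξ, ENNReal.ofReal (∑ i, (∫ h, k i h * Real.sin (2 * Real.pi * inner ℝ h ξ)) ^ 2) *
      ‖fourierReal v ξ‖ₑ ^ 2 = ∑ i, ENNReal.ofReal ((∫ h, k i h *
        Real.sin (2 * Real.pi * inner ℝ h ξ)) ^ 2) * ‖fourierReal v ξ‖ₑ ^ 2 := fun ξ => by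
    rw [ENNReal.ofReal_sum_of_nonneg fun i _ => sq_nonneg _, Finset.sum_mul]
  simp only [h2]
  rw [lintegral_finsetSum _ fun i _ => ?_]
  · exact Finset.sum_congr rfl fun i _ => lintegral_diffOp_sq (hk i) (hodd i) hm hv hv2
  · have := hmeas i
    fun_prop

/-- The energy `∫ (2π|ξ|)^(2s) |v̂(ξ)|² dξ`. -/
def fourierEnergy (s : ℝ) (v : Eucl n → ℝ) : ENNReal :=
  ∫⁻ ξ, ENNReal.ofReal ((2 * Real.pi * ‖ξ‖) ^ (2 * s)) * ‖fourierReal v ξ‖ₑ ^ 2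

theorem memLp_truncGrad (hn : 1 ≤ n) {s : ℝ} (hs0 : 0 < s) (hs1 : s < 1) {ε : ℝ}
    (hε : 0 < ε) {v : Eucl n → ℝ} (hm : Measurable v) (hv : Integrable v) (hv2 : MemLp v 2) :
    MemLp (truncGrad s ε v) 2 volume := by
  refine memLp_of_inner_basisVec fun i => ?_
  simp only [inner_truncGrad hn hs0 hs1 hε hm hv]
  exact memLp_diffOp (integrable_truncKernel hn hs0 hs1 hε _) hm hv hv2

theorem lintegral_truncGrad_sq (hn : 1 ≤ n) {s : ℝ} (hs0 : 0 < s) (hs1 : s < 1) {ε : ℝ}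
    (hε : 0 < ε) {v : Eucl n → ℝ} (hm : Measurable v) (hv : Integrable v) (hv2 : MemLp v 2) :
    ∫⁻ x, ‖truncGrad s ε v x‖ₑ ^ 2 = ∫⁻ ξ, ENNReal.ofReal
      (∑ i, truncSymbol s ε (basisVec i) ξ ^ 2) * ‖fourierReal v ξ‖ₑ ^ 2 :=
  lintegral_enorm_sq_of_diffOp (fun i => integrable_truncKernel hn hs0 hs1 hε (basisVec i))
    (fun _ => truncKernel_neg s ε _) hm hv hv2
    (fun _ x => inner_truncGrad hn hs0 hs1 hε hm hv _ x) (fun _ => measurable_truncSymbol s ε _)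

/-- Measures the Cauchy property in `ε`: the difference of two truncations has as symbol the
difference of the two symbols. -/
theorem lintegral_truncGrad_sub_sq (hn : 1 ≤ n) {s : ℝ} (hs0 : 0 < s) (hs1 : s < 1) {ε δ : ℝ}
    (hε : 0 < ε) (hδ : 0 < δ) {v : Eucl n → ℝ} (hm : Measurable v) (hv : Integrable v)
    (hv2 : MemLp v 2) :
    ∫⁻ x, ‖truncGrad s ε v x - truncGrad s δ v x‖ₑ ^ 2 = ∫⁻ ξ, ENNReal.ofReal
      (∑ i, (truncSymbol s ε (basisVec i) ξ - truncSymbol s δ (basisVec i) ξ) ^ 2) *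
        ‖fourierReal v ξ‖ₑ ^ 2 := by
  have hk := fun (ε : ℝ) (hε : 0 < ε) (i : Fin n) =>
    integrable_truncKernel hn hs0 hs1 hε (basisVec i)
  have hks : ∀ (ε : ℝ) (_ : 0 < ε) (i : Fin n) (ξ : Eucl n), Integrable fun h =>
      truncKernel s ε (basisVec i) h * Real.sin (2 * Real.pi * inner ℝ h ξ) := fun ε hε i ξ =>
    (hk ε hε i).mul_bdd (c := 1) (by fun_prop) (Eventually.of_forall fun h => Real.abs_sin_le_one _)
  have hsub : ∀ i ξ, ∫ h, (truncKernel s ε (basisVec i) h - truncKernel s δ (basisVec i) h) *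
      Real.sin (2 * Real.pi * inner ℝ h ξ) =
      truncSymbol s ε (basisVec i) ξ - truncSymbol s δ (basisVec i) ξ := fun i ξ => by
    simp only [sub_mul]
    exact integral_sub (hks ε hε i ξ) (hks δ hδ i ξ)
  have h1 := lintegral_enorm_sq_of_diffOp
    (k := fun i h => truncKernel s ε (basisVec i) h - truncKernel s δ (basisVec i) h)
    (G := fun x => truncGrad s ε v x - truncGrad s δ v x)
    (fun i => (hk ε hε i).sub (hk δ hδ i))
    (fun i h => by rw [truncKernel_neg, truncKernel_neg]; ring) hm hv hv2
    (fun i x => by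
      rw [inner_sub_left, inner_truncGrad hn hs0 hs1 hε hm hv, inner_truncGrad hn hs0 hs1 hδ hm hv,
        diffOp, diffOp, diffOp]
      simp only [sub_mul]
      exact (integral_sub (integrable_truncKernel_mul hn hs0 hs1 hε hm hv _ x)
        (integrable_truncKernel_mul hn hs0 hs1 hδ hm hv _ x)).symm)
    (fun i => by
      simp only [hsub]
      exact (measurable_truncSymbol s ε _).sub (measurable_truncSymbol s δ _))
  simp only [hsub] at h1
  exact h1

end WeightedGradient

/-! ### Removing the truncation. -/

section GradientLimit

variable {n : ℕ}

/-- The limit symbol is the vector `2πξ (2π|ξ|)^(s-1)`, of length `(2π|ξ|)^s`. The origin is treated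
apart because `s - 1 < 0`. -/
theorem sum_symbol_sq {s : ℝ} (hs0 : 0 < s) (ξ : Eucl n) :
    ∑ i, (2 * Real.pi * inner ℝ ξ (basisVec i) * (2 * Real.pi * ‖ξ‖) ^ (s - 1)) ^ 2 =
      (2 * Real.pi * ‖ξ‖) ^ (2 * s) := by
  rcases eq_or_ne ξ 0 with rfl | hξ
  · simp [Real.zero_rpow (by positivity : 2 * s ≠ 0)]
  have hξ0 : 0 < 2 * Real.pi * ‖ξ‖ := by have := Real.pi_pos; have := norm_pos_iff.2 hξ; positivity
  simp only [mul_pow _ ((2 * Real.pi * ‖ξ‖) ^ (s - 1)), mul_pow (2 * Real.pi)]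
  rw [← Finset.sum_mul, ← Finset.mul_sum, ← norm_sq_eq_sum_inner, ← mul_pow, ← mul_pow,
    ← Real.rpow_one_add' hξ0.le (by linarith), ← Real.rpow_natCast, ← Real.rpow_mul hξ0.le]
  congr 1; push_cast; ring

theorem exists_symbol_bound (hn : 1 ≤ n) {s : ℝ} (hs0 : 0 < s) (hs1 : s < 1) :
    ∃ M : ℝ, 0 ≤ M ∧ ∀ (ε : ℝ) (i : Fin n) (ξ : Eucl n),
      |truncSymbol s ε (basisVec i) ξ| ≤ M * (2 * Real.pi * ‖ξ‖) ^ s := by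
  have hw := weightConst_pos n hs0 hs1
  refine ⟨weightConst n s * ∫ h : Eucl n, min 1 ‖h‖ * ‖h‖ ^ (-((n : ℝ) + s)),
    mul_nonneg hw.le (integral_nonneg fun h => by positivity), fun ε i ξ => ?_⟩
  have := abs_truncSymbol_le hn hs0 hs1 ε (basisVec i) ξ
  rwa [norm_basisVec, mul_one, ← mul_assoc] at this

/-- Dominated convergence for energies whose symbols are bounded by a multiple of `|ξ|^s`. -/
theorem tendsto_lintegral_symbol {ι : Type*} {l : Filter ι} [l.IsCountablyGenerated] {s : ℝ}
    {v : Eucl n → ℝ} (hv : Integrable v) (hE : fourierEnergy s v < ⊤)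
    {m : ι → Fin n → Eucl n → ℝ} {m₀ : Fin n → Eucl n → ℝ} {M : ℝ}
    (hmeas : ∀ j i, Measurable (m j i))
    (hbound : ∀ j i ξ, |m j i ξ| ≤ M * (2 * Real.pi * ‖ξ‖) ^ s)
    (hlim : ∀ i ξ, Tendsto (fun j => m j i ξ) l (𝓝 (m₀ i ξ))) :
    Tendsto (fun j => ∫⁻ ξ, ENNReal.ofReal (∑ i, m j i ξ ^ 2) * ‖fourierReal v ξ‖ₑ ^ 2) l
      (𝓝 (∫⁻ ξ, ENNReal.ofReal (∑ i, m₀ i ξ ^ 2) * ‖fourierReal v ξ‖ₑ ^ 2)) := by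
  have hfm : Measurable (fourierReal v) := (continuous_fourierReal hv).measurable
  have hpi := Real.pi_pos
  refine tendsto_lintegral_filter_of_dominated_convergence
    (fun ξ => ENNReal.ofReal (n * M ^ 2) *
      (ENNReal.ofReal ((2 * Real.pi * ‖ξ‖) ^ (2 * s)) * ‖fourierReal v ξ‖ₑ ^ 2))
    (Eventually.of_forall fun j => ?_)
    (Eventually.of_forall fun j => Eventually.of_forall fun ξ => ?_) ?_
    (Eventually.of_forall fun ξ => ?_)
  · have := hmeas j
    fun_prop
  · rw [← mul_assoc, ← ENNReal.ofReal_mul (by positivity)]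
    gcongr
    calc ∑ i, m j i ξ ^ 2 ≤ ∑ _i : Fin n, (M * (2 * Real.pi * ‖ξ‖) ^ s) ^ 2 :=
          Finset.sum_le_sum fun i _ => by
            rw [← sq_abs]; exact pow_le_pow_left₀ (abs_nonneg _) (hbound j i ξ) 2
      _ = n * M ^ 2 * (2 * Real.pi * ‖ξ‖) ^ (2 * s) := by
          rw [Finset.sum_const, Finset.card_univ, Fintype.card_fin, nsmul_eq_mul, mul_pow,
            ← Real.rpow_natCast ((2 * Real.pi * ‖ξ‖) ^ s) 2, ← Real.rpow_mul (by positivity)]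
          push_cast; ring_nf
  · rw [lintegral_const_mul' _ _ ENNReal.ofReal_ne_top]
    exact (ENNReal.mul_lt_top ENNReal.ofReal_lt_top hE).ne
  · refine ENNReal.Tendsto.mul_const (ENNReal.tendsto_ofReal
      (tendsto_finsetSum _ fun i _ => (hlim i ξ).pow 2)) (Or.inr ?_)
    exact ENNReal.pow_ne_top enorm_ne_top

/-- Existence of the weighted gradient, and its norm. -/
theorem exists_weightedGrad (hn : 1 ≤ n) {s : ℝ} (hs0 : 0 < s) (hs1 : s < 1) {v : Eucl n → ℝ}
    (hm : Measurable v) (hv : Integrable v) (hv2 : MemLp v 2) (hE : fourierEnergy s v < ⊤) :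
    ∃ g : Lp (Eucl n) 2 (volume : Measure (Eucl n)),
      Tendsto (fun ε : ℝ => eLpNorm (fun x => truncGrad s ε v x - g x) 2 volume) (𝓝[>] 0) (𝓝 0) ∧
      ‖g‖ₑ ^ 2 = fourierEnergy s v := by
  classical
  obtain ⟨M, hM0, hM⟩ := exists_symbol_bound hn hs0 hs1 (n := n)
  -- The truncated gradient as a map into the complete space `L²`. Its value for `ε ≤ 0` is a
  -- filler, invisible to the filter `𝓝[>] 0`.
  let F : ℝ → Lp (Eucl n) 2 (volume : Measure (Eucl n)) := fun ε =>
    if h : 0 < ε then (memLp_truncGrad hn hs0 hs1 h hm hv hv2).toLp else 0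
  have hF : ∀ {ε : ℝ} (h : 0 < ε), F ε = (memLp_truncGrad hn hs0 hs1 h hm hv hv2).toLp :=
    fun h => dif_pos h
  have hpos : ∀ᶠ ε in 𝓝[>] (0 : ℝ), 0 < ε := self_mem_nhdsWithin
  have hcauchy : Cauchy (map F (𝓝[>] 0)) := by
    rw [cauchy_map_iff]
    refine ⟨inferInstance, ?_⟩
    rw [tendsto_uniformity_iff_dist_tendsto_zero]
    -- Symbol differences tend to zero pointwise and are at most `2M (2π|ξ|)^s`, so dominated
    -- convergence along the product filter yields the Cauchy property.
    have h1 := tendsto_lintegral_symbol (l := 𝓝[>] (0 : ℝ) ×ˢ 𝓝[>] (0 : ℝ)) (M := M + M)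
      (m := fun p i ξ => truncSymbol s p.1 (basisVec i) ξ - truncSymbol s p.2 (basisVec i) ξ)
      hv hE (fun p i => (measurable_truncSymbol s p.1 _).sub (measurable_truncSymbol s p.2 _))
      (fun p i ξ => by
        rw [add_mul]
        exact (abs_sub _ _).trans (add_le_add (hM p.1 i ξ) (hM p.2 i ξ)))
      (fun i ξ => ((tendsto_truncSymbol hn hs0 hs1 (basisVec i) ξ).comp tendsto_fst).sub
        ((tendsto_truncSymbol hn hs0 hs1 (basisVec i) ξ).comp tendsto_snd))
    simp only [sub_self, ne_eq, OfNat.ofNat_ne_zero, not_false_eq_true, zero_pow,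
      Finset.sum_const_zero, ENNReal.ofReal_zero, zero_mul, lintegral_zero] at h1
    have h2 := ((ENNReal.continuous_rpow_const (y := 1 / 2)).tendsto (0 : ENNReal)).comp h1
    rw [ENNReal.zero_rpow_of_pos (by norm_num)] at h2
    have h3 := (ENNReal.tendsto_toReal ENNReal.zero_ne_top).comp h2
    rw [ENNReal.toReal_zero] at h3
    refine h3.congr' ?_
    filter_upwards [hpos.prod_mk hpos] with p hp
    simp only [Function.comp_apply]
    rw [hF hp.1, hF hp.2, dist_edist, Lp.edist_toLp_toLp, eLpNorm_two_eq,
      ← lintegral_truncGrad_sub_sq hn hs0 hs1 hp.1 hp.2 hm hv hv2]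
    rfl
  obtain ⟨g, hg⟩ := CompleteSpace.complete hcauchy
  have hg : Tendsto F (𝓝[>] 0) (𝓝 g) := hg
  refine ⟨g, ?_, ?_⟩
  · rw [tendsto_iff_edist_tendsto_0] at hg
    refine hg.congr' ?_
    filter_upwards [hpos] with ε hε
    rw [hF hε, Lp.edist_def]
    refine eLpNorm_congr_ae ?_
    filter_upwards [(memLp_truncGrad hn hs0 hs1 hε hm hv hv2).coeFn_toLp] with x hx
    simp [hx]
  · have h1 : Tendsto (fun ε => ‖F ε‖ₑ ^ 2) (𝓝[>] 0) (𝓝 (‖g‖ₑ ^ 2)) :=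
      ((ENNReal.continuous_pow 2).tendsto _).comp ((continuous_enorm.tendsto g).comp hg)
    have h2 := tendsto_lintegral_symbol (l := 𝓝[>] (0 : ℝ)) (m := fun ε i => truncSymbol s ε (basisVec i))
      hv hE (fun ε i => measurable_truncSymbol s ε _) (fun ε i ξ => hM ε i ξ)
      (fun i ξ => by
        have := tendsto_truncSymbol hn hs0 hs1 (basisVec i) ξ
        rwa [integral_fracKernel_mul_sin hn hs0 hs1] at this)
    simp only [sum_symbol_sq hs0] at h2
    refine tendsto_nhds_unique h1 (h2.congr' ?_)
    filter_upwards [hpos] with ε hε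
    rw [hF hε, Lp.enorm_toLp, ← lintegral_enorm_sq_eq, lintegral_truncGrad_sq hn hs0 hs1 hε hm hv hv2]

end GradientLimit

/-! ### The weighted gradient on `Hs s Ω`. -/

section HsGradient

variable {n : ℕ} {s : ℝ} {Ω : Set (Eucl n)}

theorem Hs.ae_eq_zero (w : Hs s Ω) : ∀ᵐ x, x ∉ Ω → Hs.toL2 w x = 0 := w.2.2

theorem Hs.measurable_toL2 (w : Hs s Ω) : Measurable (Hs.toL2 w) :=
  (Lp.stronglyMeasurable _).measurable

theorem Hs.memLp_toL2 (w : Hs s Ω) : MemLp (Hs.toL2 w) 2 := Lp.memLp _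

/-- A square integrable function vanishing outside a bounded set is integrable, so its Fourier
transform is given by the integral. -/
theorem Hs.integrable_toL2 (hΩo : IsOpen Ω) (hΩb : Bornology.IsBounded Ω) (w : Hs s Ω) :
    Integrable (Hs.toL2 w) := by
  have : IsFiniteMeasure ((volume : Measure (Eucl n)).restrict Ω) :=
    ⟨by simpa using hΩb.measure_lt_top⟩
  have h1 : IntegrableOn (Hs.toL2 w) Ω :=
    ((Hs.memLp_toL2 w).restrict Ω).integrable one_le_two
  refine ((integrable_indicator_iff hΩo.measurableSet).2 h1).congr ?_
  filter_upwards [Hs.ae_eq_zero w] with x hx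
  by_cases hxΩ : x ∈ Ω
  · rw [Set.indicator_of_mem hxΩ]
  · rw [Set.indicator_of_notMem hxΩ, hx hxΩ]

theorem Hs.norm_eq (w : Hs s Ω) : ‖w‖ = ‖Hs.quot w‖ := rfl

theorem Hs.lintegral_diffQuot_sq_eq (w : Hs s Ω) :
    ∫⁻ p, ‖diffQuot s (Hs.toL2 w) p‖ₑ ^ 2 ∂((volume : Measure (Eucl n)).prod volume) =
      ENNReal.ofReal (‖w‖ ^ 2) := by
  rw [lintegral_enorm_sq_eq, Hs.norm_eq, ENNReal.ofReal_pow (norm_nonneg _), ofReal_norm]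
  congr 1
  exact (Lp.enorm_toLp (Hs.memLp_diffQuot w)).symm

theorem Hs.fourierEnergy_eq (hn : 1 ≤ n) (hs0 : 0 < s) (hs1 : s < 1) (hΩo : IsOpen Ω)
    (hΩb : Bornology.IsBounded Ω) (w : Hs s Ω) :
    fourierEnergy s (Hs.toL2 w) = ENNReal.ofReal (fracLapConst n s / 2 * ‖w‖ ^ 2) := by
  have hC := fracLapConst_pos n hs0 hs1
  have h1 := lintegral_diffQuot_sq hn hs0 hs1 (Hs.measurable_toL2 w)
    (Hs.integrable_toL2 hΩo hΩb w) (Hs.memLp_toL2 w)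
  rw [Hs.lintegral_diffQuot_sq_eq] at h1
  rw [ENNReal.ofReal_mul (by positivity), h1, ← mul_assoc, ← ENNReal.ofReal_mul (by positivity)]
  have h2 : fracLapConst n s / 2 * (2 / fracLapConst n s) = 1 := by field_simp
  rw [h2, ENNReal.ofReal_one, one_mul, fourierEnergy]

/-- The weighted gradient exists on `H^s_Ω`, with `‖𝒢_ω w‖² = (C_{n,s} / 2) ‖w‖²`. -/
theorem Hs.exists_hasWeightedGrad (hn : 1 ≤ n) (hs0 : 0 < s) (hs1 : s < 1) (hΩo : IsOpen Ω)
    (hΩb : Bornology.IsBounded Ω) (w : Hs s Ω) :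
    ∃ g, HasWeightedGrad s (Hs.toL2 w) g ∧ ‖g‖ ^ 2 = fracLapConst n s / 2 * ‖w‖ ^ 2 := by
  have hC := fracLapConst_pos n hs0 hs1
  obtain ⟨g, hg, hg2⟩ := exists_weightedGrad hn hs0 hs1 (Hs.measurable_toL2 w)
    (Hs.integrable_toL2 hΩo hΩb w) (Hs.memLp_toL2 w)
    (by rw [Hs.fourierEnergy_eq hn hs0 hs1 hΩo hΩb]; exact ENNReal.ofReal_lt_top)
  refine ⟨g, hg, ?_⟩
  rw [Hs.fourierEnergy_eq hn hs0 hs1 hΩo hΩb, enorm_sq_eq_ofReal] at hg2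
  exact (ENNReal.ofReal_eq_ofReal_iff (by positivity) (by positivity)).1 hg2

/-- Sums and multiples of `L²` classes agree only almost everywhere with those of representatives;
this passes such equalities through the gradient. -/
theorem truncGrad_congr (s ε : ℝ) {u v : Eucl n → ℝ} (h : u =ᵐ[volume] v) :
    truncGrad s ε u =ᵐ[volume] truncGrad s ε v := by
  filter_upwards [h] with x hx
  refine integral_congr_ae (ae_restrict_of_ae ?_)
  filter_upwards [h] with y hy
  rw [hx, hy]

/-- Triangle inequality through `truncGrad`. It makes the choice in `weightedGrad` immaterial, and
linearity of the gradient follows. -/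
theorem hasWeightedGrad_unique (hn : 1 ≤ n) (hs0 : 0 < s) (hs1 : s < 1) (hΩo : IsOpen Ω)
    (hΩb : Bornology.IsBounded Ω) (w : Hs s Ω)
    {g g' : Lp (Eucl n) 2 (volume : Measure (Eucl n))} (hg : HasWeightedGrad s (Hs.toL2 w) g)
    (hg' : HasWeightedGrad s (Hs.toL2 w) g') : g = g' := by
  have h0 := hg'.add hg
  rw [add_zero] at h0
  have h1 : eLpNorm (fun x => g x - g' x) 2 volume ≤ 0 := by
    refine ge_of_tendsto h0 ?_
    filter_upwards [self_mem_nhdsWithin] with ε hε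
    have hm := memLp_truncGrad hn hs0 hs1 hε (Hs.measurable_toL2 w)
      (Hs.integrable_toL2 hΩo hΩb w) (Hs.memLp_toL2 w)
    refine le_trans (le_of_eq (congrArg (eLpNorm · 2 volume) (funext fun x => ?_)))
      (eLpNorm_sub_le (hm.aestronglyMeasurable.sub (Lp.aestronglyMeasurable g'))
      (hm.aestronglyMeasurable.sub (Lp.aestronglyMeasurable g)) one_le_two)
    simp only [Pi.sub_apply]
    abel
  have h2 := (eLpNorm_eq_zero_iff ((Lp.aestronglyMeasurable g).sub (Lp.aestronglyMeasurable g'))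
    two_ne_zero).1 (le_antisymm h1 zero_le)
  refine Lp.ext ?_
  filter_upwards [h2] with x hx using sub_eq_zero.1 hx

theorem Hs.hasWeightedGrad_add (hn : 1 ≤ n) (hs0 : 0 < s) (hs1 : s < 1) (hΩo : IsOpen Ω)
    (hΩb : Bornology.IsBounded Ω) (w w' : Hs s Ω)
    {g g' : Lp (Eucl n) 2 (volume : Measure (Eucl n))} (hg : HasWeightedGrad s (Hs.toL2 w) g)
    (hg' : HasWeightedGrad s (Hs.toL2 w') g') :
    HasWeightedGrad s (Hs.toL2 (w + w')) (g + g') := by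
  have hm := fun {ε : ℝ} (hε : 0 < ε) (w : Hs s Ω) => memLp_truncGrad hn hs0 hs1 hε
    (Hs.measurable_toL2 w) (Hs.integrable_toL2 hΩo hΩb w) (Hs.memLp_toL2 w)
  have h0 := hg.add hg'
  rw [add_zero] at h0
  refine tendsto_of_tendsto_of_tendsto_of_le_of_le' tendsto_const_nhds h0
    (Eventually.of_forall fun ε => zero_le) ?_
  filter_upwards [self_mem_nhdsWithin] with ε hε
  have hε : 0 < ε := hε
  refine le_trans (le_of_eq (eLpNorm_congr_ae ?_)) (eLpNorm_add_le
    ((hm hε w).aestronglyMeasurable.sub (Lp.aestronglyMeasurable g))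
    ((hm hε w').aestronglyMeasurable.sub (Lp.aestronglyMeasurable g')) one_le_two)
  rw [map_add]
  filter_upwards [Lp.coeFn_add g g', truncGrad_congr s ε (Lp.coeFn_add (Hs.toL2 w) (Hs.toL2 w'))]
    with x h1 h2
  rw [h1, h2]
  have h3 : truncGrad s ε (Hs.toL2 w + Hs.toL2 w' : Eucl n → ℝ) x =
      truncGrad s ε (Hs.toL2 w) x + truncGrad s ε (Hs.toL2 w') x := by
    rw [truncGrad, truncGrad, truncGrad, ← integral_add
      (integrableOn_truncGrad hn hs0 hs1 hε (Hs.measurable_toL2 w)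
        (Hs.integrable_toL2 hΩo hΩb w) x)
      (integrableOn_truncGrad hn hs0 hs1 hε (Hs.measurable_toL2 w')
        (Hs.integrable_toL2 hΩo hΩb w') x)]
    refine integral_congr_ae (Eventually.of_forall fun y => ?_)
    simp only [Pi.add_apply]
    rw [← add_smul]
    congr 1; ring
  rw [h3]
  simp only [Pi.add_apply]
  abel

theorem Hs.hasWeightedGrad_smul (c : ℝ) (w : Hs s Ω)
    {g : Lp (Eucl n) 2 (volume : Measure (Eucl n))} (hg : HasWeightedGrad s (Hs.toL2 w) g) :
    HasWeightedGrad s (Hs.toL2 (c • w)) (c • g) := by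
  have h0 := ENNReal.Tendsto.const_mul (a := ‖c‖ₑ) hg (Or.inr enorm_ne_top)
  rw [mul_zero] at h0
  refine h0.congr fun ε => ?_
  rw [← eLpNorm_const_smul, map_smul]
  refine eLpNorm_congr_ae ?_
  filter_upwards [Lp.coeFn_smul c g, truncGrad_congr s ε (Lp.coeFn_smul c (Hs.toL2 w))]
    with x h1 h2
  rw [h1, h2]
  have h3 : truncGrad s ε (c • (Hs.toL2 w : Eucl n → ℝ)) x = c • truncGrad s ε (Hs.toL2 w) x := by
    rw [truncGrad, truncGrad, ← integral_smul]
    refine integral_congr_ae (Eventually.of_forall fun y => ?_)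
    simp only [Pi.smul_apply, smul_eq_mul]
    rw [smul_smul]
    congr 1; ring
  rw [h3]
  simp only [Pi.smul_apply, smul_sub]

theorem Hs.hasWeightedGrad_weightedGrad (hn : 1 ≤ n) (hs0 : 0 < s) (hs1 : s < 1) (hΩo : IsOpen Ω)
    (hΩb : Bornology.IsBounded Ω) (w : Hs s Ω) :
    HasWeightedGrad s (Hs.toL2 w) (weightedGrad s (Hs.toL2 w)) := by
  have h : ∃ g, HasWeightedGrad s (Hs.toL2 w) g :=
    (Hs.exists_hasWeightedGrad hn hs0 hs1 hΩo hΩb w).imp fun _ hg => hg.1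
  rw [weightedGrad, dif_pos h]
  exact h.choose_spec

/-- The weighted gradient as a linear map on `H^s_Ω`. -/
def Hs.grad (hn : 1 ≤ n) (hs0 : 0 < s) (hs1 : s < 1) (hΩo : IsOpen Ω)
    (hΩb : Bornology.IsBounded Ω) : Hs s Ω →ₗ[ℝ] Lp (Eucl n) 2 (volume : Measure (Eucl n)) where
  toFun w := weightedGrad s (Hs.toL2 w)
  map_add' w w' := hasWeightedGrad_unique hn hs0 hs1 hΩo hΩb (w + w')
    (Hs.hasWeightedGrad_weightedGrad hn hs0 hs1 hΩo hΩb _)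
    (Hs.hasWeightedGrad_add hn hs0 hs1 hΩo hΩb w w'
      (Hs.hasWeightedGrad_weightedGrad hn hs0 hs1 hΩo hΩb w)
      (Hs.hasWeightedGrad_weightedGrad hn hs0 hs1 hΩo hΩb w'))
  map_smul' c w := hasWeightedGrad_unique hn hs0 hs1 hΩo hΩb (c • w)
    (Hs.hasWeightedGrad_weightedGrad hn hs0 hs1 hΩo hΩb _)
    (Hs.hasWeightedGrad_smul c w (Hs.hasWeightedGrad_weightedGrad hn hs0 hs1 hΩo hΩb w))

theorem Hs.norm_grad_sq (hn : 1 ≤ n) (hs0 : 0 < s) (hs1 : s < 1) (hΩo : IsOpen Ω)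
    (hΩb : Bornology.IsBounded Ω) (w : Hs s Ω) :
    ‖Hs.grad hn hs0 hs1 hΩo hΩb w‖ ^ 2 = fracLapConst n s / 2 * ‖w‖ ^ 2 := by
  obtain ⟨g, hg, hg2⟩ := Hs.exists_hasWeightedGrad hn hs0 hs1 hΩo hΩb w
  rw [← hg2, hasWeightedGrad_unique hn hs0 hs1 hΩo hΩb w hg
    (Hs.hasWeightedGrad_weightedGrad hn hs0 hs1 hΩo hΩb w)]
  rfl

end HsGradient

/-! ### Boundedness, symmetry and coercivity of the form. -/

section AnisotropicForm

variable {n : ℕ} {A : Eucl n → Matrix (Fin n) (Fin n) ℝ} {lmin lmax : ℝ}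

theorem IsEllipticTensor.inner_comm (hA : IsEllipticTensor A lmin lmax) (x a b : Eucl n) :
    inner ℝ a (Matrix.toEuclideanLin (A x) b) = inner ℝ b (Matrix.toEuclideanLin (A x) a) := by
  have h : (Matrix.toEuclideanLin (A x)).IsSymmetric :=
    Matrix.isSymmetric_toEuclideanLin_iff.2 (by
      rw [Matrix.IsHermitian, Matrix.conjTranspose_eq_transpose_of_trivial]
      exact hA.symm x)
  rw [← h a b, real_inner_comm]

/-- Polarisation: with `L = A(x)` and `a = lmax⁻¹ L b`, `4⟨a, L b⟩ = ⟨a+b, L(a+b)⟩ - ⟨a-b, L(a-b)⟩ ≤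
2 lmax (‖a‖² + ‖b‖²)`, and this choice of `a` gives the constant `lmax`. -/
theorem IsEllipticTensor.norm_le (hA : IsEllipticTensor A lmin lmax) (x b : Eucl n) :
    ‖Matrix.toEuclideanLin (A x) b‖ ≤ lmax * ‖b‖ := by
  have hl : 0 < lmax := hA.pos.trans_le hA.le
  set L := Matrix.toEuclideanLin (A x) with hL
  set a : Eucl n := lmax⁻¹ • L b with ha
  have h1 := hA.upper x (a + b)
  have h2 : 0 ≤ inner ℝ (a - b) (L (a - b)) :=
    le_trans (by have := hA.pos; positivity) (hA.lower x (a - b))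
  have h3 : inner ℝ b (L a) = inner ℝ a (L b) := hA.inner_comm x b a
  have h4 : inner ℝ a (L b) = lmax⁻¹ * ‖L b‖ ^ 2 := by
    rw [ha, real_inner_smul_left, real_inner_self_eq_norm_sq]
  have h5 : ‖a‖ ^ 2 = (lmax⁻¹) ^ 2 * ‖L b‖ ^ 2 := by
    rw [ha, norm_smul, mul_pow, Real.norm_of_nonneg (by positivity)]
  have h6 := parallelogram_law_with_norm ℝ a b
  rw [← hL, map_add, inner_add_left, inner_add_right, inner_add_right] at h1
  rw [map_sub, inner_sub_left, inner_sub_right, inner_sub_right] at h2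
  have h7 : lmax * ‖a + b‖ ^ 2 ≤ lmax * (2 * (‖a‖ ^ 2 + ‖b‖ ^ 2)) :=
    mul_le_mul_of_nonneg_left (by nlinarith [sq_nonneg ‖a - b‖]) hl.le
  have h8 : lmax * (2 * (‖a‖ ^ 2 + ‖b‖ ^ 2)) =
      2 * (lmax⁻¹ * ‖L b‖ ^ 2) + 2 * (lmax * ‖b‖ ^ 2) := by
    rw [h5]; field_simp
  have h9 : lmax⁻¹ * ‖L b‖ ^ 2 ≤ lmax * ‖b‖ ^ 2 := by linarith
  refine abs_le_of_sq_le_sq' ?_ (by positivity) |>.2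
  rw [inv_mul_le_iff₀ hl] at h9
  nlinarith

theorem IsEllipticTensor.memLp (hA : IsEllipticTensor A lmin lmax)
    (g : Lp (Eucl n) 2 (volume : Measure (Eucl n))) :
    MemLp (fun x => Matrix.toEuclideanLin (A x) (g x)) 2 := by
  refine (Lp.memLp g).of_le_mul (c := lmax) (Measurable.aestronglyMeasurable ?_)
    (Eventually.of_forall fun x => hA.norm_le x (g x))
  have hg : Measurable g := (Lp.stronglyMeasurable g).measurable
  have hgj : ∀ j, Measurable fun x => g x j := fun j => by fun_prop
  refine (WithLp.measurable_toLp 2 _).comp (g := WithLp.toLp 2) (measurable_pi_iff.2 fun i => ?_)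
  change Measurable fun x => ∑ j, A x i j * g x j
  exact Finset.measurable_sum _ fun j _ => (hA.measurable i j).mul (hgj j)

/-- Multiplication by the tensor field, as a linear map on `L²(ℝⁿ; ℝⁿ)`. -/
def IsEllipticTensor.mulLp (hA : IsEllipticTensor A lmin lmax) :
    Lp (Eucl n) 2 (volume : Measure (Eucl n)) →ₗ[ℝ] Lp (Eucl n) 2 (volume : Measure (Eucl n)) where
  toFun g := (hA.memLp g).toLp
  map_add' g g' := by
    rw [← MemLp.toLp_add, MemLp.toLp_eq_toLp_iff]
    filter_upwards [Lp.coeFn_add g g'] with x hx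
    rw [hx, Pi.add_apply, Pi.add_apply, map_add]
  map_smul' c g := by
    rw [RingHom.id_apply, ← MemLp.toLp_const_smul, MemLp.toLp_eq_toLp_iff]
    filter_upwards [Lp.coeFn_smul c g] with x hx
    rw [hx, Pi.smul_apply, Pi.smul_apply, map_smul]

theorem IsEllipticTensor.coeFn_mulLp (hA : IsEllipticTensor A lmin lmax)
    (g : Lp (Eucl n) 2 (volume : Measure (Eucl n))) :
    hA.mulLp g =ᵐ[volume] fun x => Matrix.toEuclideanLin (A x) (g x) :=
  (hA.memLp g).coeFn_toLp

theorem IsEllipticTensor.norm_mulLp_le (hA : IsEllipticTensor A lmin lmax)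
    (g : Lp (Eucl n) 2 (volume : Measure (Eucl n))) : ‖hA.mulLp g‖ ≤ lmax * ‖g‖ := by
  refine Lp.norm_le_mul_norm_of_ae_le_mul ?_
  filter_upwards [hA.coeFn_mulLp g] with x hx
  rw [hx]
  exact hA.norm_le x (g x)

theorem IsEllipticTensor.inner_mulLp (hA : IsEllipticTensor A lmin lmax)
    (g g' : Lp (Eucl n) 2 (volume : Measure (Eucl n))) :
    inner ℝ g (hA.mulLp g') = ∫ x, inner ℝ (g x) (Matrix.toEuclideanLin (A x) (g' x)) := by
  rw [L2.inner_def]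
  refine integral_congr_ae ?_
  filter_upwards [hA.coeFn_mulLp g'] with x hx
  rw [hx]

theorem IsEllipticTensor.inner_mulLp_comm (hA : IsEllipticTensor A lmin lmax)
    (g g' : Lp (Eucl n) 2 (volume : Measure (Eucl n))) :
    inner ℝ g (hA.mulLp g') = inner ℝ g' (hA.mulLp g) := by
  rw [hA.inner_mulLp, hA.inner_mulLp]
  exact integral_congr_ae (Eventually.of_forall fun x => hA.inner_comm x _ _)

theorem IsEllipticTensor.le_inner_mulLp (hA : IsEllipticTensor A lmin lmax)
    (g : Lp (Eucl n) 2 (volume : Measure (Eucl n))) :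
    lmin * ‖g‖ ^ 2 ≤ inner ℝ g (hA.mulLp g) := by
  have h1 : lmin * ‖g‖ ^ 2 = ∫ x, lmin * inner ℝ (g x) (g x) := by
    rw [integral_const_mul, ← L2.inner_def, real_inner_self_eq_norm_sq]
  have h2 : Integrable fun x => inner ℝ (g x) (Matrix.toEuclideanLin (A x) (g x)) := by
    refine (L2.integrable_inner (𝕜 := ℝ) g (hA.mulLp g)).congr ?_
    filter_upwards [hA.coeFn_mulLp g] with x hx
    rw [hx]
  rw [h1, hA.inner_mulLp]
  refine integral_mono ((L2.integrable_inner (𝕜 := ℝ) g g).const_mul lmin) h2 fun x => ?_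
  have h3 := hA.lower x (g x)
  rwa [← real_inner_self_eq_norm_sq] at h3

variable {s : ℝ} {Ω : Set (Eucl n)}

theorem Hs.norm_grad (hn : 1 ≤ n) (hs0 : 0 < s) (hs1 : s < 1) (hΩo : IsOpen Ω)
    (hΩb : Bornology.IsBounded Ω) (w : Hs s Ω) :
    ‖Hs.grad hn hs0 hs1 hΩo hΩb w‖ = √(fracLapConst n s / 2) * ‖w‖ := by
  rw [← Real.sqrt_sq (norm_nonneg (Hs.grad hn hs0 hs1 hΩo hΩb w)), Hs.norm_grad_sq,
    Real.sqrt_mul (by have := fracLapConst_pos n hs0 hs1; positivity),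
    Real.sqrt_sq (norm_nonneg _)]

/-- The form `ℬ_{ω;A}` as a bounded bilinear form on `H^s_Ω`. -/
def Hs.form (hn : 1 ≤ n) (hs0 : 0 < s) (hs1 : s < 1) (hΩo : IsOpen Ω)
    (hΩb : Bornology.IsBounded Ω) (hA : IsEllipticTensor A lmin lmax) :
    Hs s Ω →L[ℝ] Hs s Ω →L[ℝ] ℝ :=
  LinearMap.mkContinuous₂
    (LinearMap.mk₂ ℝ (fun u v => inner ℝ (Hs.grad hn hs0 hs1 hΩo hΩb u)
        (hA.mulLp (Hs.grad hn hs0 hs1 hΩo hΩb v)))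
      (fun u u' v => by rw [map_add, inner_add_left])
      (fun c u v => by rw [map_smul, real_inner_smul_left, smul_eq_mul])
      (fun u v v' => by rw [map_add, map_add, inner_add_right])
      (fun c u v => by rw [map_smul, map_smul, real_inner_smul_right, smul_eq_mul]))
    (√(fracLapConst n s / 2) * (lmax * √(fracLapConst n s / 2))) (fun u v => by
      rw [LinearMap.mk₂_apply]
      refine (norm_inner_le_norm _ _).trans ?_
      refine (mul_le_mul_of_nonneg_left (hA.norm_mulLp_le _) (norm_nonneg _)).trans (le_of_eq ?_)
      rw [Hs.norm_grad, Hs.norm_grad]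
      ring)

theorem Hs.form_eq_anisoForm (hn : 1 ≤ n) (hs0 : 0 < s) (hs1 : s < 1) (hΩo : IsOpen Ω)
    (hΩb : Bornology.IsBounded Ω) (hA : IsEllipticTensor A lmin lmax) (u v : Hs s Ω) :
    Hs.form hn hs0 hs1 hΩo hΩb hA u v = anisoForm s A (Hs.toL2 u) (Hs.toL2 v) :=
  hA.inner_mulLp _ _

theorem Hs.form_comm (hn : 1 ≤ n) (hs0 : 0 < s) (hs1 : s < 1) (hΩo : IsOpen Ω)
    (hΩb : Bornology.IsBounded Ω) (hA : IsEllipticTensor A lmin lmax) (u v : Hs s Ω) :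
    Hs.form hn hs0 hs1 hΩo hΩb hA u v = Hs.form hn hs0 hs1 hΩo hΩb hA v u :=
  hA.inner_mulLp_comm _ _

theorem Hs.form_coercive (hn : 1 ≤ n) (hs0 : 0 < s) (hs1 : s < 1) (hΩo : IsOpen Ω)
    (hΩb : Bornology.IsBounded Ω) (hA : IsEllipticTensor A lmin lmax) (u : Hs s Ω) :
    fracLapConst n s / 2 * lmin * ‖u‖ ^ 2 ≤ Hs.form hn hs0 hs1 hΩo hΩb hA u u := by
  refine le_trans (le_of_eq ?_) (hA.le_inner_mulLp (Hs.grad hn hs0 hs1 hΩo hΩb u))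
  rw [Hs.norm_grad_sq]
  ring

end AnisotropicForm

/-! ### The Poincaré inequality and completeness of `Hs s Ω`. -/

section HilbertSpace

variable {n : ℕ} {s : ℝ} {Ω : Set (Eucl n)}

/-- If `Ω` lies in the ball of radius `R` at the origin, a ball of radius `R` centred at distance
`3R` stays outside it, and all distances between the two are below `5R`. -/
theorem exists_ball_far (hn : 1 ≤ n) (hΩb : Bornology.IsBounded Ω) :
    ∃ (p : Eucl n) (R : ℝ), 0 < R ∧ ∀ y ∈ Metric.ball p R, y ∉ Ω ∧ ∀ x ∈ Ω, ‖x - y‖ ≤ 5 * R := by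
  obtain ⟨R, hR, hΩ⟩ := hΩb.exists_pos_norm_lt
  refine ⟨(3 * R) • basisVec ⟨0, hn⟩, R, hR, fun y hy => ?_⟩
  set p : Eucl n := (3 * R) • basisVec ⟨0, hn⟩ with hp
  have hpn : ‖p‖ = 3 * R := by
    rw [hp, norm_smul, norm_basisVec, mul_one, Real.norm_of_nonneg (by positivity)]
  rw [mem_ball_iff_norm] at hy
  constructor
  · intro hyΩ
    have h1 := hΩ y hyΩ
    have h2 := norm_sub_norm_le p (p - y)
    rw [sub_sub_cancel, hpn, norm_sub_rev] at h2
    linarith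
  · intro x hx
    have h1 := hΩ x hx
    have h2 : ‖x - y‖ ≤ ‖x‖ + (‖p‖ + ‖y - p‖) := by
      have : x - y = x - (p + (y - p)) := by abel
      rw [this]
      exact (norm_sub_le _ _).trans (add_le_add_right (norm_add_le _ _) _)
    linarith

theorem Hs.lintegral_restrict_toL2 (hΩo : IsOpen Ω) (w : Hs s Ω) :
    ∫⁻ x in Ω, ‖Hs.toL2 w x‖ₑ ^ 2 = ‖Hs.toL2 w‖ₑ ^ 2 := by
  rw [Lp.enorm_def, ← lintegral_enorm_sq_eq, ← lintegral_indicator hΩo.measurableSet]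
  refine lintegral_congr_ae ?_
  filter_upwards [Hs.ae_eq_zero w] with x hx
  by_cases hxΩ : x ∈ Ω
  · rw [Set.indicator_of_mem hxΩ]
  · rw [Set.indicator_of_notMem hxΩ, hx hxΩ]; simp

/-- The Poincaré inequality on `H^s_Ω`: compare the values of `w` on `Ω` with its zero values on a
ball away from `Ω`. -/
theorem exists_poincareOn (hn : 1 ≤ n) (hs0 : 0 < s) (hΩo : IsOpen Ω)
    (hΩb : Bornology.IsBounded Ω) : ∃ C : ℝ, PoincareOn s Ω C := by
  obtain ⟨p, R, hR, hball⟩ := exists_ball_far hn hΩb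
  -- `k` bounds the inverse denominator of the difference quotient from below on `Ω × ball`. There
  -- the quotient is at least `k |w(x)|` in size, and integrating its square gives `m ‖w‖²`.
  set k : ℝ := ((5 * R) ^ ((n : ℝ) / 2 + s))⁻¹ with hk
  have hk0 : 0 < k := by positivity
  set m : ℝ := k ^ 2 * (volume (Metric.ball p R)).toReal with hm
  have hv0 : 0 < (volume (Metric.ball p R)).toReal :=
    ENNReal.toReal_pos (Metric.measure_ball_pos _ _ hR).ne' measure_ball_lt_top.ne
  have hm0 : 0 < m := by positivity
  refine ⟨(√m)⁻¹, fun w => ?_⟩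
  have hmeas := Hs.measurable_toL2 w
  have h1 : ENNReal.ofReal m * ‖Hs.toL2 w‖ₑ ^ 2 ≤ ENNReal.ofReal (‖w‖ ^ 2) := by
    rw [← Hs.lintegral_diffQuot_sq_eq]
    calc ENNReal.ofReal m * ‖Hs.toL2 w‖ₑ ^ 2
        = ∫⁻ z in Ω ×ˢ Metric.ball p R, ENNReal.ofReal (k ^ 2) * ‖Hs.toL2 w z.1‖ₑ ^ 2 * 1
            ∂((volume : Measure (Eucl n)).prod volume) := by
          rw [← Measure.prod_restrict, lintegral_prod_mul
            (f := fun x => ENNReal.ofReal (k ^ 2) * ‖Hs.toL2 w x‖ₑ ^ 2) (g := fun _ => 1)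
            (by fun_prop) (by fun_prop), lintegral_const_mul _ (by fun_prop),
            Hs.lintegral_restrict_toL2 hΩo, lintegral_one, Measure.restrict_apply_univ, hm,
            ENNReal.ofReal_mul (by positivity), ENNReal.ofReal_toReal measure_ball_lt_top.ne]
          ring
      _ ≤ ∫⁻ z in Ω ×ˢ Metric.ball p R, ‖diffQuot s (Hs.toL2 w) z‖ₑ ^ 2
            ∂((volume : Measure (Eucl n)).prod volume) := by
          refine lintegral_mono_ae ?_
          have h2 := (Measure.quasiMeasurePreserving_snd
            (μ := (volume : Measure (Eucl n))) (ν := (volume : Measure (Eucl n)))).ae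
            (Hs.ae_eq_zero w)
          filter_upwards [ae_restrict_of_ae h2, ae_restrict_mem
            (hΩo.measurableSet.prod measurableSet_ball)] with z hz hzm
          obtain ⟨hz1, hz2⟩ := hball z.2 hzm.2
          have hne : 0 < ‖z.1 - z.2‖ := norm_pos_iff.2
            (sub_ne_zero.2 fun h => hz1 (h ▸ hzm.1))
          rw [mul_one, enorm_sq_eq_ofReal, enorm_sq_eq_ofReal,
            ← ENNReal.ofReal_mul (by positivity), ← mul_pow]
          refine ENNReal.ofReal_le_ofReal (pow_le_pow_left₀ (by positivity) ?_ 2)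
          rw [diffQuot, hz hz1, sub_zero, norm_div, Real.norm_of_nonneg
            (r := ‖z.1 - z.2‖ ^ ((n : ℝ) / 2 + s)) (by positivity), div_eq_inv_mul]
          refine mul_le_mul_of_nonneg_right ?_ (norm_nonneg _)
          rw [hk]
          exact inv_anti₀ (by positivity)
            (Real.rpow_le_rpow hne.le (hz2 _ hzm.1) (by positivity))
      _ ≤ _ := setLIntegral_le_lintegral _ _
  rw [enorm_sq_eq_ofReal, ← ENNReal.ofReal_mul hm0.le,
    ENNReal.ofReal_le_ofReal_iff (by positivity)] at h1
  rw [← div_eq_inv_mul, le_div_iff₀ (by positivity)]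
  refine (abs_le_of_sq_le_sq' ?_ (norm_nonneg _)).2
  rw [mul_pow, Real.sq_sqrt hm0.le]
  linarith

theorem Hs.toL2_injective : Function.Injective (Hs.toL2 : Hs s Ω →ₗ[ℝ] L2 n) :=
  Subtype.val_injective

/-- The norm of `H^s_Ω` is definite if a Poincaré inequality holds. -/
abbrev Hs.normedAddCommGroup {C : ℝ} (hC : PoincareOn s Ω C) : NormedAddCommGroup (Hs s Ω) :=
  NormedAddCommGroup.ofSeparation fun w hw => by
    refine Hs.toL2_injective ?_
    rw [map_zero, ← norm_le_zero_iff]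
    simpa [hw] using hC w

/-- The inclusion of `H^s_Ω` in `L²(ℝⁿ)` as a bounded map. -/
def Hs.toL2CLM {C : ℝ} (hC : PoincareOn s Ω C) : Hs s Ω →L[ℝ] L2 n :=
  Hs.toL2.mkContinuous C hC

/-- The graph of the difference quotient is closed. -/
theorem exists_Hs_of_tendsto {u : ℕ → Hs s Ω} {v : L2 n}
    {q : Lp ℝ 2 ((volume : Measure (Eucl n)).prod (volume : Measure (Eucl n)))}
    (hv : Tendsto (fun k => Hs.toL2 (u k)) atTop (𝓝 v))
    (hq : Tendsto (fun k => Hs.quot (u k)) atTop (𝓝 q)) : ∃ w : Hs s Ω, Hs.quot w = q := by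
  obtain ⟨ns, hns, hns'⟩ := (tendstoInMeasure_of_tendsto_Lp hv).exists_seq_tendsto_ae
  -- A second extraction along the first, so that functions and quotients converge almost everywhere
  -- together.
  obtain ⟨ms, hms, hms'⟩ := (tendstoInMeasure_of_tendsto_Lp
    (hq.comp hns.tendsto_atTop)).exists_seq_tendsto_ae
  have hfst := (Measure.quasiMeasurePreserving_fst
    (μ := (volume : Measure (Eucl n))) (ν := (volume : Measure (Eucl n)))).ae hns'
  have hsnd := (Measure.quasiMeasurePreserving_snd
    (μ := (volume : Measure (Eucl n))) (ν := (volume : Measure (Eucl n)))).ae hns'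
  have hcoe : ∀ᵐ p ∂((volume : Measure (Eucl n)).prod volume), ∀ k,
      Hs.quot (u k) p = diffQuot s (Hs.toL2 (u k)) p :=
    ae_all_iff.2 fun k => (Hs.memLp_diffQuot (u k)).coeFn_toLp
  have hdq : diffQuot s v =ᵐ[(volume : Measure (Eucl n)).prod volume] q := by
    filter_upwards [hfst, hsnd, hcoe, hms'] with p h1 h2 h3 h4
    refine tendsto_nhds_unique ?_ h4
    have h5 : Tendsto (fun k => diffQuot s (Hs.toL2 (u (ns k))) p) atTop (𝓝 (diffQuot s v p)) :=
      (h1.sub h2).div_const _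
    refine (h5.comp hms.tendsto_atTop).congr fun k => ?_
    simp only [Function.comp]
    rw [h3]
  have hzero : ∀ᵐ x, x ∉ Ω → v x = 0 := by
    have h0 : ∀ᵐ x, ∀ k, x ∉ Ω → Hs.toL2 (u k) x = 0 :=
      ae_all_iff.2 fun k => Hs.ae_eq_zero (u k)
    filter_upwards [h0, hns'] with x h1 h2 hx
    refine tendsto_nhds_unique h2 ?_
    simp only [h1 _ hx]
    exact tendsto_const_nhds
  have hmem : MemLp (diffQuot s v) 2 ((volume : Measure (Eucl n)).prod volume) :=
    (memLp_congr_ae hdq).2 (Lp.memLp q)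
  refine ⟨⟨v, hmem, hzero⟩, Lp.ext ?_⟩
  exact hmem.coeFn_toLp.trans hdq

/-- By Poincaré a Cauchy sequence also converges in `L²`. The limit of the quotients is then the
quotient of an element of the space, and `Hs.quot` is isometric. -/
theorem Hs.completeSpace {C : ℝ} (hC : PoincareOn s Ω C) : CompleteSpace (Hs s Ω) := by
  refine Metric.complete_of_cauchySeq_tendsto fun u hu => ?_
  have h1 : CauchySeq fun k => Hs.toL2CLM hC (u k) := hu.map (Hs.toL2CLM hC).uniformContinuous
  have hiso : Isometry (Hs.quot : Hs s Ω → _) :=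
    AddMonoidHomClass.isometry_of_norm _ fun w => (Hs.norm_eq w).symm
  have h2 : CauchySeq fun k => Hs.quot (u k) := hu.map hiso.uniformContinuous
  obtain ⟨v, hv⟩ := cauchySeq_tendsto_of_complete h1
  obtain ⟨q, hq⟩ := cauchySeq_tendsto_of_complete h2
  obtain ⟨w, rfl⟩ := exists_Hs_of_tendsto hv hq
  exact ⟨w, (hiso.isUniformInducing.isInducing.tendsto_nhds_iff).2 hq⟩

end HilbertSpace

/-! ### Measurable dual pairings and the energy estimate. -/

section DualPairing

variable {V : Type*} [NormedAddCommGroup V] [NormedSpace ℝ V]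

theorem memLp_sub_form {T : ℝ} (a : V →L[ℝ] V →L[ℝ] ℝ) {f : ℝ → StrongDual ℝ V} {u : ℝ → V}
    (hf : MemLp f 2 (timeMeasure T)) (hu : MemLp u 2 (timeMeasure T)) :
    MemLp (fun t => f t - a (u t)) 2 (timeMeasure T) :=
  MemLp.sub hf (a.comp_memLp' hu)

theorem integrable_dual_apply {T : ℝ} {f : ℝ → StrongDual ℝ V} {u : ℝ → V}
    (hf : MemLp f 2 (timeMeasure T)) (hu : MemLp u 2 (timeMeasure T)) :
    Integrable (fun t => f t (u t)) (timeMeasure T) := by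
  refine Integrable.mono' ((hf.integrable_norm_pow two_ne_zero).add
    (hu.integrable_norm_pow two_ne_zero)) ?_ (Eventually.of_forall fun t => ?_)
  · exact isBoundedBilinearMap_apply.continuous.comp_aestronglyMeasurable
      (hf.aestronglyMeasurable.prodMk hu.aestronglyMeasurable)
  · refine ((f t).le_opNorm (u t)).trans ?_
    simp only [Pi.add_apply]
    nlinarith [sq_nonneg (‖f t‖ - ‖u t‖), sq_nonneg ‖f t‖, sq_nonneg ‖u t‖]

theorem integrable_dual_apply_const {T : ℝ} {f : ℝ → StrongDual ℝ V}
    (hf : MemLp f 2 (timeMeasure T)) (v : V) : Integrable (fun t => f t v) (timeMeasure T) :=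
  integrable_dual_apply hf (memLp_const v)

/-- The energy estimate, from the energy identity and Young's inequality. -/
theorem energy_le {T c : ℝ} {a : V →L[ℝ] V →L[ℝ] ℝ} (hc : 0 < c)
    (hcoer : ∀ x, c * ‖x‖ ^ 2 ≤ a x x) {f : ℝ → StrongDual ℝ (V)}
    (hf : MemLp f 2 (timeMeasure T)) {u : ℝ → V} (hu : MemLp u 2 (timeMeasure T)) {t : ℝ}
    (ht : t ∈ Set.Icc 0 T) :
    (2 * ∫ r in (0 : ℝ)..t, (f r (u r) - a (u r) (u r))) +
      c * ∫ r in (0 : ℝ)..t, ‖u r‖ ^ 2 ≤ 1 / c * ∫ r in (0 : ℝ)..t, ‖f r‖ ^ 2 := by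
  have h1 := intervalIntegrable_of_timeMeasure ht
    (integrable_dual_apply (memLp_sub_form a hf hu) hu)
  simp only [sub_apply] at h1
  have h2 := intervalIntegrable_of_timeMeasure ht (hu.integrable_norm_pow two_ne_zero)
  have h3 := intervalIntegrable_of_timeMeasure ht (hf.integrable_norm_pow two_ne_zero)
  rw [← intervalIntegral.integral_const_mul, ← intervalIntegral.integral_const_mul,
    ← intervalIntegral.integral_const_mul, ← intervalIntegral.integral_add
      (h1.const_mul 2) (h2.const_mul c)]
  refine intervalIntegral.integral_mono_on ht.1 ((h1.const_mul 2).add (h2.const_mul c))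
    (h3.const_mul (1 / c)) fun r _ => ?_
  have h4 : f r (u r) ≤ ‖f r‖ * ‖u r‖ := (le_abs_self _).trans ((f r).le_opNorm (u r))
  have h5 := hcoer (u r)
  -- Young's inequality as a completed square. Coercivity supplies `-2c‖u‖²`; half of it absorbs the
  -- source and half stays on the left of the estimate.
  have h6 : 1 / c * ‖f r‖ ^ 2 - 2 * (‖f r‖ * ‖u r‖) + c * ‖u r‖ ^ 2 =
      1 / c * (‖f r‖ - c * ‖u r‖) ^ 2 := by
    field_simp
    ring
  have h7 : 0 ≤ 1 / c * (‖f r‖ - c * ‖u r‖) ^ 2 := by positivity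
  linarith

end DualPairing

/-! ### From the abstract problem to weak solutions on `Hs s Ω`. -/

section WeakSolutions

variable {n : ℕ} {s : ℝ} {Ω : Set (Eucl n)} {T c C : ℝ}

/-- The definite norm and completeness depend on a Poincaré inequality, so they are installed only
inside the proof; the statement keeps the seminorm, which is unchanged. -/
theorem Hs.exists_parabolic_solution (hC : PoincareOn s Ω C) (hT : 0 ≤ T)
    (a : Hs s Ω →L[ℝ] Hs s Ω →L[ℝ] ℝ) (ha : ∀ x y, a x y = a y x) (hc : 0 < c)
    (hcoer : ∀ x, c * ‖x‖ ^ 2 ≤ a x x) {f : ℝ → StrongDual ℝ (Hs s Ω)}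
    (hf : MemLp f 2 (timeMeasure T)) (u₀ : Hs s Ω) :
    ∃ (u : ℝ → Hs s Ω) (U : ℝ → L2 n), MemLp u 2 (timeMeasure T) ∧ IsContRep T u U ∧
      U 0 = Hs.toL2 u₀ ∧
      (∀ t ∈ Set.Icc 0 T, ∀ v, inner ℝ (U t) (Hs.toL2 v) =
        inner ℝ (Hs.toL2 u₀) (Hs.toL2 v) + ∫ r in (0 : ℝ)..t, (f r v - a (u r) v)) ∧
      ∀ t ∈ Set.Icc 0 T, ‖U t‖ ^ 2 =
        ‖Hs.toL2 u₀‖ ^ 2 + 2 * ∫ r in (0 : ℝ)..t, (f r (u r) - a (u r) (u r)) := by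
  let _ := Hs.normedAddCommGroup hC
  have _ := Hs.completeSpace hC
  obtain ⟨u, U, h1, h2, h3, h4, h5, h6⟩ := FracDiff.exists_parabolic_solution hT (Hs.toL2CLM hC)
    Hs.toL2_injective a ha hc hcoer hf u₀
  exact ⟨u, U, h1, ⟨h2, h3⟩, h4, h5, h6⟩

theorem Hs.ae_eq_zero_of_homogeneous (hC : PoincareOn s Ω C) (hT : 0 ≤ T)
    (a : Hs s Ω →L[ℝ] Hs s Ω →L[ℝ] ℝ) (ha : ∀ x y, a x y = a y x) (hpos : ∀ x, 0 ≤ a x x)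
    {z : ℝ → Hs s Ω} (hz : MemLp z 2 (timeMeasure T))
    (h : ∀ᵐ t ∂(timeMeasure T), ∀ v,
      inner ℝ (Hs.toL2 (z t)) (Hs.toL2 v) = -∫ r in (0 : ℝ)..t, a (z r) v) :
    z =ᵐ[timeMeasure T] 0 := by
  let _ := Hs.normedAddCommGroup hC
  have _ := Hs.completeSpace hC
  exact FracDiff.ae_eq_zero_of_homogeneous hT (Hs.toL2CLM hC) Hs.toL2_injective a ha hpos hz h

theorem Hs.integrable_dual_apply_const (hC : PoincareOn s Ω C) {f : ℝ → StrongDual ℝ (Hs s Ω)}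
    (hf : MemLp f 2 (timeMeasure T)) (v : Hs s Ω) :
    Integrable (fun t => f t v) (timeMeasure T) := by
  let _ := Hs.normedAddCommGroup hC
  exact FracDiff.integrable_dual_apply_const hf v

theorem Hs.memLp_sub_form (hC : PoincareOn s Ω C) (a : Hs s Ω →L[ℝ] Hs s Ω →L[ℝ] ℝ)
    {f : ℝ → StrongDual ℝ (Hs s Ω)} {u : ℝ → Hs s Ω} (hf : MemLp f 2 (timeMeasure T))
    (hu : MemLp u 2 (timeMeasure T)) : MemLp (fun t => f t - a (u t)) 2 (timeMeasure T) := by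
  let _ := Hs.normedAddCommGroup hC
  exact FracDiff.memLp_sub_form a hf hu

theorem Hs.memLp_sub (hC : PoincareOn s Ω C) {u u' : ℝ → Hs s Ω}
    (hu : MemLp u 2 (timeMeasure T)) (hu' : MemLp u' 2 (timeMeasure T)) :
    MemLp (u - u') 2 (timeMeasure T) := by
  let _ := Hs.normedAddCommGroup hC
  exact MemLp.sub hu hu'

theorem isTimeDeriv_of_primitive (hC : PoincareOn s Ω C) (hT : 0 ≤ T) {u : ℝ → Hs s Ω} {U : ℝ → L2 n}
    {w : ℝ → StrongDual ℝ (Hs s Ω)} {u₀ : Hs s Ω} (hw : MemLp w 2 (timeMeasure T))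
    (hU : IsContRep T u U) (h : ∀ t ∈ Set.Icc 0 T, ∀ v, inner ℝ (U t) (Hs.toL2 v) =
      inner ℝ (Hs.toL2 u₀) (Hs.toL2 v) + ∫ r in (0 : ℝ)..t, w r v) : IsTimeDeriv T u w := by
  intro φ hφ _ hφs v
  refine integral_deriv_mul_primitive hT (c₀ := inner ℝ (Hs.toL2 u₀) (Hs.toL2 v))
    (Hs.integrable_dual_apply_const hC hw v) ?_ hφ hφs
  filter_upwards [hU.2, ae_timeMeasure_mem T] with t h1 ht
  rw [← h1, h t ht v]

/-- Tested against a fixed `v`, the weak derivative is scalar and the du Bois-Reymond lemma applies;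
continuity of `U` extends the identity to every `t` in `[0, T]`. -/
theorem IsTimeDeriv.eq_add_integral (hC : PoincareOn s Ω C) (hT : 0 < T) {u : ℝ → Hs s Ω} {U : ℝ → L2 n}
    {w : ℝ → StrongDual ℝ (Hs s Ω)} (hw : MemLp w 2 (timeMeasure T)) (huw : IsTimeDeriv T u w)
    (hU : IsContRep T u U) {t : ℝ} (ht : t ∈ Set.Icc 0 T) (v : Hs s Ω) :
    inner ℝ (U t) (Hs.toL2 v) = inner ℝ (U 0) (Hs.toL2 v) + ∫ r in (0 : ℝ)..t, w r v := by
  refine eq_add_primitive_of_weak hT (c := fun t => inner ℝ (U t) (Hs.toL2 v))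
    (hU.1.inner continuousOn_const) (Hs.integrable_dual_apply_const hC hw v)
    (fun φ hφ hφc hφs => ?_) ht
  rw [← huw φ hφ hφc hφs v]
  refine integral_congr_ae ?_
  filter_upwards [hU.2] with r hr
  rw [hr]

variable {A : Eucl n → Matrix (Fin n) (Fin n) ℝ} {lmin lmax : ℝ}

theorem IsWeakSolution.inner_eq (hC : PoincareOn s Ω C) (hT : 0 < T)
    {a : Hs s Ω →L[ℝ] Hs s Ω →L[ℝ] ℝ}
    (ha : ∀ u v, a u v = anisoForm s A (Hs.toL2 u) (Hs.toL2 v))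
    {f : ℝ → StrongDual ℝ (Hs s Ω)} {u₀ : Hs s Ω} {u : ℝ → Hs s Ω}
    (hu : IsWeakSolution A T f u₀ u) :
    ∀ᵐ t ∂(timeMeasure T), ∀ v, inner ℝ (Hs.toL2 (u t)) (Hs.toL2 v) =
      inner ℝ (Hs.toL2 u₀) (Hs.toL2 v) + ∫ r in (0 : ℝ)..t, (f r v - a (u r) v) := by
  obtain ⟨w, hw, huw, heq⟩ := hu.equation
  obtain ⟨U, hU, hU0⟩ := hu.initial
  filter_upwards [hU.2, ae_timeMeasure_mem T] with t h1 ht v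
  rw [← h1, huw.eq_add_integral hC hT hw hU ht v, hU0]
  congr 1
  refine intervalIntegral_congr_timeMeasure ht ?_
  filter_upwards [heq] with r hr
  rw [← hr v, ha, add_sub_cancel_right]

/-- Both solutions satisfy the same integrated identity, so their difference solves the homogeneous
one. -/
theorem IsWeakSolution.unique (hT : 0 < T) (hC : PoincareOn s Ω C)
    {a : Hs s Ω →L[ℝ] Hs s Ω →L[ℝ] ℝ}
    (ha : ∀ u v, a u v = anisoForm s A (Hs.toL2 u) (Hs.toL2 v)) (hasymm : ∀ u v, a u v = a v u)
    (hpos : ∀ u, 0 ≤ a u u) {f : ℝ → StrongDual ℝ (Hs s Ω)} (hf : MemLp f 2 (timeMeasure T))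
    {u₀ : Hs s Ω} {u u' : ℝ → Hs s Ω} (hu : IsWeakSolution A T f u₀ u)
    (hu' : IsWeakSolution A T f u₀ u') : u' =ᵐ[timeMeasure T] u := by
  have hi : ∀ {u : ℝ → Hs s Ω}, MemLp u 2 (timeMeasure T) → ∀ v : Hs s Ω,
      Integrable (fun t => f t v - a (u t) v) (timeMeasure T) := fun hu v =>
    Hs.integrable_dual_apply_const hC (Hs.memLp_sub_form hC a hf hu) v
  have hz : (u' - u) =ᵐ[timeMeasure T] 0 := by
    refine Hs.ae_eq_zero_of_homogeneous hC hT.le a hasymm hpos (Hs.memLp_sub hC hu'.memLp hu.memLp) ?_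
    filter_upwards [hu.inner_eq hC hT ha, hu'.inner_eq hC hT ha, ae_timeMeasure_mem T] with t h h' ht v
    rw [Pi.sub_apply, map_sub, inner_sub_left, h v, h' v, add_sub_add_left_eq_sub,
      ← intervalIntegral.integral_sub
        (intervalIntegrable_of_timeMeasure ht (hi hu'.memLp v))
        (intervalIntegrable_of_timeMeasure ht (hi hu.memLp v)),
      ← intervalIntegral.integral_neg]
    refine intervalIntegral.integral_congr fun r _ => ?_
    simp only [Pi.sub_apply, map_sub, sub_apply]
    ring
  filter_upwards [hz] with t ht using sub_eq_zero.1 ht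

theorem Hs.energy_le (hC : PoincareOn s Ω C) {a : Hs s Ω →L[ℝ] Hs s Ω →L[ℝ] ℝ} (hc : 0 < c)
    (hcoer : ∀ x, c * ‖x‖ ^ 2 ≤ a x x) {f : ℝ → StrongDual ℝ (Hs s Ω)}
    (hf : MemLp f 2 (timeMeasure T)) {u : ℝ → Hs s Ω} (hu : MemLp u 2 (timeMeasure T)) {t : ℝ}
    (ht : t ∈ Set.Icc 0 T) :
    (2 * ∫ r in (0 : ℝ)..t, (f r (u r) - a (u r) (u r))) +
      c * ∫ r in (0 : ℝ)..t, ‖u r‖ ^ 2 ≤ 1 / c * ∫ r in (0 : ℝ)..t, ‖f r‖ ^ 2 := by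
  let _ := Hs.normedAddCommGroup hC
  exact FracDiff.energy_le hc hcoer hf hu ht

end WeakSolutions

end FracDiff

end

/-! ### The theorem for the weighted nonlocal gradient. -/

theorem corollary4p2 (n : ℕ) (hn : 1 ≤ n) (s : ℝ) (hs0 : 0 < s) (hs1 : s < 1)
    (Ω : Set (FracDiff.Eucl n)) (hΩo : IsOpen Ω) (hΩb : Bornology.IsBounded Ω)
    (A : FracDiff.Eucl n → Matrix (Fin n) (Fin n) ℝ) (lmin lmax : ℝ)
    (hA : FracDiff.IsEllipticTensor A lmin lmax) (T : ℝ) (hT : 0 < T)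
    (f : ℝ → StrongDual ℝ (FracDiff.Hs s Ω)) (hf : MemLp f 2 (FracDiff.timeMeasure T))
    (u₀ : FracDiff.Hs s Ω) :
    (∀ v : FracDiff.Hs s Ω, ∃ g, FracDiff.HasWeightedGrad s (FracDiff.Hs.toL2 v) g) ∧
    (∃ Cp : ℝ, FracDiff.PoincareOn s Ω Cp) ∧
    ∃ u : ℝ → FracDiff.Hs s Ω,
      FracDiff.IsWeakSolution A T f u₀ u ∧
      (∀ u' : ℝ → FracDiff.Hs s Ω, FracDiff.IsWeakSolution A T f u₀ u' →
        u' =ᵐ[FracDiff.timeMeasure T] u) ∧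
      ∀ U : ℝ → FracDiff.L2 n, FracDiff.IsContRep T u U →
        ∀ Ccoer : ℝ, Ccoer = FracDiff.fracLapConst n s / 2 * lmin →
        ∀ Cp : ℝ, √2 ≤ Cp → FracDiff.PoincareOn s Ω Cp →
        ∀ t ∈ Set.Icc 0 T,
          ‖U t‖ ^ 2 + Ccoer * ∫ r in (0 : ℝ)..t, ‖u r‖ ^ 2 ≤
            ‖FracDiff.Hs.toL2 u₀‖ ^ 2 + Cp ^ 2 / (2 * Ccoer) * ∫ r in (0 : ℝ)..t, ‖f r‖ ^ 2 := by
  obtain ⟨C, hC⟩ := FracDiff.exists_poincareOn hn hs0 hΩo hΩb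
  have hc : 0 < FracDiff.fracLapConst n s / 2 * lmin := by
    have := FracDiff.fracLapConst_pos n hs0 hs1
    have := hA.pos
    positivity
  have hcoer := FracDiff.Hs.form_coercive hn hs0 hs1 hΩo hΩb hA
  have hsymm := FracDiff.Hs.form_comm hn hs0 hs1 hΩo hΩb hA
  have hform := FracDiff.Hs.form_eq_anisoForm hn hs0 hs1 hΩo hΩb hA
  set a := FracDiff.Hs.form hn hs0 hs1 hΩo hΩb hA
  obtain ⟨u, V, hu, hV, hV0, hVinner, hVnorm⟩ :=
    FracDiff.Hs.exists_parabolic_solution hC hT.le a hsymm hc hcoer hf u₀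
  have hw : MemLp (fun t => f t - a (u t)) 2 (FracDiff.timeMeasure T) :=
    FracDiff.Hs.memLp_sub_form hC a hf hu
  have hsol : FracDiff.IsWeakSolution A T f u₀ u :=
    { memLp := hu
      equation := ⟨fun t => f t - a (u t), hw,
        FracDiff.isTimeDeriv_of_primitive hC hT.le hw hV hVinner,
        Eventually.of_forall fun t v => by
          rw [← hform, sub_apply, sub_add_cancel]⟩
      initial := ⟨V, hV, hV0⟩ }
  refine ⟨fun v => ⟨_, FracDiff.Hs.hasWeightedGrad_weightedGrad hn hs0 hs1 hΩo hΩb v⟩, ⟨C, hC⟩,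
    u, hsol, fun u' hu' => hsol.unique hT hC hform hsymm
      (fun x => le_trans (by positivity) (hcoer x)) hf hu', ?_⟩
  rintro U hU _ rfl Cp hCp - t ht
  -- Any continuous representative equals the constructed one at every time, so the energy identity
  -- of `V` holds for `U`.
  have hUV : U t = V t := FracDiff.eqOn_of_ae_timeMeasure hT hU.1 hV.1
    (by filter_upwards [hU.2, hV.2] with r h1 h2; rw [h1, h2]) ht
  have h1 := FracDiff.Hs.energy_le hC hc hcoer hf hu ht
  -- The estimate holds with factor `1 / Ccoer`, and `Cp ≥ √2` is what makes `Cp² / (2 Ccoer)` at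
  -- least as large.
  have h2 : 1 / (FracDiff.fracLapConst n s / 2 * lmin) * ∫ r in (0 : ℝ)..t, ‖f r‖ ^ 2 ≤
      Cp ^ 2 / (2 * (FracDiff.fracLapConst n s / 2 * lmin)) * ∫ r in (0 : ℝ)..t, ‖f r‖ ^ 2 := by
    refine mul_le_mul_of_nonneg_right ?_
      (intervalIntegral.integral_nonneg ht.1 fun r _ => sq_nonneg _)
    have h3 : 2 ≤ Cp ^ 2 := by
      have := pow_le_pow_left₀ (Real.sqrt_nonneg 2) hCp 2
      rwa [Real.sq_sqrt zero_le_two] at this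
    rw [div_le_div_iff₀ hc (by positivity)]
    nlinarith
  rw [hUV, hVnorm t ht]
  linarith
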